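/- Let $\Sigma\subset\mathbb{H}^3$ be a smooth embedded surface (without boundary) all of whose principal curvatures satisfy $|k_{1,2}|\le 1$, and choose at each point $x\in\Sigma$ one of the two unit normals $\nu(x)$, called the outer normal. A horosphere $H$ is an \emph{outer tangent horosphere} of $\Sigma$ at $p\in\Sigma$ if $p\in H$, $H$ is tangent to $\Sigma$ at $p$ and lies on the side of $\nu(p)$ (the geodesic of $\mathbb{H}^3$ leaving $p$ in direction $\nu(p)$ runs inside the open horoball bounded by $H$), and $\Sigma$ does not meet the open horoball bounded by $H$. Let $p\neq q$ be two points of $\Sigma$ with the same outer tangent horosphere $H$. (1) Every geodesic segment $\gamma$ of $\Sigma$ (for the induced metric) from $p$ to $q$ is contained in $H\cap\Sigma$. Moreover $\gamma$ is also a geodesic of $H$ (for its induced metric), and it is a line of curvature of $\Sigma$. (2) If in addition $\Sigma$ is connected and complete for its induced metric, then there is exactly one unit-speed geodesic segment of $\Sigma$ from $p$ to $q$; so $H\cap\Sigma$ contains the geodesic of $\Sigma$ joining $p$ to $q$, and this geodesic segment is a geodesic of $H$ and a line of curvature of $\Sigma$. -/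

import Mathlib

open Set Filter Topology
open scoped ContDiff

noncomputable section

namespace HypSurf

/-! ### Hyperbolic 3-space: the hyperboloid model -/

/-- The coordinate space `ℝ⁴` that carries the Minkowski form. -/
abbrev E : Type := EuclideanSpace ℝ (Fin 4)

/-- The Minkowski form of signature `(-,+,+,+)`. -/
def mink (x y : E) : ℝ := -(x 0 * y 0) + x 1 * y 1 + x 2 * y 2 + x 3 * y 3

/-- Hyperbolic 3-space: the upper sheet of the hyperboloid `⟨x,x⟩ = -1`. The tangent space at `x`
is the orthogonal complement of `x`, and its Riemannian metric is the restriction of `mink`. -/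
def hyp3 : Set E := {x | mink x x = -1 ∧ 0 < x 0}

/-- Orthogonal projection of a vector of `ℝ⁴` to the tangent space of `hyp3` at `x`. The
Levi-Civita derivative in `hyp3` of a vector field along a curve is this projection of its
ordinary derivative. -/
def tangentProj (x w : E) : E := w + mink w x • x

/-! ### Embedded surfaces -/

/-- A smooth embedded surface in `hyp3` (without boundary): near each of its points, `S` is the
image of a smooth immersion of an open subset of the plane that is a homeomorphism onto its image
with the subspace topology. -/
def IsEmbeddedSurface (S : Set E) : Prop :=
  S ⊆ hyp3 ∧
  ∀ x ∈ S, ∃ (U : Set E) (V : Set (EuclideanSpace ℝ (Fin 2)))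
      (φ : EuclideanSpace ℝ (Fin 2) → E) (ψ : E → EuclideanSpace ℝ (Fin 2)),
    IsOpen U ∧ x ∈ U ∧ IsOpen V ∧ ContDiffOn ℝ ∞ φ V ∧
    (∀ a ∈ V, Function.Injective (fderiv ℝ φ a)) ∧
    φ '' V = S ∩ U ∧ (∀ a ∈ V, ψ (φ a) = a) ∧ ContinuousOn ψ (S ∩ U)

/-- The tangent space of `S` at `x`, as the set of velocities at `x` of curves in `S`. -/
def tangentSet (S : Set E) (x : E) : Set E :=
  {v | ∃ c : ℝ → E, c 0 = x ∧ (∀ᶠ t in 𝓝 (0 : ℝ), c t ∈ S) ∧ HasDerivAt c v 0}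

/-- `ν` is a unit vector of the tangent space of `hyp3` at `x` that is normal to `S`. -/
def IsUnitNormal (S : Set E) (x ν : E) : Prop :=
  mink ν x = 0 ∧ mink ν ν = 1 ∧ ∀ w ∈ tangentSet S x, mink ν w = 0

/-- The shape operator of `S` at `x` with respect to the unit normal `ν` sends the tangent vector
`v` to `w`: that is, `w = -∇_v N`, where `N` is a unit normal field of `S` with `N = ν` at `x`,
differentiated along a curve in `S` with velocity `v` at `x`. -/
def ShapeOperatorMapsTo (S : Set E) (x ν v w : E) : Prop :=
  ∃ (c N : ℝ → E) (N' : E), c 0 = x ∧ N 0 = ν ∧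
    (∀ᶠ t in 𝓝 (0 : ℝ), c t ∈ S ∧ IsUnitNormal S (c t) (N t)) ∧
    HasDerivAt c v 0 ∧ HasDerivAt N N' 0 ∧ w = -tangentProj x N'

/-- `v` is a principal direction of `S` at `x`, with principal curvature `k`: an eigenvector of
the shape operator. Either unit normal may be used, so `k` is determined up to that sign. -/
def IsPrincipalDirection (S : Set E) (x : E) (k : ℝ) (v : E) : Prop :=
  v ≠ 0 ∧ ∃ ν : E, ShapeOperatorMapsTo S x ν v (k • v)

/-- `k` is a principal curvature of `S` at `x` (for one of the two unit normals at `x`). -/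
def IsPrincipalCurvature (S : Set E) (x : E) (k : ℝ) : Prop :=
  ∃ v : E, IsPrincipalDirection S x k v

/-! ### Curves in a surface -/

/-- `γ : [0, L] → S` is a unit-speed geodesic of `S` from `p` to `q`: a curve in `S` whose
acceleration in `hyp3` is everywhere orthogonal to `S`, that is, whose acceleration with respect
to the Levi-Civita connection of the induced metric of `S` vanishes. -/
structure IsGeodesicSegment (S : Set E) (p q : E) (L : ℝ) (γ : ℝ → E) : Prop where
  nonneg : 0 ≤ L
  contDiffOn : ContDiffOn ℝ 2 γ (Icc 0 L)
  mem : ∀ t ∈ Icc 0 L, γ t ∈ S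
  source : γ 0 = p
  target : γ L = q
  unit_speed : ∀ t ∈ Icc 0 L,
    mink (derivWithin γ (Icc 0 L) t) (derivWithin γ (Icc 0 L) t) = 1
  accel : ∀ t ∈ Icc 0 L, ∀ w ∈ tangentSet S (γ t),
    mink (tangentProj (γ t) (derivWithin (derivWithin γ (Icc 0 L)) (Icc 0 L) t)) w = 0

/-- `γ : [0, L] → S` is a line of curvature: its velocity is everywhere a principal direction. -/
def IsLineOfCurvature (S : Set E) (L : ℝ) (γ : ℝ → E) : Prop :=
  ∀ t ∈ Icc 0 L, ∃ k : ℝ, IsPrincipalDirection S (γ t) k (derivWithin γ (Icc 0 L) t)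

/-- The hyperbolic length of a curve parametrized by `[0, 1]`. -/
def curveLength (c : ℝ → E) : ℝ :=
  ∫ t in (0 : ℝ)..1,
    Real.sqrt (mink (derivWithin c (Icc 0 1) t) (derivWithin c (Icc 0 1) t))

/-- The intrinsic distance of `S`: the infimum of the lengths of `C¹` curves in `S` from `x` to
`y` (infinite if there are none). -/
def intrinsicDist (S : Set E) (x y : E) : ENNReal :=
  sInf {l | ∃ c : ℝ → E, ContDiffOn ℝ 1 c (Icc 0 1) ∧ (∀ t ∈ Icc (0 : ℝ) 1, c t ∈ S) ∧
    c 0 = x ∧ c 1 = y ∧ l = ENNReal.ofReal (curveLength c)}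

/-- `S` is complete: Cauchy sequences for the intrinsic distance converge in `S`. -/
def IsCompleteSurface (S : Set E) : Prop :=
  ∀ x : ℕ → E, (∀ i, x i ∈ S) →
    (∀ ε : ENNReal, 0 < ε → ∃ N, ∀ i ≥ N, ∀ j ≥ N, intrinsicDist S (x i) (x j) < ε) →
    ∃ y ∈ S, Tendsto (fun i => intrinsicDist S (x i) y) atTop (𝓝 0)

/-! ### Horospheres -/

/-- Future-pointing null vectors. Each determines a horosphere, centred at the point at infinity
that the vector spans, and every horosphere arises from exactly one of them. -/
def IsFutureNull (n : E) : Prop := mink n n = 0 ∧ 0 < n 0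

/-- The horosphere of the future null vector `n`. -/
def horosphere (n : E) : Set E := {x | x ∈ hyp3 ∧ mink x n = -1}

/-- The open horoball bounded by `horosphere n`. -/
def openHoroball (n : E) : Set E := {x | x ∈ hyp3 ∧ -1 < mink x n}

/-- `horosphere n` is an outer tangent horosphere of `S` at `p` for the outer unit normal `ν`
at `p`: it is tangent to `S` at `p`, on the side of `ν` (the geodesic issuing from `p` in the
direction `ν` runs in the open horoball), and `S` does not meet the open horoball. -/
structure IsOuterTangentHorosphere (S : Set E) (n p ν : E) : Prop where
  null : IsFutureNull n
  mem_surface : p ∈ S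
  mem_horosphere : p ∈ horosphere n
  unitNormal : IsUnitNormal S p ν
  tangent : tangentSet S p = tangentSet (horosphere n) p
  side : ∀ t : ℝ, 0 < t → Real.cosh t • p + Real.sinh t • ν ∈ openHoroball n
  disjoint : Disjoint S (openHoroball n)

end HypSurf

end

open HypSurf

/-! Write ⟨·,·⟩ for the Minkowski form and u(x) = ⟨x, n⟩. The horoball is {u > -1}, so S lies in {u
≤ -1}. As a curve in ℝ⁴, a unit-speed geodesic γ of S satisfies γ'' = γ + κN, with N a unit normal
and κ = II(γ', γ') its normal curvature; the bound on the principal curvatures gives |κ| ≤ 1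
(`IsGeodesicSegment.snd_deriv_eq`). The tangential projection of the null vector n at a point x of
hyperbolic space has length |u(x)|, so |⟨N, n⟩| ≤ -u and (u ∘ γ)'' = u + κ⟨N, n⟩ ≤ 0. Thus u ∘ γ is
concave, equals -1 at both ends and is at most -1 in between: it is constant
(`IsGeodesicSegment.mem_horosphere`). Equality then forces κ = ⟨N, n⟩ = ±1 and n = γ + κN, so γ'' =
n. This vector is normal to the horosphere, so γ is a geodesic there as well; and γ' realizes the
extreme value ±1 of II on unit vectors, so it is an eigenvector of the shape operator
(`IsLocalModel.abs_secondForm_le`).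

From γ'' = n one gets γ(t) = p + tγ'(0) + (t²/2)n, hence ⟨q - p, q - p⟩ = L². The end points
therefore determine L and γ'(0), which is uniqueness (`IsGeodesicSegment.unique`).

What remains for (2) is that some geodesic joins p to q; it need not be shown to be minimizing. The
intrinsic distance is a length distance inducing the subspace topology, so completeness makes its
closed balls compact (`isCompact_closedBall_of_length`). In a compact ball, N-gons from p to q of
least discrete energy exist. At each inner vertex of a minimizer the second difference is normal to
S, and Taylor expansion identifies it with the normal acceleration up to third order
(`IsLocalModel.exists_secondDifference_le`). This bounds steps by O(1/N) and second differences by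
O(1/N²). A limit as N → ∞ is a curve whose acceleration is normal to S, and rescaling it to unit
speed gives the geodesic. -/

namespace HypSurf

/-! ### The Minkowski form -/

lemma mink_comm (x y : E) : mink x y = mink y x := by unfold mink; ring

@[simp] lemma mink_add_left (x y z : E) : mink (x + y) z = mink x z + mink y z := by
  simp [mink]; ring

@[simp] lemma mink_add_right (x y z : E) : mink x (y + z) = mink x y + mink x z := by
  simp [mink]; ring

@[simp] lemma mink_smul_left (a : ℝ) (x y : E) : mink (a • x) y = a * mink x y := by
  simp [mink]; ring

@[simp] lemma mink_smul_right (a : ℝ) (x y : E) : mink x (a • y) = a * mink x y := by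
  simp [mink]; ring

@[simp] lemma mink_neg_left (x y : E) : mink (-x) y = -mink x y := by
  simp [mink]; ring

@[simp] lemma mink_neg_right (x y : E) : mink x (-y) = -mink x y := by
  simp [mink]; ring

@[simp] lemma mink_sub_left (x y z : E) : mink (x - y) z = mink x z - mink y z := by
  simp [mink]; ring

@[simp] lemma mink_sub_right (x y z : E) : mink x (y - z) = mink x y - mink x z := by
  simp [mink]; ring

@[simp] lemma mink_zero_left (y : E) : mink 0 y = 0 := by simp [mink]

@[simp] lemma mink_zero_right (y : E) : mink y 0 = 0 := by simp [mink]

lemma norm_sq_eq_coords (x : E) : ‖x‖ ^ 2 = x 0 ^ 2 + x 1 ^ 2 + x 2 ^ 2 + x 3 ^ 2 := by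
  rw [EuclideanSpace.norm_sq_eq, Fin.sum_univ_four]; simp

lemma abs_mink_le (x y : E) : |mink x y| ≤ ‖x‖ * ‖y‖ := by
  apply abs_le_of_sq_le_sq _ (by positivity)
  rw [mul_pow, norm_sq_eq_coords, norm_sq_eq_coords]
  unfold mink
  nlinarith [sq_nonneg (x 0 * y 1 + x 1 * y 0), sq_nonneg (x 0 * y 2 + x 2 * y 0),
    sq_nonneg (x 0 * y 3 + x 3 * y 0), sq_nonneg (x 1 * y 2 - x 2 * y 1),
    sq_nonneg (x 1 * y 3 - x 3 * y 1), sq_nonneg (x 2 * y 3 - x 3 * y 2)]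

lemma mink_self_le (x : E) : mink x x ≤ ‖x‖ ^ 2 := by
  have := (le_abs_self _).trans (abs_mink_le x x); rwa [← sq] at this

lemma isBoundedBilinearMap_mink : IsBoundedBilinearMap ℝ (fun z : E × E => mink z.1 z.2) where
  add_left := by simp
  smul_left := by simp
  add_right := by simp
  smul_right := by simp
  bound := ⟨1, one_pos, fun x y => by simpa using abs_mink_le x y⟩

lemma continuous_mink : Continuous (fun z : E × E => mink z.1 z.2) :=
  isBoundedBilinearMap_mink.continuous

lemma contDiff_mink {m : WithTop ℕ∞} : ContDiff ℝ m (fun z : E × E => mink z.1 z.2) :=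
  isBoundedBilinearMap_mink.contDiff

lemma hasDerivWithinAt_mink {a b : ℝ → E} {a' b' : E} {s : Set ℝ} {t : ℝ}
    (ha : HasDerivWithinAt a a' s t) (hb : HasDerivWithinAt b b' s t) :
    HasDerivWithinAt (fun t => mink (a t) (b t))
      (mink (a t) b' + mink a' (b t)) s t := by
  have h := (isBoundedBilinearMap_mink.hasFDerivAt (a t, b t)).comp_hasDerivWithinAt t
    (ha.prodMk hb)
  simp only [IsBoundedBilinearMap.deriv_apply] at h
  exact h

lemma hasDerivAt_mink {a b : ℝ → E} {a' b' : E} {t : ℝ}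
    (ha : HasDerivAt a a' t) (hb : HasDerivAt b b' t) :
    HasDerivAt (fun t => mink (a t) (b t))
      (mink (a t) b' + mink a' (b t)) t := by
  rw [← hasDerivWithinAt_univ] at *
  exact hasDerivWithinAt_mink ha hb

/-- A vector orthogonal to a timelike vector is spacelike, quantitatively. -/
lemma norm_sq_le_of_orthogonal {m d : E} (hm : mink m m ≤ -1) (h : mink d m = 0) :
    ‖d‖ ^ 2 ≤ 2 * m 0 ^ 2 * mink d d := by
  rw [norm_sq_eq_coords]
  unfold mink at *
  set s := d 1 ^ 2 + d 2 ^ 2 + d 3 ^ 2 with hs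
  -- Cauchy-Schwarz on the spatial parts, where the spatial part of m has square at most m₀² - 1.
  -- Rearranged, it says s ≤ m₀²(s - d₀²), which with d₀² ≤ s gives the claim.
  have h1 : (d 0 * m 0) ^ 2 ≤ s * (m 0 ^ 2 - 1) := by
    have e : d 0 * m 0 = d 1 * m 1 + d 2 * m 2 + d 3 * m 3 := by linarith
    have c : (d 1 * m 1 + d 2 * m 2 + d 3 * m 3) ^ 2
        ≤ s * (m 1 ^ 2 + m 2 ^ 2 + m 3 ^ 2) := by
      nlinarith [sq_nonneg (d 1 * m 2 - d 2 * m 1), sq_nonneg (d 1 * m 3 - d 3 * m 1),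
        sq_nonneg (d 2 * m 3 - d 3 * m 2)]
    rw [e]
    refine c.trans (mul_le_mul_of_nonneg_left (by linarith) (by positivity))
  have h0 : 0 ≤ s := by positivity
  have h2 : 1 ≤ m 0 ^ 2 := by nlinarith [sq_nonneg (m 1), sq_nonneg (m 2), sq_nonneg (m 3)]
  have h3 : d 0 ^ 2 ≤ s := by
    by_contra hc
    push Not at hc
    nlinarith [mul_lt_mul_of_pos_right hc (by linarith : 0 < m 0 ^ 2)]
  have h4 : -(d 0 * d 0) + d 1 * d 1 + d 2 * d 2 + d 3 * d 3 = s - d 0 ^ 2 := by rw [hs]; ring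
  rw [h4]
  nlinarith

lemma mink_self_nonneg_of_orthogonal {x v : E} (hx : mink x x = -1) (h : mink v x = 0) :
    0 ≤ mink v v := by
  have h1 := norm_sq_le_of_orthogonal hx.le h
  have h2 : 0 < x 0 ^ 2 := by
    unfold mink at hx
    nlinarith [sq_nonneg (x 1), sq_nonneg (x 2), sq_nonneg (x 3)]
  by_contra hc
  push Not at hc
  nlinarith [sq_nonneg ‖v‖]

lemma eq_zero_of_orthogonal {x v : E} (hx : mink x x = -1) (h : mink v x = 0)
    (h0 : mink v v ≤ 0) : v = 0 := by
  have h1 := norm_sq_le_of_orthogonal hx.le h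
  have h3 : ‖v‖ ^ 2 ≤ 0 := h1.trans (mul_nonpos_of_nonneg_of_nonpos (by positivity) h0)
  have h4 : ‖v‖ = 0 := by nlinarith [norm_nonneg v]
  simpa using h4

lemma mink_self_pos_of_orthogonal {x v : E} (hx : mink x x = -1) (h : mink v x = 0)
    (hv : v ≠ 0) : 0 < mink v v := by
  by_contra hc
  exact hv (eq_zero_of_orthogonal hx h (not_lt.mp hc))

/-- The Cauchy-Schwarz inequality in the orthogonal complement of a timelike vector. -/
lemma mink_sq_le {x v w : E} (hx : mink x x = -1) (hv : mink v x = 0) (hw : mink w x = 0) :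
    mink v w ^ 2 ≤ mink v v * mink w w := by
  have h0 := mink_self_nonneg_of_orthogonal hx hw
  have key := mink_self_nonneg_of_orthogonal hx
    (v := mink w w • v - mink v w • w) (by simp [hv, hw])
  simp only [mink_sub_left, mink_sub_right, mink_smul_left, mink_smul_right,
    mink_comm w v] at key
  rcases h0.eq_or_lt with h | h
  · have : w = 0 := eq_zero_of_orthogonal hx hw h.symm.le
    simp [this]
  · have : 0 ≤ mink w w * (mink v v * mink w w - mink v w ^ 2) := by nlinarith
    have := nonneg_of_mul_nonneg_right this h
    linarith

lemma mink_lt_zero {x y : E} (hx : x ∈ hyp3) (hy : y ∈ hyp3) : mink x y < 0 := by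
  obtain ⟨hx1, hx0⟩ := hx
  obtain ⟨hy1, hy0⟩ := hy
  unfold mink at *
  have c : (x 1 * y 1 + x 2 * y 2 + x 3 * y 3) ^ 2
      ≤ (x 1 ^ 2 + x 2 ^ 2 + x 3 ^ 2) * (y 1 ^ 2 + y 2 ^ 2 + y 3 ^ 2) := by
    nlinarith [sq_nonneg (x 1 * y 2 - x 2 * y 1), sq_nonneg (x 1 * y 3 - x 3 * y 1),
      sq_nonneg (x 2 * y 3 - x 3 * y 2)]
  have c2 : (x 1 * y 1 + x 2 * y 2 + x 3 * y 3) ^ 2 < (x 0 * y 0) ^ 2 := by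
    refine c.trans_lt ?_
    rw [mul_pow]
    exact mul_lt_mul'' (by nlinarith) (by nlinarith) (by positivity) (by positivity)
  have := lt_of_pow_lt_pow_left₀ 2 (by positivity) c2
  linarith

/-- The sum x + y is timelike and orthogonal to x - y, so chords of the hyperboloid are spacelike
and control the Euclidean distance at bounded height. -/
lemma norm_sub_sq_le {x y : E} (hx : x ∈ hyp3) (hy : y ∈ hyp3) :
    ‖x - y‖ ^ 2 ≤ 2 * (x 0 + y 0) ^ 2 * mink (x - y) (x - y) := by
  have h := mink_lt_zero hx hy
  have := norm_sq_le_of_orthogonal (m := x + y) (d := x - y)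
    (by simp [hx.1, hy.1, mink_comm y x]; linarith)
    (by simp [hx.1, hy.1, mink_comm y x]; ring)
  simpa using this

lemma mink_chord {x y : E} (hx : x ∈ hyp3) (hy : y ∈ hyp3) :
    mink (x - y) (x - y) = 2 * (-1 - mink x y) := by
  simp [hx.1, hy.1, mink_comm y x]; ring

lemma mink_chord_nonneg {x y : E} (hx : x ∈ hyp3) (hy : y ∈ hyp3) :
    0 ≤ mink (x - y) (x - y) := by
  have := norm_sub_sq_le hx hy
  have h0 : 0 < (x 0 + y 0) ^ 2 := by have := hx.2; have := hy.2; positivity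
  by_contra hc
  push Not at hc
  nlinarith [sq_nonneg ‖x - y‖]

lemma mink_le_neg_one {x y : E} (hx : x ∈ hyp3) (hy : y ∈ hyp3) : mink x y ≤ -1 := by
  have := mink_chord_nonneg hx hy
  rw [mink_chord hx hy] at this
  linarith

/-- The vector that represents a linear form with respect to the Minkowski form. -/
noncomputable def minkRep : (E →L[ℝ] ℝ) →L[ℝ] E :=
  ∑ i : Fin 4, ((if i = 0 then (-1 : ℝ) else 1) •
    (ContinuousLinearMap.apply ℝ ℝ (EuclideanSpace.single i (1 : ℝ) : E)).smulRight
      (EuclideanSpace.single i (1 : ℝ) : E))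

lemma mink_minkRep (f : E →L[ℝ] ℝ) (w : E) : mink (minkRep f) w = f w := by
  have hw : w = ∑ i : Fin 4, w i • (EuclideanSpace.single i (1 : ℝ) : E) := by
    ext j; fin_cases j <;> simp [Fin.sum_univ_four]
  conv_rhs => rw [hw, map_sum]
  simp [minkRep, Fin.sum_univ_four, mink]
  ring

lemma three_le_infty : (3 : WithTop ℕ∞) ≤ ∞ :=
  WithTop.coe_le_coe.mpr (le_top : (3 : ℕ∞) ≤ ⊤)

/-! ### Smooth local retractions onto a surface -/

/-- `r` is a local smooth retraction of the open set `W` onto the surface `S`. -/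
structure IsLocalRetraction (S W : Set E) (r : E → E) : Prop where
  isOpen : IsOpen W
  contDiffOn : ContDiffOn ℝ 3 r W
  mapsTo : ∀ y ∈ W, r y ∈ S
  fix : ∀ y ∈ S, y ∈ W → r y = y
  finrank_range : ∀ y ∈ S, y ∈ W → Module.finrank ℝ (fderiv ℝ r y).range = 2

/-- Composing a left inverse of the differential of φ with φ gives a local diffeomorphism of the
plane; its local inverse extends the chart to a map Ψ on an open subset of ℝ⁴, and φ ∘ Ψ is the
retraction. Later arguments differentiate this map instead of working in charts. -/
lemma IsEmbeddedSurface.exists_isLocalRetraction {S : Set E} (hS : IsEmbeddedSurface S)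
    {x₀ : E} (hx₀ : x₀ ∈ S) : ∃ W r, x₀ ∈ W ∧ IsLocalRetraction S W r := by
  obtain ⟨U, V, φ, ψ, hU, hxU, hV, hφ, hinj, himg, hψφ, hψ⟩ := hS.2 x₀ hx₀
  obtain ⟨a₀, ha₀, rfl⟩ : x₀ ∈ φ '' V := himg ▸ ⟨hx₀, hxU⟩
  have hφa : ∀ a ∈ V, ContDiffAt ℝ ∞ φ a := fun a ha => hφ.contDiffAt (hV.mem_nhds ha)
  have hdφ : ∀ a ∈ V, HasFDerivAt φ (fderiv ℝ φ a) a := fun a ha =>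
    ((hφa a ha).differentiableAt (by simp)).hasFDerivAt
  obtain ⟨l, hl⟩ := (fderiv ℝ φ a₀).toLinearMap.exists_leftInverse_of_injective
    (LinearMap.ker_eq_bot.mpr (hinj a₀ ha₀))
  set l' : E →L[ℝ] EuclideanSpace ℝ (Fin 2) := LinearMap.toContinuousLinearMap l with hl'
  have hl'φ : l'.comp (fderiv ℝ φ a₀) = ContinuousLinearMap.id ℝ _ := by
    ext1 v
    simpa [hl'] using LinearMap.congr_fun hl v
  have hh : ContDiffAt ℝ ∞ (l' ∘ φ) a₀ := l'.contDiff.contDiffAt.comp a₀ (hφa a₀ ha₀)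
  have hh' : HasFDerivAt (l' ∘ φ)
      ((ContinuousLinearEquiv.refl ℝ (EuclideanSpace ℝ (Fin 2)) : _ →L[ℝ] _)) a₀ := by
    have := l'.hasFDerivAt.comp a₀ (hdφ a₀ ha₀)
    rwa [hl'φ] at this
  have hn : (∞ : WithTop ℕ∞) ≠ 0 := by simp
  set g := hh.localInverse hh' hn with hg
  have hgs : ContDiffAt ℝ ∞ g (l' (φ a₀)) := hh.to_localInverse hh' hn
  have hga : g (l' (φ a₀)) = a₀ := hh.localInverse_apply_image hh' hn
  have hgl : ∀ᶠ b in 𝓝 a₀, g (l' (φ b)) = b :=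
    (hh.hasStrictFDerivAt' hh' hn).eventually_left_inverse
  set Ψ : E → EuclideanSpace ℝ (Fin 2) := g ∘ l' with hΨ
  have hΨs : ContDiffAt ℝ 3 Ψ (φ a₀) :=
    (hgs.comp (φ a₀) l'.contDiff.contDiffAt).of_le three_le_infty
  have e1 : ∀ᶠ y in 𝓝 (φ a₀), ContDiffAt ℝ 3 Ψ y := hΨs.eventually (by simp)
  have e2 : ∀ᶠ y in 𝓝 (φ a₀), Ψ y ∈ V :=
    hΨs.continuousAt.eventually_mem (by simpa [hΨ, hga] using hV.mem_nhds ha₀)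
  -- Embeddedness enters here: continuity of ψ puts the parameter of a nearby point of S close to
  -- a₀, where Ψ inverts φ.
  have e3 : ∀ᶠ y in 𝓝 (φ a₀), y ∈ S → ∃ b ∈ V, φ b = y ∧ Ψ y = b := by
    have c := hψ (φ a₀) ⟨hx₀, hxU⟩
    have c1 : ∀ᶠ y in 𝓝[S ∩ U] (φ a₀), g (l' (φ (ψ y))) = ψ y := by
      exact c.eventually (p := fun b => g (l' (φ b)) = b) (by rwa [hψφ a₀ ha₀])
    rw [eventually_nhdsWithin_iff] at c1
    filter_upwards [c1, hU.mem_nhds hxU] with y hy hyU hyS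
    obtain ⟨b, hb, rfl⟩ : y ∈ φ '' V := himg ▸ ⟨hyS, hyU⟩
    have := hy ⟨hyS, hyU⟩
    rw [hψφ b hb] at this
    exact ⟨b, hb, rfl, this⟩
  obtain ⟨W, hW, hWo, hxW⟩ := eventually_nhds_iff.mp (e1.and (e2.and e3))
  have hr : ∀ y ∈ W, ContDiffAt ℝ 3 (φ ∘ Ψ) y := fun y hy =>
    ((hφa _ (hW y hy).2.1).of_le three_le_infty).comp y (hW y hy).1
  have hfix : ∀ y ∈ S, y ∈ W → φ (Ψ y) = y := by
    intro y hy hyW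
    obtain ⟨b, -, h1, h2⟩ := (hW y hyW).2.2 hy
    rw [h2, h1]
  refine ⟨W, φ ∘ Ψ, hxW, hWo, fun y hy => (hr y hy).contDiffWithinAt, ?_, hfix, ?_⟩
  · intro y hy
    have : φ (Ψ y) ∈ φ '' V := mem_image_of_mem _ (hW y hy).2.1
    exact (himg ▸ this).1
  · intro y hy hyW
    obtain ⟨b, hbV, hby, hΨb⟩ := (hW y hyW).2.2 hy
    have hdr : HasFDerivAt (φ ∘ Ψ) ((fderiv ℝ φ b).comp (fderiv ℝ Ψ y)) y := by
      have := ((hW y hyW).1.differentiableAt (by simp)).hasFDerivAt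
      exact HasFDerivAt.comp y (by rw [hΨb]; exact hdφ b hbV) this
    have hcomp : (fderiv ℝ (φ ∘ Ψ) y).comp (fderiv ℝ φ b) = fderiv ℝ φ b := by
      have h1 : HasFDerivAt ((φ ∘ Ψ) ∘ φ) ((fderiv ℝ (φ ∘ Ψ) y).comp (fderiv ℝ φ b)) b :=
        HasFDerivAt.comp b (by rw [hby]; exact hdr.differentiableAt.hasFDerivAt) (hdφ b hbV)
      refine h1.unique ((hdφ b hbV).congr_of_eventuallyEq ?_)
      have hWb : ∀ᶠ a in 𝓝 b, φ a ∈ W :=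
        (hφa b hbV).continuousAt.eventually_mem (by rw [hby]; exact hWo.mem_nhds hyW)
      filter_upwards [hWb, hV.mem_nhds hbV] with a haW haV
      have : φ a ∈ φ '' V := mem_image_of_mem _ haV
      exact hfix _ (himg ▸ this).1 haW
    -- One inclusion is the chain rule for φ ∘ Ψ; the other holds because the retraction fixes the
    -- image of φ near y.
    have hrange : (fderiv ℝ (φ ∘ Ψ) y).range = (fderiv ℝ φ b).range := by
      apply le_antisymm
      · rintro _ ⟨w, rfl⟩
        exact ⟨fderiv ℝ Ψ y w, by simp [hdr.fderiv]⟩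
      · rintro _ ⟨w, rfl⟩
        exact ⟨fderiv ℝ φ b w, congrArg (fun f => f w) hcomp⟩
    rw [hrange]
    have := LinearMap.finrank_range_of_inj (f := (fderiv ℝ φ b).toLinearMap) (hinj b hbV)
    simpa using this

lemma mink_eq_zero_of_mem_tangentSet {S : Set E} (hS : S ⊆ hyp3) {x v : E}
    (hv : v ∈ tangentSet S x) : mink v x = 0 := by
  obtain ⟨c, h0, hc, hd⟩ := hv
  have h1 := hasDerivAt_mink hd hd
  have h2 : HasDerivAt (fun t => mink (c t) (c t)) 0 0 := by
    refine (hasDerivAt_const (0 : ℝ) (-1 : ℝ)).congr_of_eventuallyEq ?_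
    filter_upwards [hc] with t ht using (hS ht).1
  have := h1.unique h2
  rw [h0, mink_comm x v] at this
  linarith

namespace IsLocalRetraction

variable {S W : Set E} {r : E → E} {y : E}

lemma contDiffAt (h : IsLocalRetraction S W r) (hy : y ∈ W) : ContDiffAt ℝ 3 r y :=
  h.contDiffOn.contDiffAt (h.isOpen.mem_nhds hy)

lemma hasFDerivAt (h : IsLocalRetraction S W r) (hy : y ∈ W) :
    HasFDerivAt r (fderiv ℝ r y) y :=
  ((h.contDiffAt hy).differentiableAt (by simp)).hasFDerivAt

lemma fderiv_apply_of_mem (h : IsLocalRetraction S W r) (hy : y ∈ W) {v : E}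
    (hv : v ∈ tangentSet S y) : fderiv ℝ r y v = v := by
  obtain ⟨c, h0, hc, hd⟩ := hv
  have hy' : HasFDerivAt r (fderiv ℝ r y) (c 0) := by rw [h0]; exact h.hasFDerivAt hy
  have h1 := hy'.comp_hasDerivAt 0 hd
  refine h1.unique (hd.congr_of_eventuallyEq ?_)
  have : ∀ᶠ t in 𝓝 (0 : ℝ), c t ∈ W :=
    hd.continuousAt.eventually_mem (by rw [h0]; exact h.isOpen.mem_nhds hy)
  filter_upwards [hc, this] with t h1 h2 using h.fix _ h1 h2

/-- The curve in `S` obtained by projecting a straight line. -/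
lemma exists_curve (h : IsLocalRetraction S W r) (hy : y ∈ W) (w : E) :
    (∀ᶠ t in 𝓝 (0 : ℝ), r (y + t • w) ∈ S) ∧
      HasDerivAt (fun t : ℝ => r (y + t • w)) (fderiv ℝ r y w) 0 := by
  have hd : HasDerivAt (fun t : ℝ => y + t • w) w 0 := by
    simpa using ((hasDerivAt_id (0 : ℝ)).smul_const w).const_add y
  have hW : ∀ᶠ t in 𝓝 (0 : ℝ), y + t • w ∈ W :=
    hd.continuousAt.eventually_mem (by simpa using h.isOpen.mem_nhds hy)
  refine ⟨by filter_upwards [hW] with t ht using h.mapsTo _ ht, ?_⟩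
  have hy' : HasFDerivAt r (fderiv ℝ r y) (y + (0 : ℝ) • w) := by
    simpa using h.hasFDerivAt hy
  exact hy'.comp_hasDerivAt 0 hd

lemma fderiv_mem (h : IsLocalRetraction S W r) (hyS : y ∈ S) (hy : y ∈ W) (w : E) :
    fderiv ℝ r y w ∈ tangentSet S y :=
  ⟨_, by simpa using h.fix y hyS hy, (h.exists_curve hy w).1, (h.exists_curve hy w).2⟩

/-- The differential of r fixes every velocity of S, and its values are velocities of projected
lines. This turns a set of velocities into a linear space of dimension 2. -/
lemma tangentSet_eq_range (h : IsLocalRetraction S W r) (hyS : y ∈ S) (hy : y ∈ W) :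
    tangentSet S y = (fderiv ℝ r y).range := by
  ext v
  constructor
  · intro hv
    exact ⟨v, h.fderiv_apply_of_mem hy hv⟩
  · rintro ⟨w, rfl⟩
    exact h.fderiv_mem hyS hy w

/-- A vector normal to both `y` and a unit normal of the surface is tangent. -/
lemma mem_tangentSet (h : IsLocalRetraction S W r) (hS : S ⊆ hyp3) (hyS : y ∈ S) (hy : y ∈ W)
    {ν : E} (hν : IsUnitNormal S y ν) {z : E} (h1 : mink z y = 0) (h2 : mink z ν = 0) :
    z ∈ tangentSet S y := by
  rw [h.tangentSet_eq_range hyS hy]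
  let B : E →ₗ[ℝ] E →ₗ[ℝ] ℝ := LinearMap.mk₂ ℝ mink (by simp) (by simp) (by simp) (by simp)
  let Φ : E →ₗ[ℝ] ℝ × ℝ := (B y).prod (B ν)
  have hyy := (hS hyS).1
  have hsurj : Function.Surjective Φ := by
    rintro ⟨a, b⟩
    refine ⟨-a • y + b • ν, ?_⟩
    simp [Φ, B, hyy, hν.1, hν.2.1, mink_comm y ν]
  -- The two orthogonality conditions are independent, so their common kernel has dimension 4 - 2 =
  -- 2, the dimension of the tangent plane it contains.
  have hker : Module.finrank ℝ (LinearMap.ker Φ) = 2 := by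
    have := LinearMap.finrank_range_add_finrank_ker Φ
    rw [LinearMap.range_eq_top.mpr hsurj] at this
    simp at this
    omega
  have hle : ((fderiv ℝ r y).range : Submodule ℝ E) ≤ LinearMap.ker Φ := by
    intro v hv
    have hv' : v ∈ tangentSet S y := by rw [h.tangentSet_eq_range hyS hy]; exact hv
    have a := mink_eq_zero_of_mem_tangentSet hS hv'
    have b := hν.2.2 v hv'
    simp [Φ, B, mink_comm y v, a, b]
  have heq := Submodule.eq_of_le_of_finrank_eq hle
    ((h.finrank_range y hyS hy).trans hker.symm)
  have : z ∈ LinearMap.ker Φ := by simp [Φ, B, mink_comm y z, mink_comm ν z, h1, h2]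
  rw [← heq] at this
  exact this

end IsLocalRetraction

/-- A local retraction together with a smooth unit normal field. -/
structure IsLocalModel (S W : Set E) (r N : E → E) : Prop extends IsLocalRetraction S W r where
  contDiffOn_normal : ContDiffOn ℝ 2 N W
  unitNormal : ∀ y ∈ S, y ∈ W → IsUnitNormal S y (N y)

/-- The form w ↦ ⟨ν₀, w - dr(w)⟩ vanishes on tangent vectors, since dr fixes them. Its Minkowski
representative, made orthogonal to y and normalized where its square is positive, is a unit normal
field. It is C² because r is C³. -/
lemma IsEmbeddedSurface.exists_isLocalModel {S : Set E} (hS : IsEmbeddedSurface S)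
    {x₀ ν₀ : E} (hx₀ : x₀ ∈ S) (hν₀ : IsUnitNormal S x₀ ν₀) :
    ∃ W r N, x₀ ∈ W ∧ IsLocalModel S W r N := by
  obtain ⟨W, r, hxW, h⟩ := hS.exists_isLocalRetraction hx₀
  let B : E →L[ℝ] ℝ := isBoundedBilinearMap_mink.toContinuousLinearMap ν₀
  have hB : ∀ w, B w = mink ν₀ w := fun w => rfl
  let N₁ : E → E := fun y => minkRep (B.comp (ContinuousLinearMap.id ℝ E - fderiv ℝ r y))
  have hN₁ : ∀ y w, mink (N₁ y) w = mink ν₀ w - mink ν₀ (fderiv ℝ r y w) := by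
    intro y w
    simp [N₁, mink_minkRep, hB]
  have hdr : ContDiffOn ℝ 2 (fderiv ℝ r) W := h.contDiffOn.fderiv_of_isOpen h.isOpen (by norm_num)
  have hN₁s : ContDiffOn ℝ 2 N₁ W := by
    refine minkRep.contDiff.comp_contDiffOn ?_
    exact (contDiffOn_const.clm_comp (contDiffOn_const.sub hdr))
  let N₂ : E → E := fun y => N₁ y + mink (N₁ y) y • y
  have hN₂s : ContDiffOn ℝ 2 N₂ W := by
    refine hN₁s.add (ContDiffOn.fun_smul ?_ contDiffOn_fun_id)
    exact contDiff_mink.comp_contDiffOn (hN₁s.prodMk contDiffOn_id)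
  have hqs : ContDiffOn ℝ 2 (fun y => mink (N₂ y) (N₂ y)) W :=
    contDiff_mink.comp_contDiffOn (hN₂s.prodMk hN₂s)
  have hx₀' := (hS.1 hx₀).1
  have hN₂x : N₂ x₀ ≠ 0 := by
    intro h0
    have h1 : mink (N₂ x₀) ν₀ = 1 := by
      have := hν₀.2.2 _ (h.fderiv_mem hx₀ hxW ν₀)
      simp [N₂, hN₁, this, hν₀.1, hν₀.2.1, mink_comm x₀ ν₀]
    rw [h0] at h1
    simp at h1
  have horth : ∀ y ∈ S, mink (N₂ y) y = 0 := by
    intro y hy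
    simp [N₂, (hS.1 hy).1]
  have hpos : 0 < mink (N₂ x₀) (N₂ x₀) :=
    mink_self_pos_of_orthogonal hx₀' (horth x₀ hx₀) hN₂x
  let W' : Set E := W ∩ (fun y => mink (N₂ y) (N₂ y)) ⁻¹' (Ioi 0)
  have hW' : IsOpen W' := hqs.continuousOn.isOpen_inter_preimage h.isOpen isOpen_Ioi
  refine ⟨W', r, fun y => (Real.sqrt (mink (N₂ y) (N₂ y)))⁻¹ • N₂ y, ⟨hxW, hpos⟩,
    ⟨hW', h.contDiffOn.mono inter_subset_left, fun y hy => h.mapsTo y hy.1,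
      fun y hy hyW => h.fix y hy hyW.1, fun y hy hyW => h.finrank_range y hy hyW.1⟩, ?_, ?_⟩
  · refine ContDiffOn.smul (ContDiffOn.inv (ContDiffOn.sqrt (hqs.mono inter_subset_left) ?_) ?_)
      (hN₂s.mono inter_subset_left)
    · intro y hy; exact hy.2.ne'
    · intro y hy; exact (Real.sqrt_pos.mpr hy.2).ne'
  · intro y hy hyW
    have hp : 0 < mink (N₂ y) (N₂ y) := hyW.2
    refine ⟨by simp [horth y hy], ?_, ?_⟩
    · have := Real.mul_self_sqrt hp.le
      have hne := (Real.sqrt_pos.mpr hp).ne'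
      simp only [mink_smul_left, mink_smul_right]
      field_simp
      linarith
    · intro w hw
      have h1 := mink_eq_zero_of_mem_tangentSet hS.1 hw
      have h2 := h.fderiv_apply_of_mem hyW.1 hw
      simp only [mink_smul_left, N₂, mink_add_left, hN₁, h2, mink_comm y w, h1]
      simp

/-! ### The second fundamental form and the principal curvatures -/

lemma eq_zero_of_forall_quadratic_nonneg {a c : ℝ} (h : ∀ t : ℝ, 0 ≤ 2 * t * a + t ^ 2 * c) :
    a = 0 := by
  have hd : ∀ t : ℝ, HasDerivAt (fun t : ℝ => 2 * t * a + t ^ 2 * c) (2 * a + 2 * t * c) t := by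
    intro t
    have := (((hasDerivAt_id t).const_mul 2).mul_const a).fun_add
      (((hasDerivAt_id t).pow 2).mul_const c)
    simpa using this
  have hmin : IsLocalMin (fun t : ℝ => 2 * t * a + t ^ 2 * c) 0 :=
    Eventually.of_forall fun t => by simpa using h t
  have := hmin.hasDerivAt_eq_zero (hd 0)
  linarith

/-- A vector on which a positive semidefinite form vanishes lies in its kernel. -/
lemma bilin_eq_of_quadratic_eq {T : Submodule ℝ E} {b : E → E → ℝ} {l : ℝ}
    (hadd : ∀ u v w, b (u + v) w = b u w + b v w) (hsmul : ∀ (a : ℝ) u w, b (a • u) w = a * b u w)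
    (hsymm : ∀ u ∈ T, ∀ w ∈ T, b u w = b w u)
    (hle : ∀ w ∈ T, b w w ≤ l * mink w w) {u : E} (hu : u ∈ T) (hu' : b u u = l * mink u u)
    {w : E} (hw : w ∈ T) : b u w = l * mink u w := by
  have key : l * mink u w - b u w = 0 := by
    -- The semidefinite form l⟨·,·⟩ - b at u + tw is a quadratic in t without constant term;
    -- nonnegativity kills its linear coefficient.
    refine eq_zero_of_forall_quadratic_nonneg (c := l * mink w w - b w w) fun t => ?_
    have htw := T.smul_mem t hw
    have h1 := hle _ (T.add_mem hu htw)
    rw [hadd, hsymm u hu _ (T.add_mem hu htw), hsymm (t • w) htw _ (T.add_mem hu htw),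
      hadd, hadd, hsmul, hsymm u hu _ htw, hsmul, hsmul, hsymm w hw _ htw, hsmul,
      hsymm w hw u hu] at h1
    rw [hsymm u hu w hw] at h1 ⊢
    simp only [mink_add_left, mink_add_right, mink_smul_left, mink_smul_right,
      mink_comm w u] at h1
    rw [hsymm w hw u hu] at h1 ⊢
    nlinarith
  linarith

/-- If every eigenvalue of a symmetric form is at most `1`, the form is at most the metric. -/
lemma bilin_le_of_eigenvalue_le {y : E} (hy : mink y y = -1) {T : Submodule ℝ E}
    (hT : ∀ w ∈ T, mink w y = 0) {b : E →L[ℝ] E →L[ℝ] ℝ}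
    (hsymm : ∀ u ∈ T, ∀ w ∈ T, b u w = b w u)
    (heig : ∀ k : ℝ, ∀ u ∈ T, u ≠ 0 → (∀ w ∈ T, b u w = k * mink u w) → k ≤ 1)
    {w : E} (hw : w ∈ T) : b w w ≤ mink w w := by
  rcases eq_or_ne w 0 with rfl | hw0
  · simp
  have hpos : ∀ u ∈ T, u ≠ 0 → 0 < mink u u := fun u hu hu0 =>
    mink_self_pos_of_orthogonal hy (hT u hu) hu0
  have hnormalize : ∀ u ∈ T, u ≠ 0 → ∃ s : ℝ, s ^ 2 * mink u u = 1 := by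
    intro u hu hu0
    have h := hpos u hu hu0
    refine ⟨(Real.sqrt (mink u u))⁻¹, ?_⟩
    rw [inv_pow, Real.sq_sqrt h.le, inv_mul_cancel₀ h.ne']
  let K : Set E := {u | u ∈ T ∧ mink u u = 1}
  have hmm : Continuous fun u : E => mink u u :=
    continuous_mink.comp (continuous_id.prodMk continuous_id)
  have hK : IsCompact K := by
    apply Metric.isCompact_of_isClosed_isBounded
    · exact T.closed_of_finiteDimensional.inter (isClosed_eq hmm continuous_const)
    · refine isBounded_iff_forall_norm_le.mpr ⟨Real.sqrt (2 * y 0 ^ 2), fun u hu => ?_⟩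
      apply Real.le_sqrt_of_sq_le
      have := norm_sq_le_of_orthogonal hy.le (hT u hu.1)
      rwa [hu.2, mul_one] at this
  have hne : K.Nonempty := by
    obtain ⟨s, hs⟩ := hnormalize w hw hw0
    exact ⟨s • w, T.smul_mem s hw, by simp; linarith⟩
  have hb : Continuous fun u : E => b u u := by fun_prop
  -- A maximizer of b on the unit sphere of T is an eigenvector with eigenvalue `b u u`, so `heig`
  -- bounds the maximum.
  obtain ⟨u, hu, hmax⟩ := hK.exists_isMaxOn hne hb.continuousOn
  have hle : ∀ v ∈ T, b v v ≤ b u u * mink v v := by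
    intro v hv
    rcases eq_or_ne v 0 with rfl | hv0
    · simp
    obtain ⟨s, hs⟩ := hnormalize v hv hv0
    have h1 : b (s • v) (s • v) ≤ b u u := hmax ⟨T.smul_mem s hv, by simp; linarith⟩
    have h2 := mul_le_mul_of_nonneg_right h1 (hpos v hv hv0).le
    calc b v v = (s ^ 2 * mink v v) * b v v := by rw [hs, one_mul]
      _ = b (s • v) (s • v) * mink v v := by simp; ring
      _ ≤ _ := h2
  have hu0 : u ≠ 0 := by
    rintro rfl
    have := hu.2
    simp at this
  have hk := heig (b u u) u hu.1 hu0 fun v hv =>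
    bilin_eq_of_quadratic_eq (b := fun u v => b u v) (by simp) (by simp) hsymm hle hu.1
      (by simp [hu.2]) hv
  have := hle w hw
  nlinarith [hpos w hw hw0]

namespace IsLocalModel

variable {S W : Set E} {r N : E → E} {y : E}

lemma hasFDerivAt_normal (h : IsLocalModel S W r N) (hy : y ∈ W) :
    HasFDerivAt N (fderiv ℝ N y) y :=
  ((h.contDiffOn_normal.contDiffAt (h.isOpen.mem_nhds hy)).differentiableAt
    (by simp)).hasFDerivAt

lemma _root_.HypSurf.IsLocalRetraction.hasFDerivAt_fderiv (h : IsLocalRetraction S W r)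
    (hy : y ∈ W) : HasFDerivAt (fderiv ℝ r) (fderiv ℝ (fderiv ℝ r) y) y := by
  have := (h.contDiffAt hy).fderiv_right (m := 2) (by norm_num)
  exact (this.differentiableAt (by simp)).hasFDerivAt

lemma _root_.HypSurf.IsLocalRetraction.snd_fderiv_comm (h : IsLocalRetraction S W r)
    (hy : y ∈ W) (v w : E) :
    fderiv ℝ (fderiv ℝ r) y v w = fderiv ℝ (fderiv ℝ r) y w v :=
  (h.contDiffAt hy).isSymmSndFDerivAt
    (by rw [minSmoothness_of_isRCLikeNormedField]; norm_num) v w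

/-- The second fundamental form of the surface for the normal field of the model. -/
noncomputable def _root_.HypSurf.secondForm (r N : E → E) (y : E) : E →L[ℝ] E →L[ℝ] ℝ :=
  (ContinuousLinearMap.compL ℝ E E ℝ
    (isBoundedBilinearMap_mink.toContinuousLinearMap (N y))).comp (fderiv ℝ (fderiv ℝ r) y)

lemma _root_.HypSurf.secondForm_apply (r N : E → E) (y v w : E) :
    secondForm r N y v w = mink (N y) (fderiv ℝ (fderiv ℝ r) y v w) := rfl

lemma secondForm_comm (h : IsLocalModel S W r N) (hy : y ∈ W) (v w : E) :
    secondForm r N y v w = secondForm r N y w v := by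
  rw [secondForm_apply, secondForm_apply, h.snd_fderiv_comm hy]

/-- Differentiate along the curve t ↦ r(y + tv): ⟨N, c⟩ = 0 and ⟨N, N⟩ = 1 make dN(v) tangent, and
⟨N, dr(w)⟩ = 0 moves the derivative from N to dr, which gives the second fundamental form as ⟨N,
D²r⟩. -/
lemma fderiv_normal (h : IsLocalModel S W r N) (hS : S ⊆ hyp3) (hyS : y ∈ S) (hy : y ∈ W)
    {v : E} (hv : v ∈ tangentSet S y) :
    ShapeOperatorMapsTo S y (N y) v (-fderiv ℝ N y v) ∧ -fderiv ℝ N y v ∈ tangentSet S y ∧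
      ∀ w ∈ tangentSet S y, mink (-fderiv ℝ N y v) w = secondForm r N y v w := by
  have hrv := h.fderiv_apply_of_mem hy hv
  obtain ⟨hcS, hcd⟩ := h.exists_curve hy v
  rw [hrv] at hcd
  set c : ℝ → E := fun t => r (y + t • v) with hc
  have hc0 : c 0 = y := by simpa [hc] using h.fix y hyS hy
  have hcW : ∀ᶠ t in 𝓝 (0 : ℝ), c t ∈ W :=
    hcd.continuousAt.eventually_mem (by rw [hc0]; exact h.isOpen.mem_nhds hy)
  have hNd : HasDerivAt (fun t => N (c t)) (fderiv ℝ N y v) 0 := by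
    have : HasFDerivAt N (fderiv ℝ N y) (c 0) := by rw [hc0]; exact h.hasFDerivAt_normal hy
    exact this.comp_hasDerivAt 0 hcd
  have hdd : HasDerivAt (fun t => fderiv ℝ r (c t)) (fderiv ℝ (fderiv ℝ r) y v) 0 := by
    have : HasFDerivAt (fderiv ℝ r) (fderiv ℝ (fderiv ℝ r) y) (c 0) := by
      rw [hc0]; exact h.hasFDerivAt_fderiv hy
    exact this.comp_hasDerivAt 0 hcd
  obtain ⟨n1, n2, n3⟩ := h.unitNormal y hyS hy
  have hNy : mink (fderiv ℝ N y v) y = 0 := by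
    have h1 := hasDerivAt_mink hNd hcd
    have h2 : HasDerivAt (fun t => mink (N (c t)) (c t)) 0 0 := by
      refine (hasDerivAt_const (0 : ℝ) (0 : ℝ)).congr_of_eventuallyEq ?_
      filter_upwards [hcS, hcW] with t hS' hW' using (h.unitNormal _ hS' hW').1
    have := h1.unique h2
    rw [hc0, n3 v hv] at this
    linarith
  have hNN : mink (fderiv ℝ N y v) (N y) = 0 := by
    have h1 := hasDerivAt_mink hNd hNd
    have h2 : HasDerivAt (fun t => mink (N (c t)) (N (c t))) 0 0 := by
      refine (hasDerivAt_const (0 : ℝ) (1 : ℝ)).congr_of_eventuallyEq ?_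
      filter_upwards [hcS, hcW] with t hS' hW' using (h.unitNormal _ hS' hW').2.1
    have := h1.unique h2
    rw [hc0, mink_comm (N y)] at this
    linarith
  refine ⟨⟨c, fun t => N (c t), fderiv ℝ N y v, hc0, by simp [hc0], ?_, hcd, hNd, ?_⟩, ?_, ?_⟩
  · filter_upwards [hcS, hcW] with t hS' hW' using ⟨hS', h.unitNormal _ hS' hW'⟩
  · simp [tangentProj, hNy]
  · exact h.mem_tangentSet hS hyS hy (h.unitNormal y hyS hy) (by simp [hNy]) (by simp [hNN])
  · intro w hw
    have h0 : HasDerivAt (fun t => fderiv ℝ r (c t) w) (fderiv ℝ (fderiv ℝ r) y v w) 0 := by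
      simpa using hdd.clm_apply (hasDerivAt_const (0 : ℝ) w)
    have h1 := hasDerivAt_mink hNd h0
    have h2 : HasDerivAt (fun t => mink (N (c t)) (fderiv ℝ r (c t) w)) 0 0 := by
      refine (hasDerivAt_const (0 : ℝ) (0 : ℝ)).congr_of_eventuallyEq ?_
      filter_upwards [hcS, hcW] with t hS' hW' using
        (h.unitNormal _ hS' hW').2.2 _ (h.fderiv_mem hS' hW' w)
    have := h1.unique h2
    rw [hc0, h.fderiv_apply_of_mem hy hw] at this
    rw [secondForm_apply, mink_neg_left]
    linarith

/-- The form is definite on tangent vectors, so the shape operator is determined by the second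
fundamental form, and eigenvectors of the form are eigenvectors of the operator. -/
lemma isPrincipalDirection (h : IsLocalModel S W r N) (hS : S ⊆ hyp3) (hyS : y ∈ S) (hy : y ∈ W)
    {v : E} (hv : v ∈ tangentSet S y) (hv0 : v ≠ 0) {k : ℝ}
    (hk : ∀ w ∈ tangentSet S y, secondForm r N y v w = k * mink v w) :
    IsPrincipalDirection S y k v := by
  obtain ⟨h1, h2, h3⟩ := h.fderiv_normal hS hyS hy hv
  refine ⟨hv0, N y, ?_⟩
  suffices -fderiv ℝ N y v = k • v by rwa [this] at h1
  rw [h.tangentSet_eq_range hyS hy] at h2 hv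
  have hd : -fderiv ℝ N y v - k • v ∈ tangentSet S y := by
    rw [h.tangentSet_eq_range hyS hy]
    exact Submodule.sub_mem _ h2 (Submodule.smul_mem _ k hv)
  have := eq_zero_of_orthogonal (hS hyS).1 (mink_eq_zero_of_mem_tangentSet hS hd) (by
    rw [mink_sub_left, h3 _ hd, hk _ hd, mink_smul_left, sub_self])
  exact sub_eq_zero.mp this

/-- Principal curvatures in `[-1, 1]` bound the second fundamental form by the metric; where the
bound is attained the direction is principal. -/
lemma abs_secondForm_le (h : IsLocalModel S W r N) (hS : S ⊆ hyp3) (hyS : y ∈ S) (hy : y ∈ W)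
    (hk : ∀ k : ℝ, IsPrincipalCurvature S y k → |k| ≤ 1) {v : E} (hv : v ∈ tangentSet S y) :
    |secondForm r N y v v| ≤ mink v v ∧ (v ≠ 0 → |secondForm r N y v v| = mink v v →
      ∃ k, IsPrincipalDirection S y k v) := by
  have hT := h.tangentSet_eq_range hyS hy
  have hTy : ∀ w ∈ (fderiv ℝ r y).range, mink w y = 0 := fun w hw =>
    mink_eq_zero_of_mem_tangentSet hS (by rw [hT]; exact hw)
  have hup : ∀ w ∈ (fderiv ℝ r y).range, secondForm r N y w w ≤ mink w w := fun w hw =>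
    bilin_le_of_eigenvalue_le (hS hyS).1 hTy (fun u _ w _ => h.secondForm_comm hy u w)
      (fun k u hu hu0 hku => (le_abs_self k).trans (hk k ⟨u, h.isPrincipalDirection hS hyS hy
        (by rw [hT]; exact hu) hu0 (fun w hw => hku w (by rwa [hT] at hw))⟩)) hw
  have hlo : ∀ w ∈ (fderiv ℝ r y).range, (-secondForm r N y) w w ≤ mink w w := fun w hw =>
    bilin_le_of_eigenvalue_le (hS hyS).1 hTy
      (fun u _ w _ => by simpa using h.secondForm_comm hy u w)
      (fun k u hu hu0 hku => by
        -- An eigenvalue k of -II is the principal curvature -k of II, to which the two-sided bound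
        -- applies.
        refine (neg_le_abs (-k)).trans' (by simp) |>.trans (hk (-k) ⟨u,
          h.isPrincipalDirection hS hyS hy (by rw [hT]; exact hu) hu0 (fun w hw => ?_)⟩)
        have := hku w (by rwa [hT] at hw)
        simp at this
        linarith) hw
  have hv' : v ∈ (fderiv ℝ r y).range := by rwa [hT] at hv
  refine ⟨abs_le.mpr ⟨?_, hup v hv'⟩, fun hv0 heq => ?_⟩
  · have := hlo v hv'
    simp at this
    linarith
  rcases abs_choice (secondForm r N y v v) with hc | hc
  · refine ⟨1, h.isPrincipalDirection hS hyS hy hv hv0 fun w hw => ?_⟩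
    rw [hT] at hw
    exact bilin_eq_of_quadratic_eq (b := fun u v => secondForm r N y u v) (by simp) (by simp)
      (fun u _ w _ => h.secondForm_comm hy u w) (fun w hw => by simpa using hup w hw) hv'
      (by simp; linarith) hw
  · refine ⟨-1, h.isPrincipalDirection hS hyS hy hv hv0 fun w hw => ?_⟩
    rw [hT] at hw
    have := bilin_eq_of_quadratic_eq (b := fun u v => -secondForm r N y u v) (l := 1)
      (fun u v w => by simp; ring) (by simp)
      (fun u _ w _ => by simp [h.secondForm_comm hy u w]) (fun w hw => by simpa using hlo w hw)
      hv' (by simp; linarith) hw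
    linarith

end IsLocalModel

/-! ### Geodesics between points with the same outer tangent horosphere -/

/-- Along the curve γ' = dr(γ'). Differentiating once more gives γ'' = D²r(γ', γ') + dr(γ''), and
pairing with N removes the tangent term dr(γ''). -/
lemma IsLocalModel.curve_derivatives {S W : Set E} {r N : E → E} (h : IsLocalModel S W r N)
    (hS : S ⊆ hyp3) {L : ℝ} (hL : 0 < L) {γ γ' : ℝ → E} {γ'' : E}
    (hγ : ∀ t ∈ Icc 0 L, HasDerivWithinAt γ (γ' t) (Icc 0 L) t) (hmem : ∀ t ∈ Icc 0 L, γ t ∈ S)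
    {t : ℝ} (ht : t ∈ Icc 0 L) (hγ' : HasDerivWithinAt γ' γ'' (Icc 0 L) t) (htW : γ t ∈ W) :
    γ' t ∈ tangentSet S (γ t) ∧ mink γ'' (γ t) = -mink (γ' t) (γ' t) ∧
      mink γ'' (N (γ t)) = secondForm r N (γ t) (γ' t) (γ' t) := by
  have hU : ∀ t ∈ Icc 0 L, UniqueDiffWithinAt ℝ (Icc 0 L) t := uniqueDiffOn_Icc hL
  have hW : ∀ᶠ s in 𝓝[Icc 0 L] t, s ∈ Icc 0 L ∧ γ s ∈ W :=
    (eventually_mem_nhdsWithin).and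
      ((hγ t ht).continuousWithinAt.eventually_mem (h.isOpen.mem_nhds htW))
  have hT : ∀ s ∈ Icc 0 L, γ s ∈ W → γ' s = fderiv ℝ r (γ s) (γ' s) := by
    intro s hs hsW
    have h1 := (h.hasFDerivAt hsW).comp_hasDerivWithinAt s (hγ s hs)
    refine (hU s hs).eq_deriv _ (hγ s hs) (h1.congr_of_eventuallyEq ?_ ?_)
    · filter_upwards [eventually_mem_nhdsWithin, (hγ s hs).continuousWithinAt.eventually_mem
        (h.isOpen.mem_nhds hsW)] with a ha haW using (h.fix _ (hmem a ha) haW).symm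
    · exact (h.fix _ (hmem s hs) hsW).symm
  have hTm : ∀ s ∈ Icc 0 L, γ s ∈ W → γ' s ∈ tangentSet S (γ s) := by
    intro s hs hsW
    rw [hT s hs hsW]
    exact h.fderiv_mem (hmem s hs) hsW _
  refine ⟨hTm t ht htW, ?_, ?_⟩
  · have h1 := hasDerivWithinAt_mink hγ' (hγ t ht)
    have h2 : HasDerivWithinAt (fun t => mink (γ' t) (γ t)) 0 (Icc 0 L) t := by
      refine (hasDerivWithinAt_const t _ (0 : ℝ)).congr_of_eventuallyEq ?_ ?_
      · filter_upwards [hW] with s hs using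
          mink_eq_zero_of_mem_tangentSet hS (hTm s hs.1 hs.2)
      · exact mink_eq_zero_of_mem_tangentSet hS (hTm t ht htW)
    have := (hU t ht).eq_deriv _ h1 h2
    linarith
  · have h1 := (h.hasFDerivAt_fderiv htW).comp_hasDerivWithinAt t (hγ t ht)
    have h2 := h1.clm_apply hγ'
    have h3 : γ'' = fderiv ℝ (fderiv ℝ r) (γ t) (γ' t) (γ' t) + fderiv ℝ r (γ t) γ'' := by
      refine (hU t ht).eq_deriv _ hγ' (h2.congr_of_eventuallyEq ?_ (hT t ht htW))
      filter_upwards [hW] with s hs using hT s hs.1 hs.2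
    have h4 := (h.unitNormal _ (hmem t ht) htW).2.2 _ (h.fderiv_mem (hmem t ht) htW γ'')
    rw [secondForm_apply, mink_comm γ'']
    conv_lhs => rw [h3]
    rw [mink_add_right, h4, add_zero]

lemma IsGeodesicSegment.hasDerivWithinAt {S : Set E} {p q : E} {L : ℝ} {γ : ℝ → E}
    (h : IsGeodesicSegment S p q L γ) (hL : 0 < L) {t : ℝ} (ht : t ∈ Icc 0 L) :
    HasDerivWithinAt γ (derivWithin γ (Icc 0 L) t) (Icc 0 L) t ∧
      HasDerivWithinAt (derivWithin γ (Icc 0 L))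
        (derivWithin (derivWithin γ (Icc 0 L)) (Icc 0 L) t) (Icc 0 L) t := by
  have hU : UniqueDiffOn ℝ (Icc 0 L) := uniqueDiffOn_Icc hL
  refine ⟨((h.contDiffOn.differentiableOn (by simp)) t ht).hasDerivWithinAt, ?_⟩
  have h1 := (contDiffOn_succ_iff_derivWithin (n := 1) hU).mp
    (by simpa [one_add_one_eq_two] using h.contDiffOn)
  exact ((h1.2.2.differentiableOn (by simp)) t ht).hasDerivWithinAt

lemma mink_eq_zero_of_mem_tangentSet_horosphere {n x w : E}
    (hw : w ∈ tangentSet (horosphere n) x) : mink w n = 0 := by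
  obtain ⟨c, -, hc, hd⟩ := hw
  have h1 := hasDerivAt_mink hd (hasDerivAt_const (0 : ℝ) n)
  have h2 : HasDerivAt (fun t => mink (c t) n) 0 0 := by
    refine (hasDerivAt_const (0 : ℝ) (-1 : ℝ)).congr_of_eventuallyEq ?_
    filter_upwards [hc] with t ht using ht.2
  have := h1.unique h2
  simpa using this

/-- A null vector has component at most `u` along a unit normal at a point at height `u`; if
`u = 1` and the component is `±1` then the null vector is normal. -/
lemma null_normal_component {x n ν : E} (hx : mink x x = -1) (hn : mink n n = 0)
    (hν : mink ν x = 0) (hν1 : mink ν ν = 1) :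
    mink ν n ^ 2 ≤ mink x n ^ 2 ∧
      (mink x n = -1 → mink ν n ^ 2 = 1 → n = x + mink ν n • ν) := by
  -- This vector is the projection of n to the tangent space at x. It has square ⟨x, n⟩² and the
  -- same product with ν as n, so Cauchy-Schwarz applies.
  have h1 : mink (n + mink x n • x) x = 0 := by simp [hx, mink_comm n x]
  have h2 := mink_sq_le hx hν h1
  simp only [mink_add_left, mink_add_right, mink_smul_left, mink_smul_right, hν, hν1, hn, hx,
    mink_comm n x] at h2
  refine ⟨by nlinarith, fun hu hb => ?_⟩
  have h3 : n - x - mink ν n • ν = 0 := by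
    refine eq_zero_of_orthogonal hx ?_ ?_
    · simp [mink_comm n x, hu, hx, hν]
    · apply le_of_eq
      simp only [mink_sub_left, mink_sub_right, mink_smul_left, mink_smul_right, hν, hν1, hn, hx,
        mink_comm n x, mink_comm x ν, hu, mink_comm n ν]
      linarith
  rw [sub_sub, sub_eq_zero] at h3
  exact h3

/-! ### Concavity along a geodesic, the equality case, and uniqueness -/

section

variable {S : Set E} {p q n : E} {L : ℝ} {γ : ℝ → E}

lemma IsGeodesicSegment.length_pos (h : IsGeodesicSegment S p q L γ) (hpq : p ≠ q) : 0 < L := by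
  refine h.nonneg.lt_of_ne fun h0 => hpq ?_
  rw [← h.source, ← h.target, ← h0]

/-- The products ⟨γ'', γ⟩ = -1 and ⟨γ'', N⟩ = κ fix the two normal components. The remainder γ'' - γ
- κN is tangent to S, hence orthogonal to itself by the geodesic equation, hence zero. -/
lemma IsGeodesicSegment.snd_deriv_eq (h : IsGeodesicSegment S p q L γ) (hL : 0 < L)
    (hS : IsEmbeddedSurface S)
    (hk : ∀ x ∈ S, ∀ k : ℝ, IsPrincipalCurvature S x k → |k| ≤ 1)
    {t : ℝ} (ht : t ∈ Icc 0 L) {ν : E} (hν : IsUnitNormal S (γ t) ν) :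
    ∃ (κ : ℝ) (N : E), IsUnitNormal S (γ t) N ∧ |κ| ≤ 1 ∧
      derivWithin (derivWithin γ (Icc 0 L)) (Icc 0 L) t = γ t + κ • N ∧
      (|κ| = 1 → ∃ k, IsPrincipalDirection S (γ t) k (derivWithin γ (Icc 0 L) t)) := by
  obtain ⟨W, r, N, hW, hm⟩ := hS.exists_isLocalModel (h.mem t ht) hν
  obtain ⟨h1, h2, h3⟩ := hm.curve_derivatives hS.1 hL (fun s hs => (h.hasDerivWithinAt hL hs).1)
    h.mem ht (h.hasDerivWithinAt hL ht).2 hW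
  have hacc := h.accel t ht
  have hus := h.unit_speed t ht
  set γ₁ := derivWithin γ (Icc 0 L) t
  set γ₂ := derivWithin (derivWithin γ (Icc 0 L)) (Icc 0 L) t
  set κ := secondForm r N (γ t) γ₁ γ₁
  have hN := hm.unitNormal _ (h.mem t ht) hW
  have hx := (hS.1 (h.mem t ht)).1
  have hb := hm.abs_secondForm_le hS.1 (h.mem t ht) hW (hk _ (h.mem t ht)) h1
  rw [hus] at hb h2
  have hne : γ₁ ≠ 0 := by
    intro h0
    rw [h0] at hus
    simp at hus
  refine ⟨κ, N (γ t), hN, hb.1, ?_, hb.2 hne⟩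
  have d1 : mink (γ₂ - γ t - κ • N (γ t)) (γ t) = 0 := by simp [h2, hx, hN.1]
  have d2 : mink (γ₂ - γ t - κ • N (γ t)) (N (γ t)) = 0 := by
    simp [h3, mink_comm (γ t) (N (γ t)), hN.1, hN.2.1, κ]
  have hd := hm.mem_tangentSet hS.1 (h.mem t ht) hW hN d1 d2
  have h0 := hacc _ hd
  have h4 : mink (γ₂ - γ t - κ • N (γ t)) (γ₂ - γ t - κ • N (γ t)) = 0 := by
    have e1 := mink_comm (γ t) (γ₂ - γ t - κ • N (γ t))
    have e2 := mink_comm (N (γ t)) (γ₂ - γ t - κ • N (γ t))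
    rw [d1] at e1
    rw [d2] at e2
    rw [tangentProj, mink_add_left, mink_smul_left, e1, mul_zero, add_zero] at h0
    set d := γ₂ - γ t - κ • N (γ t)
    have : mink d d = mink γ₂ d - mink (γ t) d - κ * mink (N (γ t)) d := by
      conv_lhs => rw [show d = γ₂ - γ t - κ • N (γ t) from rfl]
      rw [mink_sub_left, mink_sub_left, mink_smul_left]
    rw [this, h0, e1, e2]
    ring
  have := eq_zero_of_orthogonal hx d1 h4.le
  rw [sub_sub, sub_eq_zero] at this
  exact this

/-- A geodesic whose end points lie on a horosphere that bounds a horoball disjoint from the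
surface stays on the horosphere, and its acceleration is the null vector of the horosphere. -/
lemma IsGeodesicSegment.mem_horosphere (h : IsGeodesicSegment S p q L γ) (hL : 0 < L)
    (hS : IsEmbeddedSurface S)
    (hk : ∀ x ∈ S, ∀ k : ℝ, IsPrincipalCurvature S x k → |k| ≤ 1)
    (hν : ∀ x ∈ S, ∃ ν, IsUnitNormal S x ν) (hn : mink n n = 0)
    (hp : mink p n = -1) (hq : mink q n = -1) (hdis : Disjoint S (openHoroball n))
    {t : ℝ} (ht : t ∈ Icc 0 L) :
    mink (γ t) n = -1 ∧ mink (derivWithin γ (Icc 0 L) t) n = 0 ∧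
      derivWithin (derivWithin γ (Icc 0 L)) (Icc 0 L) t = n ∧
      ∃ k, IsPrincipalDirection S (γ t) k (derivWithin γ (Icc 0 L) t) := by
  set γ₁ := derivWithin γ (Icc 0 L)
  set γ₂ := derivWithin γ₁ (Icc 0 L)
  have hU : UniqueDiffOn ℝ (Icc 0 L) := uniqueDiffOn_Icc hL
  have hle : ∀ t ∈ Icc 0 L, mink (γ t) n ≤ -1 := by
    intro t ht
    by_contra hc
    exact disjoint_left.mp hdis (h.mem t ht) ⟨hS.1 (h.mem t ht), not_le.mp hc⟩
  have hd1 : ∀ t ∈ Icc 0 L, HasDerivWithinAt (fun t => mink (γ t) n) (mink (γ₁ t) n)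
      (Icc 0 L) t := by
    intro t ht
    simpa using hasDerivWithinAt_mink (h.hasDerivWithinAt hL ht).1
      (hasDerivWithinAt_const t (Icc 0 L) n)
  have hd2 : ∀ t ∈ Icc 0 L, HasDerivWithinAt (fun t => mink (γ₁ t) n) (mink (γ₂ t) n)
      (Icc 0 L) t := by
    intro t ht
    simpa using hasDerivWithinAt_mink (h.hasDerivWithinAt hL ht).2
      (hasDerivWithinAt_const t (Icc 0 L) n)
  -- The central inequality: with u = ⟨γ, n⟩ < 0, one has u'' = u + κ⟨N, n⟩ ≤ u + |u| = 0.
  have hdd : ∀ t ∈ Icc 0 L, mink (γ₂ t) n ≤ 0 := by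
    intro t ht
    obtain ⟨ν, hν⟩ := hν _ (h.mem t ht)
    obtain ⟨κ, N, hN, hκ, heq, -⟩ := h.snd_deriv_eq hL hS hk ht hν
    have h1 := (null_normal_component (hS.1 (h.mem t ht)).1 hn hN.1 hN.2.1).1
    have h2 : |mink N n| ≤ |mink (γ t) n| := sq_le_sq.mp h1
    rw [show γ₂ t = γ t + κ • N from heq, mink_add_left, mink_smul_left]
    have h3 := hle t ht
    rw [abs_of_neg (by linarith : mink (γ t) n < 0)] at h2
    have h4 : κ * mink N n ≤ |κ| * |mink N n| := by rw [← abs_mul]; exact le_abs_self _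
    have h5 : |κ| * |mink N n| ≤ 1 * |mink N n| :=
      mul_le_mul_of_nonneg_right hκ (abs_nonneg _)
    linarith
  have hint : interior (Icc 0 L) ⊆ Icc 0 L := interior_subset
  have hconc : ConcaveOn ℝ (Icc 0 L) (fun t => mink (γ t) n) :=
    concaveOn_of_hasDerivWithinAt2_nonpos (convex_Icc 0 L)
      (fun t ht => (hd1 t ht).continuousWithinAt)
      (fun t ht => (hd1 t (hint ht)).mono hint) (fun t ht => (hd2 t (hint ht)).mono hint)
      (fun t ht => hdd t (hint ht))
  have hu : ∀ t ∈ Icc 0 L, mink (γ t) n = -1 := by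
    intro t ht
    refine le_antisymm (hle t ht) ?_
    -- A concave function lies above the smaller of its end values, here both -1.
    have := hconc.min_le_of_mem_Icc (left_mem_Icc.mpr hL.le) (right_mem_Icc.mpr hL.le) ht
    simpa [h.source, h.target, hp, hq] using this
  have hu1 : ∀ t ∈ Icc 0 L, mink (γ₁ t) n = 0 := fun t ht =>
    (hU t ht).eq_deriv _ (hd1 t ht) ((hasDerivWithinAt_const t _ (-1 : ℝ)).congr hu (hu t ht))
  have hu2 : ∀ t ∈ Icc 0 L, mink (γ₂ t) n = 0 := fun t ht =>
    (hU t ht).eq_deriv _ (hd2 t ht) ((hasDerivWithinAt_const t _ (0 : ℝ)).congr hu1 (hu1 t ht))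
  refine ⟨hu t ht, hu1 t ht, ?_⟩
  obtain ⟨ν, hν⟩ := hν _ (h.mem t ht)
  obtain ⟨κ, N, hN, hκ, heq, hpd⟩ := h.snd_deriv_eq hL hS hk ht hν
  have hnc := null_normal_component (hS.1 (h.mem t ht)).1 hn hN.1 hN.2.1
  have h0 := hu2 t ht
  rw [show γ₂ t = γ t + κ • N from heq, mink_add_left, mink_smul_left, hu t ht] at h0
  rw [hu t ht] at hnc
  have hκ2 : κ ^ 2 ≤ 1 := by rwa [← sq_abs, sq_le_one_iff₀ (abs_nonneg κ)]
  -- Equality case: κ⟨N, n⟩ = 1 while both factors have square at most 1, so (⟨N, n⟩ - κ)² ≤ 0.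
  have hb : mink N n = κ := by nlinarith [sq_nonneg (mink N n - κ), hnc.1]
  rw [hb] at hnc h0
  have hκ1 : κ ^ 2 = 1 := by linarith
  refine ⟨heq.trans (hnc.2 rfl hκ1).symm, hpd ?_⟩
  rw [← sq_abs] at hκ1
  exact (pow_eq_one_iff_of_nonneg (abs_nonneg κ) two_ne_zero).mp hκ1

/-- Both n and γ(t) are orthogonal to the tangent vectors of the horosphere, so an acceleration
equal to n has no component along it. -/
lemma IsGeodesicSegment.horosphere (h : IsGeodesicSegment S p q L γ) (hS : S ⊆ hyp3)
    (hγ : ∀ t ∈ Icc 0 L, mink (γ t) n = -1 ∧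
      derivWithin (derivWithin γ (Icc 0 L)) (Icc 0 L) t = n) :
    IsGeodesicSegment (horosphere n) p q L γ where
  nonneg := h.nonneg
  contDiffOn := h.contDiffOn
  mem t ht := ⟨hS (h.mem t ht), (hγ t ht).1⟩
  source := h.source
  target := h.target
  unit_speed := h.unit_speed
  accel t ht w hw := by
    have h1 := mink_eq_zero_of_mem_tangentSet_horosphere hw
    have h2 := mink_eq_zero_of_mem_tangentSet (fun x hx => hx.1) hw
    rw [(hγ t ht).2, tangentProj, mink_add_left, mink_smul_left, mink_comm n w,
      mink_comm (γ t) w, h1, h2]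
    ring

/-- Constant acceleration makes γ a parabola in ℝ⁴, the form taken there by the straight lines of
the flat horosphere. -/
lemma IsGeodesicSegment.eq_quadratic (h : IsGeodesicSegment S p q L γ) (hL : 0 < L)
    (hγ : ∀ t ∈ Icc 0 L, derivWithin (derivWithin γ (Icc 0 L)) (Icc 0 L) t = n)
    {t : ℝ} (ht : t ∈ Icc 0 L) :
    γ t = p + t • derivWithin γ (Icc 0 L) 0 + (t ^ 2 / 2) • n := by
  have hU : UniqueDiffOn ℝ (Icc 0 L) := uniqueDiffOn_Icc hL
  set γ₁ := derivWithin γ (Icc 0 L)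
  have h1 : ∀ t ∈ Icc 0 L, γ₁ t = γ₁ 0 + t • n := by
    have hd : ∀ t ∈ Icc 0 L, HasDerivWithinAt (fun t => γ₁ t - t • n) 0 (Icc 0 L) t := by
      intro t ht
      have := (h.hasDerivWithinAt hL ht).2.fun_sub
        (((hasDerivAt_id t).smul_const n).hasDerivWithinAt (s := Icc 0 L))
      rw [hγ t ht] at this
      simpa using this
    intro t ht
    have := constant_of_derivWithin_zero (fun t ht => (hd t ht).differentiableWithinAt)
      (fun t ht => (hd t ⟨ht.1, ht.2.le⟩).derivWithin (hU t ⟨ht.1, ht.2.le⟩)) t ht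
    simp only [zero_smul, sub_zero] at this
    rw [← this]; abel
  have hd : ∀ t ∈ Icc 0 L, HasDerivWithinAt
      (fun t => γ t - (t • γ₁ 0 + (t ^ 2 / 2) • n)) 0 (Icc 0 L) t := by
    intro t ht
    have h2 : HasDerivAt (fun t : ℝ => t • γ₁ 0 + (t ^ 2 / 2) • n) (γ₁ 0 + t • n) t := by
      have := ((hasDerivAt_id t).smul_const (γ₁ 0)).fun_add
        ((((hasDerivAt_id t).pow 2).div_const 2).smul_const n)
      simpa using this
    have := (h.hasDerivWithinAt hL ht).1.fun_sub (h2.hasDerivWithinAt (s := Icc 0 L))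
    rwa [show derivWithin γ (Icc 0 L) t = _ from h1 t ht, sub_self] at this
  have := constant_of_derivWithin_zero (fun t ht => (hd t ht).differentiableWithinAt)
      (fun t ht => (hd t ⟨ht.1, ht.2.le⟩).derivWithin (hU t ⟨ht.1, ht.2.le⟩)) t ht
  simp only [h.source] at this
  rw [sub_eq_iff_eq_add] at this
  rw [this]; simp; abel

/-- Two unit-speed curves with constant null acceleration `n` tangent to the horosphere of `n`
and with the same end points agree. -/
lemma IsGeodesicSegment.unique {L' : ℝ} {γ' : ℝ → E} (h : IsGeodesicSegment S p q L γ)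
    (h' : IsGeodesicSegment S p q L' γ') (hL : 0 < L) (hL' : 0 < L') (hn : mink n n = 0)
    (hγ : ∀ t ∈ Icc 0 L, mink (derivWithin γ (Icc 0 L) t) n = 0 ∧
      derivWithin (derivWithin γ (Icc 0 L)) (Icc 0 L) t = n)
    (hγ' : ∀ t ∈ Icc 0 L', mink (derivWithin γ' (Icc 0 L') t) n = 0 ∧
      derivWithin (derivWithin γ' (Icc 0 L')) (Icc 0 L') t = n) :
    L' = L ∧ EqOn γ' γ (Icc 0 L) := by
  -- Since n is null and orthogonal to the initial velocity, only the square of the linear term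
  -- survives in ⟨q - p, q - p⟩. This fixes L, and then the displacement fixes the velocity.
  have key : ∀ {L : ℝ} {γ : ℝ → E}, IsGeodesicSegment S p q L γ → 0 < L →
      (∀ t ∈ Icc 0 L, mink (derivWithin γ (Icc 0 L) t) n = 0 ∧
        derivWithin (derivWithin γ (Icc 0 L)) (Icc 0 L) t = n) →
      q - p = L • derivWithin γ (Icc 0 L) 0 + (L ^ 2 / 2) • n ∧
      mink (q - p) (q - p) = L ^ 2 := by
    intro L γ h hL hγ
    have h1 := h.eq_quadratic hL (fun t ht => (hγ t ht).2) (right_mem_Icc.mpr hL.le)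
    have h0 := left_mem_Icc.mpr hL.le
    have h2 : q - p = L • derivWithin γ (Icc 0 L) 0 + (L ^ 2 / 2) • n := by
      rw [h.target] at h1
      rw [h1]; abel
    refine ⟨h2, ?_⟩
    rw [h2]
    simp [hn, (hγ 0 h0).1, h.unit_speed 0 h0, mink_comm n]
    ring
  obtain ⟨a1, a2⟩ := key h hL hγ
  obtain ⟨b1, b2⟩ := key h' hL' hγ'
  have hLL : L' = L := (pow_left_inj₀ hL'.le hL.le two_ne_zero).mp (b2.symm.trans a2)
  subst hLL
  refine ⟨rfl, fun t ht => ?_⟩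
  have hv : derivWithin γ' (Icc 0 L') 0 = derivWithin γ (Icc 0 L') 0 := by
    have := b1.symm.trans a1
    exact smul_right_injective _ hL.ne' (add_right_cancel this)
  rw [h.eq_quadratic hL (fun t ht => (hγ t ht).2) ht,
    h'.eq_quadratic hL' (fun t ht => (hγ' t ht).2) ht, hv]

end

/-! ### The Hopf-Rinow theorem for length metrics -/

/-- In a complete locally compact length space closed balls are compact. -/
theorem isCompact_closedBall_of_length {X : Type*} [MetricSpace X] [CompleteSpace X]
    [LocallyCompactSpace X]
    (hl : ∀ (x y : X) (s t : ℝ), 0 < s → 0 < t → dist x y < s + t →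
      ∃ z, dist x z < s ∧ dist z y < t) (p : X) (R : ℝ) :
    IsCompact (Metric.closedBall p R) := by
  by_contra hR
  let A : Set ℝ := {ρ | IsCompact (Metric.closedBall p ρ)}
  have hmono : ∀ ρ ∈ A, ∀ ρ' ≤ ρ, ρ' ∈ A := fun ρ hρ ρ' h =>
    IsCompact.of_isClosed_subset hρ Metric.isClosed_closedBall (Metric.closedBall_subset_closedBall h)
  have hbdd : BddAbove A := ⟨R, fun ρ hρ => by
    by_contra h
    exact hR (hmono ρ hρ R (not_le.mp h).le)⟩
  have h0 : (0 : ℝ) ∈ A := by simp [A]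
  set ρ := sSup A
  have hρ0 : 0 ≤ ρ := le_csSup hbdd h0
  have hlt : ∀ s < ρ, IsCompact (Metric.closedBall p s) := by
    intro s hs
    obtain ⟨s', hs', hss'⟩ := exists_lt_of_lt_csSup ⟨0, h0⟩ hs
    exact hmono s' hs' s hss'.le
  have hcomp : IsCompact (Metric.closedBall p ρ) := by
    refine isCompact_iff_totallyBounded_isComplete.mpr ⟨?_, Metric.isClosed_closedBall.isComplete⟩
    rw [Metric.totallyBounded_iff]
    intro ε hε
    rcases le_or_gt ρ (ε / 4) with h | h
    · refine ⟨{p}, finite_singleton p, fun y hy => ?_⟩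
      simp only [Metric.mem_closedBall, mem_singleton_iff, iUnion_iUnion_eq_left,
        Metric.mem_ball] at hy ⊢
      linarith
    -- Since (ρ - ε/4) + ε/2 > ρ, each point of the ball of radius ρ is within ε/2 of the compact
    -- ball of radius ρ - ε/4. An ε/4-net of the latter is then an ε-net of the former.
    · obtain ⟨t, ht, hcov⟩ := Metric.totallyBounded_iff.mp
        (hlt (ρ - ε / 4) (by linarith)).totallyBounded (ε / 4) (by linarith)
      refine ⟨t, ht, fun y hy => ?_⟩
      rw [Metric.mem_closedBall, dist_comm] at hy
      obtain ⟨z, hz1, hz2⟩ := hl p y (ρ - ε / 4) (ε / 2) (by linarith) (by linarith)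
        (by linarith)
      have := hcov (show z ∈ Metric.closedBall p (ρ - ε / 4) by
        rw [Metric.mem_closedBall, dist_comm]; exact hz1.le)
      simp only [mem_iUnion, Metric.mem_ball] at this ⊢
      obtain ⟨w, hw, hzw⟩ := this
      refine ⟨w, hw, ?_⟩
      have := dist_triangle y z w
      rw [dist_comm y z] at this
      linarith
  -- A compact δ-thickening contains the ball of radius ρ + δ/2, which contradicts the choice of ρ
  -- as supremum.
  obtain ⟨δ, hδ, hth⟩ := hcomp.exists_isCompact_cthickening
  have hbig : ρ + δ / 2 ∈ A := by
    refine IsCompact.of_isClosed_subset hth Metric.isClosed_closedBall fun y hy => ?_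
    rw [Metric.mem_closedBall, dist_comm] at hy
    -- The length property asks for positive radii, so ρ = 0 is treated directly.
    rcases hρ0.eq_or_lt with h | h
    · refine Metric.mem_cthickening_of_dist_le y p δ _ (Metric.mem_closedBall_self hρ0) ?_
      rw [dist_comm]; linarith
    · obtain ⟨z, hz1, hz2⟩ := hl p y ρ δ h hδ (by linarith)
      refine Metric.mem_cthickening_of_dist_le y z δ _ ?_ (by rw [dist_comm]; exact hz2.le)
      rw [Metric.mem_closedBall, dist_comm]; exact hz1.le
  have := le_csSup hbdd hbig
  linarith

/-! ### Paths in a surface and the intrinsic distance -/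

/-- The speed of a curve. -/
noncomputable def speed (c : ℝ → E) (t : ℝ) : ℝ := Real.sqrt (mink (deriv c t) (deriv c t))

lemma speed_nonneg (c : ℝ → E) (t : ℝ) : 0 ≤ speed c t := Real.sqrt_nonneg _

lemma continuous_speed {c : ℝ → E} (hc : ContDiff ℝ 1 c) : Continuous (speed c) :=
  (continuous_mink.comp ((hc.continuous_deriv le_rfl).prodMk
    (hc.continuous_deriv le_rfl))).sqrt

lemma hasDerivAt_of_contDiff {c : ℝ → E} (hc : ContDiff ℝ 1 c) (t : ℝ) :
    HasDerivAt c (deriv c t) t := ((hc.differentiable one_ne_zero) t).hasDerivAt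

lemma intrinsicDist_le_of_path {S : Set E} {c : ℝ → E} (hc : ContDiff ℝ 1 c) {a b : ℝ}
    (hab : a ≤ b) (hmem : ∀ t ∈ Icc a b, c t ∈ S) :
    intrinsicDist S (c a) (c b) ≤ ENNReal.ofReal (∫ t in a..b, speed c t) := by
  have hf : ContDiff ℝ 1 fun t : ℝ => a + t * (b - a) := by fun_prop
  have hfd : ∀ t : ℝ, HasDerivAt (fun t : ℝ => a + t * (b - a)) (b - a) t := fun t => by
    simpa using ((hasDerivAt_id t).mul_const (b - a)).const_add a
  refine sInf_le ⟨fun t => c (a + t * (b - a)), (hc.comp hf).contDiffOn, ?_, by simp, by simp, ?_⟩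
  · intro t ht
    apply hmem
    constructor <;> nlinarith [ht.1, ht.2]
  · congr 1
    have h1 := intervalIntegral.integral_comp_mul_deriv (a := 0) (b := 1)
      (fun t _ => hfd t) (continuousOn_const) (continuous_speed hc)
    simp only [zero_mul, one_mul, add_zero, add_sub_cancel] at h1
    rw [← h1]
    refine intervalIntegral.integral_congr fun t ht => ?_
    rw [uIcc_of_le zero_le_one] at ht
    have h2 : HasDerivAt (fun t => c (a + t * (b - a))) ((b - a) • deriv c (a + t * (b - a))) t :=
      (hasDerivAt_of_contDiff hc _).scomp t (hfd t)
    rw [h2.hasDerivWithinAt.derivWithin (uniqueDiffOn_Icc zero_lt_one t ht)]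
    simp only [mink_smul_left, mink_smul_right, Function.comp, speed]
    rw [← mul_assoc, Real.sqrt_mul (mul_self_nonneg _), Real.sqrt_mul_self (by linarith), mul_comm]

/-- A path of length less than `l` can be chosen to be `C¹` on the whole line and constant outside
of `[0, 1]`. -/
lemma exists_path_of_intrinsicDist_lt {S : Set E} {x y : E} {l : ℝ}
    (h : intrinsicDist S x y < ENNReal.ofReal l) :
    ∃ c : ℝ → E, ContDiff ℝ 1 c ∧ (∀ t, c t ∈ S) ∧ (∀ t ≤ 0, c t = x) ∧ (∀ t ≥ 1, c t = y) ∧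
      ∫ t in (0 : ℝ)..1, speed c t < l := by
  obtain ⟨_, ⟨c, hc, hmem, hx, hy, rfl⟩, hl⟩ := sInf_lt_iff.mp h
  have hl' : curveLength c < l := by
    by_contra hcon
    exact absurd hl (not_lt.mpr (ENNReal.ofReal_le_ofReal (not_lt.mp hcon)))
  have hI : ∀ t, Real.smoothTransition t ∈ Icc (0 : ℝ) 1 := fun t =>
    ⟨Real.smoothTransition.nonneg t, Real.smoothTransition.le_one t⟩
  have hθ : ContDiff ℝ 1 Real.smoothTransition := Real.smoothTransition.contDiff
  have hθd : ∀ t, HasDerivAt Real.smoothTransition (deriv Real.smoothTransition t) t := fun t =>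
    ((hθ.differentiable one_ne_zero) t).hasDerivAt
  have hU : UniqueDiffOn ℝ (Icc (0 : ℝ) 1) := uniqueDiffOn_Icc zero_lt_one
  -- Precomposing with the monotone transition function extends c to the line, constant outside [0,
  -- 1], without changing its length.
  refine ⟨c ∘ Real.smoothTransition, ?_, fun t => hmem _ (hI t), ?_, ?_, ?_⟩
  · rw [← contDiffOn_univ] at hθ ⊢
    exact hc.comp hθ fun t _ => hI t
  · intro t ht
    simp [Real.smoothTransition.zero_of_nonpos ht, hx]
  · intro t ht
    simp [Real.smoothTransition.one_of_one_le ht, hy]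
  · convert hl' using 1
    have hcont : ContinuousOn (fun t => Real.sqrt (mink (derivWithin c (Icc 0 1) t)
        (derivWithin c (Icc 0 1) t))) (Icc 0 1) := by
      have := hc.continuousOn_derivWithin hU le_rfl
      exact (continuous_mink.comp_continuousOn (this.prodMk this)).sqrt
    have h1 := intervalIntegral.integral_comp_mul_deriv' (a := 0) (b := 1) (fun t _ => hθd t)
      ((hθ.continuous_deriv le_rfl).continuousOn)
      (hcont.mono (by rintro _ ⟨t, -, rfl⟩; exact hI t))
    rw [Real.smoothTransition.zero_of_nonpos le_rfl, Real.smoothTransition.one_of_one_le le_rfl]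
      at h1
    rw [curveLength, ← h1]
    refine intervalIntegral.integral_congr fun t ht => ?_
    have h2 : HasDerivAt (c ∘ Real.smoothTransition)
        (deriv Real.smoothTransition t • derivWithin c (Icc 0 1) (Real.smoothTransition t)) t := by
      have hcd := ((hc.differentiableOn one_ne_zero) _ (hI t)).hasDerivWithinAt
      rw [← hasDerivWithinAt_univ]
      exact hcd.scomp t (hθd t).hasDerivWithinAt fun t _ => hI t
    have hpos : 0 ≤ deriv Real.smoothTransition t := Real.smoothTransition.monotone.deriv_nonneg
    simp only [speed, h2.deriv, mink_smul_left, mink_smul_right, Function.comp]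
    rw [← mul_assoc, Real.sqrt_mul (mul_self_nonneg _), Real.sqrt_mul_self hpos, mul_comm]

lemma intrinsicDist_self {S : Set E} {x : E} (hx : x ∈ S) : intrinsicDist S x x = 0 := by
  have := intrinsicDist_le_of_path (S := S) (contDiff_const (c := x)) (le_refl (0 : ℝ))
    (fun _ _ => hx)
  simpa using this

lemma intrinsicDist_le_symm {S : Set E} {x y : E} {l : ℝ}
    (h : intrinsicDist S x y < ENNReal.ofReal l) : intrinsicDist S y x ≤ ENNReal.ofReal l := by
  obtain ⟨c, hc, hS, h0, h1, hl⟩ := exists_path_of_intrinsicDist_lt h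
  have h2 := intrinsicDist_le_of_path (S := S) (hc.comp contDiff_neg) (a := -1) (b := 0)
    (by norm_num) (fun t _ => hS _)
  simp only [Function.comp, neg_neg, neg_zero, h1 1 le_rfl, h0 0 le_rfl] at h2
  refine h2.trans (ENNReal.ofReal_le_ofReal (le_trans (le_of_eq ?_) hl.le))
  have h3 : ∀ t, speed (c ∘ fun t => -t) (-t) = speed c t := by
    intro t
    simp [speed, Function.comp_def, deriv_comp_neg]
  rw [← neg_zero (G := ℝ), ← intervalIntegral.integral_comp_neg]
  simp only [h3, neg_zero]

lemma intrinsicDist_comm (S : Set E) (x y : E) : intrinsicDist S x y = intrinsicDist S y x := by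
  have key : ∀ x y, intrinsicDist S x y ≤ intrinsicDist S y x := by
    intro x y
    refine ENNReal.le_of_forall_pos_le_add fun ε hε hlt => ?_
    have h : intrinsicDist S y x < ENNReal.ofReal ((intrinsicDist S y x).toReal + ε) := by
      rw [ENNReal.ofReal_add ENNReal.toReal_nonneg ε.coe_nonneg, ENNReal.ofReal_toReal hlt.ne]
      exact ENNReal.lt_add_right hlt.ne (by simpa using hε.ne')
    refine (intrinsicDist_le_symm h).trans (le_of_eq ?_)
    rw [ENNReal.ofReal_add ENNReal.toReal_nonneg ε.coe_nonneg, ENNReal.ofReal_toReal hlt.ne]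
    simp
  exact le_antisymm (key x y) (key y x)

lemma deriv_eq_zero_of_const_Iic {c : ℝ → E} {x : E} (hc : ContDiff ℝ 1 c)
    (h : ∀ t ≤ 0, c t = x) {t : ℝ} (ht : t ≤ 0) : deriv c t = 0 := by
  have h1 := (hasDerivAt_of_contDiff hc t).hasDerivWithinAt (s := Iic t)
  have h2 : HasDerivWithinAt c 0 (Iic t) t :=
    (hasDerivWithinAt_const t (Iic t) x).congr (fun s hs => h s (le_trans hs ht)) (h t ht)
  exact (uniqueDiffWithinAt_Iic t).eq_deriv _ h1 h2

lemma deriv_eq_zero_of_const_Ici {c : ℝ → E} {x : E} (hc : ContDiff ℝ 1 c)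
    (h : ∀ t ≥ 1, c t = x) {t : ℝ} (ht : 1 ≤ t) : deriv c t = 0 := by
  have h1 := (hasDerivAt_of_contDiff hc t).hasDerivWithinAt (s := Ici t)
  have h2 : HasDerivWithinAt c 0 (Ici t) t :=
    (hasDerivWithinAt_const t (Ici t) x).congr (fun s hs => h s (le_trans ht hs)) (h t ht)
  exact (uniqueDiffWithinAt_Ici t).eq_deriv _ h1 h2

lemma intrinsicDist_lt_add {S : Set E} {x y z : E} {k l : ℝ}
    (h : intrinsicDist S x y < ENNReal.ofReal k) (h' : intrinsicDist S y z < ENNReal.ofReal l) :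
    intrinsicDist S x z ≤ ENNReal.ofReal (k + l) := by
  obtain ⟨c, hc, hS, h0, h1, hl⟩ := exists_path_of_intrinsicDist_lt h
  obtain ⟨d, hd, hS', h0', h1', hl'⟩ := exists_path_of_intrinsicDist_lt h'
  have hd' : ContDiff ℝ 1 fun t : ℝ => d (t - 1) := hd.comp (contDiff_id.sub contDiff_const)
  -- Concatenation without gluing: on each side of t = 1 one of the two summands is constantly y, so
  -- the sum is C¹ and follows first c, then d.
  set e : ℝ → E := fun t => c t + d (t - 1) - y with he
  have hes : ContDiff ℝ 1 e := (hc.add hd').sub contDiff_const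
  have hed : ∀ t, deriv e t = deriv c t + deriv d (t - 1) := by
    intro t
    have h2 : HasDerivAt (fun t : ℝ => d (t - 1)) (deriv d (t - 1)) t := by
      exact (hasDerivAt_of_contDiff hd (t - 1)).comp_sub_const t 1
    exact (((hasDerivAt_of_contDiff hc t).add h2).sub_const y).deriv
  have hle : ∀ t ≤ 1, e t = c t := fun t ht => by
    simp [he, h0' (t - 1) (by linarith)]
  have hge : ∀ t ≥ 1, e t = d (t - 1) := fun t ht => by
    simp [he, h1 t ht]
  have key := intrinsicDist_le_of_path (S := S) hes (a := 0) (b := 2) (by norm_num) (fun t _ => by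
    rcases le_total t 1 with ht | ht
    · rw [hle t ht]; exact hS t
    · rw [hge t ht]; exact hS' _)
  rw [hle 0 zero_le_one, h0 0 le_rfl, hge 2 one_le_two, h1' (2 - 1) (by norm_num)] at key
  refine key.trans (ENNReal.ofReal_le_ofReal ?_)
  have hint := fun a b => (continuous_speed hes).intervalIntegrable (μ := MeasureTheory.volume) a b
  rw [← intervalIntegral.integral_add_adjacent_intervals (hint 0 1) (hint 1 2)]
  have i1 : ∫ t in (0 : ℝ)..1, speed e t = ∫ t in (0 : ℝ)..1, speed c t := by
    refine intervalIntegral.integral_congr fun t ht => ?_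
    rw [uIcc_of_le zero_le_one] at ht
    simp only [speed, hed, deriv_eq_zero_of_const_Iic hd h0' (by linarith [ht.2] : t - 1 ≤ 0),
      add_zero]
  have i2 : ∫ t in (1 : ℝ)..2, speed e t = ∫ t in (0 : ℝ)..1, speed d t := by
    have : ∫ t in (1 : ℝ)..2, speed e t = ∫ t in (1 : ℝ)..2, speed d (t - 1) := by
      refine intervalIntegral.integral_congr fun t ht => ?_
      rw [uIcc_of_le one_le_two] at ht
      simp only [speed, hed, deriv_eq_zero_of_const_Ici hc h1 ht.1, zero_add]
    rw [this, intervalIntegral.integral_comp_sub_right]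
    norm_num
  rw [i1, i2]
  linarith

lemma intrinsicDist_triangle (S : Set E) (x y z : E) :
    intrinsicDist S x z ≤ intrinsicDist S x y + intrinsicDist S y z := by
  refine ENNReal.le_of_forall_pos_le_add fun ε hε hlt => ?_
  obtain ⟨h1, h2⟩ := ENNReal.add_lt_top.mp hlt
  have hε2 : (0 : ℝ) < ε / 2 := by have : (0 : ℝ) < ε := hε; positivity
  have key : ∀ {a : ENNReal}, a < ⊤ → a < ENNReal.ofReal (a.toReal + ε / 2) := by
    intro a ha
    rw [ENNReal.ofReal_add ENNReal.toReal_nonneg hε2.le, ENNReal.ofReal_toReal ha.ne]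
    exact ENNReal.lt_add_right ha.ne (by simpa using hε2)
  refine (intrinsicDist_lt_add (key h1) (key h2)).trans (le_of_eq ?_)
  have : (intrinsicDist S x y).toReal + ε / 2 + ((intrinsicDist S y z).toReal + ε / 2)
      = (intrinsicDist S x y).toReal + (intrinsicDist S y z).toReal + ε := by ring
  rw [this, ENNReal.ofReal_add (by positivity) ε.coe_nonneg, ENNReal.ofReal_add (by positivity)
    (by positivity), ENNReal.ofReal_toReal h1.ne, ENNReal.ofReal_toReal h2.ne]
  simp

/-- The intrinsic distance is a length distance. -/
lemma exists_between_of_intrinsicDist_lt {S : Set E} {x y : E} (hy : y ∈ S) {s t : ℝ}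
    (hs : 0 < s) (ht : 0 < t) (h : intrinsicDist S x y < ENNReal.ofReal (s + t)) :
    ∃ z ∈ S, intrinsicDist S x z < ENNReal.ofReal s ∧ intrinsicDist S z y < ENNReal.ofReal t := by
  obtain ⟨c, hc, hS, h0, h1, hl⟩ := exists_path_of_intrinsicDist_lt h
  set F : ℝ → ℝ := fun τ => ∫ t in (0 : ℝ)..τ, speed c t with hF
  have hint := fun a b => (continuous_speed hc).intervalIntegrable (μ := MeasureTheory.volume) a b
  have hFc : Continuous F := intervalIntegral.continuous_primitive hint 0
  rcases lt_or_ge (F 1) s with hlt | hge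
  · refine ⟨y, hy, ?_, by rw [intrinsicDist_self hy]; simpa using ht⟩
    have := intrinsicDist_le_of_path (S := S) hc zero_le_one (fun t _ => hS t)
    rw [h0 0 le_rfl, h1 1 le_rfl] at this
    exact this.trans_lt ((ENNReal.ofReal_lt_ofReal_iff hs).mpr hlt)
  · have hF0 : F 0 = 0 := by simp [hF]
    have hl2 : F 1 < s + t := hl
    -- The path is cut at a length s' strictly between F 1 - t and s, so that the first part is
    -- shorter than s and the rest shorter than t.
    set s' := (max 0 (F 1 - t) + s) / 2 with hs'
    have hm : max 0 (F 1 - t) < s := max_lt hs (by linarith)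
    have hm1 := le_max_left 0 (F 1 - t)
    have hm2 := le_max_right 0 (F 1 - t)
    obtain ⟨τ, hτ, hFτ⟩ : s' ∈ F '' Icc 0 1 :=
      intermediate_value_Icc zero_le_one hFc.continuousOn ⟨by linarith, by linarith⟩
    refine ⟨c τ, hS τ, ?_, ?_⟩
    · have := intrinsicDist_le_of_path (S := S) hc hτ.1 (fun t _ => hS t)
      rw [h0 0 le_rfl] at this
      exact this.trans_lt ((ENNReal.ofReal_lt_ofReal_iff hs).mpr
        (show F τ < s by linarith))
    · have := intrinsicDist_le_of_path (S := S) hc hτ.2 (fun t _ => hS t)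
      rw [h1 1 le_rfl] at this
      refine this.trans_lt ((ENNReal.ofReal_lt_ofReal_iff ht).mpr ?_)
      have := intervalIntegral.integral_add_adjacent_intervals (hint 0 τ) (hint τ 1)
      have e1 : F τ + ∫ t in τ..1, speed c t = F 1 := this
      linarith

/-! ### The intrinsic topology -/

/-- Along a path in hyperbolic space, `cosh` of the distance to a fixed point grows at most
exponentially in the length. -/
lemma mink_path_le {c : ℝ → E} (hc : ContDiff ℝ 1 c) (hmem : ∀ t, c t ∈ hyp3) {x : E}
    (hx : x ∈ hyp3) :
    -mink x (c 1) ≤ -mink x (c 0) * Real.exp (∫ t in (0 : ℝ)..1, speed c t) := by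
  set F : ℝ → ℝ := fun τ => ∫ t in (0 : ℝ)..τ, speed c t with hF
  have hFd : ∀ t, HasDerivAt F (speed c t) t := fun t =>
    intervalIntegral.integral_hasDerivAt_right
      ((continuous_speed hc).intervalIntegrable _ _)
      ((continuous_speed hc).stronglyMeasurableAtFilter _ _) (continuous_speed hc).continuousAt
  have hcd := hasDerivAt_of_contDiff hc
  have hf : ∀ t, HasDerivAt (fun t => -mink x (c t)) (-mink x (deriv c t)) t := fun t => by
    simpa using (hasDerivAt_mink (hasDerivAt_const t x) (hcd t)).fun_neg
  -- The projection of x to the tangent space at c(t) has square ⟨x, c⟩² - 1; Cauchy-Schwarz against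
  -- c' bounds the logarithmic growth rate of -⟨x, c⟩ by the speed.
  have hbound : ∀ t, -mink x (deriv c t) ≤ -mink x (c t) * speed c t := by
    intro t
    have hcc := (hmem t).1
    have htan : mink (deriv c t) (c t) = 0 :=
      mink_eq_zero_of_mem_tangentSet (S := hyp3) (fun _ h => h)
        ⟨fun s => c (t + s), by simp, Eventually.of_forall fun s => hmem _, by
          have := hcd (t + 0)
          simpa using this.comp_const_add t 0⟩
    have h1 := mink_sq_le (v := x + mink x (c t) • c t) hcc (by simp [hcc]) htan
    have h2 := mink_self_nonneg_of_orthogonal hcc htan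
    have h3 := mink_lt_zero hx (hmem t)
    simp only [mink_add_left, mink_add_right, mink_smul_left, mink_smul_right, hx.1, hcc,
      mink_comm (c t) (deriv c t), htan, mink_comm (c t) x] at h1
    have h4 : mink x (deriv c t) ^ 2 ≤ (-mink x (c t) * speed c t) ^ 2 := by
      rw [mul_pow, speed, Real.sq_sqrt h2]
      nlinarith
    have h5 := abs_le_of_sq_le_sq h4 (mul_nonneg (by linarith) (speed_nonneg c t))
    exact (neg_le_abs _).trans h5
  have hd : ∀ t, HasDerivAt (fun t => -mink x (c t) * Real.exp (-F t))
      (-mink x (deriv c t) * Real.exp (-F t)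
        + -mink x (c t) * (Real.exp (-F t) * -speed c t)) t := fun t =>
    (hf t).mul ((hFd t).neg.exp)
  have hanti : Antitone (fun t => -mink x (c t) * Real.exp (-F t)) := by
    refine antitone_of_deriv_nonpos (fun t => (hd t).differentiableAt) fun t => ?_
    rw [(hd t).deriv]
    have := mul_le_mul_of_nonneg_right (hbound t) (Real.exp_pos (-F t)).le
    linarith
  have h01 := hanti (zero_le_one (α := ℝ))
  have hF0 : F 0 = 0 := by simp [hF]
  simp only [hF0, neg_zero, Real.exp_zero, mul_one] at h01
  rw [Real.exp_neg, ← div_eq_mul_inv, div_le_iff₀ (Real.exp_pos _)] at h01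
  exact h01

lemma mink_le_of_intrinsicDist_lt {S : Set E} (hS : S ⊆ hyp3) {x y z : E} (hz : z ∈ hyp3) {l : ℝ}
    (h : intrinsicDist S x y < ENNReal.ofReal l) : -mink z y ≤ -mink z x * Real.exp l := by
  obtain ⟨c, hc, hmem, h0, h1, hl⟩ := exists_path_of_intrinsicDist_lt h
  have := mink_path_le hc (fun t => hS (hmem t)) hz
  rw [h0 0 le_rfl, h1 1 le_rfl] at this
  refine this.trans (mul_le_mul_of_nonneg_left (Real.exp_le_exp.mpr hl.le) ?_)
  have := mink_lt_zero hz (h0 0 le_rfl ▸ hS (hmem 0))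
  linarith

/-- The intrinsic distance controls the distance of the ambient space. -/
lemma exists_norm_sub_lt_of_intrinsicDist_lt {S : Set E} (hS : S ⊆ hyp3) {x : E} (hx : x ∈ S)
    {ε : ℝ} (hε : 0 < ε) :
    ∃ δ > 0, ∀ y ∈ S, intrinsicDist S x y < ENNReal.ofReal δ → ‖x - y‖ < ε := by
  have hcont : ContinuousAt (fun d : ℝ => 4 * (x 0 + x 0 * Real.exp d) ^ 2 * (Real.exp d - 1)) 0 := by
    fun_prop
  have hev : ∀ᶠ d in 𝓝 (0 : ℝ),
      4 * (x 0 + x 0 * Real.exp d) ^ 2 * (Real.exp d - 1) < ε ^ 2 :=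
    hcont.eventually_lt continuousAt_const (by simp; positivity)
  obtain ⟨δ, hδ, hball⟩ := Metric.eventually_nhds_iff.mp hev
  refine ⟨δ / 2, by positivity, fun y hy hd => ?_⟩
  have h1 := mink_le_of_intrinsicDist_lt hS (hS hx) hd
  rw [(hS hx).1] at h1
  -- Minus the product with this base point is the height, so the same growth estimate also bounds
  -- `y 0`, as the comparison of chord and norm requires.
  have he : (EuclideanSpace.single 0 1 : E) ∈ hyp3 := ⟨by simp [mink], by simp⟩
  have h2 := mink_le_of_intrinsicDist_lt hS he hd
  have he' : ∀ z : E, -mink (EuclideanSpace.single 0 1) z = z 0 := by intro z; simp [mink]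
  rw [he', he'] at h2
  have h3 := norm_sub_sq_le (hS hx) (hS hy)
  rw [mink_chord (hS hx) (hS hy)] at h3
  have h4 := hball (y := δ / 2) (by simp [abs_of_pos hδ]; linarith)
  have hx0 := (hS hx).2
  have hy0 := (hS hy).2
  have h5 : (x 0 + y 0) ^ 2 ≤ (x 0 + x 0 * Real.exp (δ / 2)) ^ 2 :=
    pow_le_pow_left₀ (by positivity) (by linarith) 2
  have h6 : 0 ≤ -1 - mink x y := by linarith [mink_le_neg_one (hS hx) (hS hy)]
  have h7 : (x 0 + y 0) ^ 2 * (-1 - mink x y)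
      ≤ (x 0 + x 0 * Real.exp (δ / 2)) ^ 2 * (Real.exp (δ / 2) - 1) :=
    mul_le_mul h5 (by linarith) h6 (by positivity)
  exact lt_of_pow_lt_pow_left₀ 2 hε.le (by nlinarith)

/-- The Minkowski length of the chord between two points. -/
noncomputable def chord (x y : E) : ℝ := Real.sqrt (mink (x - y) (x - y))

lemma chord_sq {x y : E} (hx : x ∈ hyp3) (hy : y ∈ hyp3) :
    chord x y ^ 2 = mink (x - y) (x - y) := Real.sq_sqrt (mink_chord_nonneg hx hy)

lemma chord_le_norm (x y : E) : chord x y ≤ ‖x - y‖ :=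
  Real.sqrt_le_iff.mpr ⟨norm_nonneg _, mink_self_le _⟩

lemma norm_sub_le_chord {x y : E} (hx : x ∈ hyp3) (hy : y ∈ hyp3) {X : ℝ} (hxX : x 0 ≤ X)
    (hyX : y 0 ≤ X) : ‖x - y‖ ≤ 4 * X * chord x y := by
  have hx0 := hx.2
  have hy0 := hy.2
  have hX : 0 < X := hx0.trans_le hxX
  have h := norm_sub_sq_le hx hy
  have h1 : (x 0 + y 0) ^ 2 ≤ (2 * X) ^ 2 := pow_le_pow_left₀ (by linarith) (by linarith) 2
  have hc := chord_sq hx hy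
  have h0 : 0 ≤ chord x y := Real.sqrt_nonneg _
  refine le_of_sq_le_sq ?_ (by positivity)
  rw [mul_pow, mul_pow, hc]
  rw [← hc] at h ⊢
  nlinarith [mul_le_mul_of_nonneg_right h1 (sq_nonneg (chord x y)),
    mul_nonneg (sq_nonneg X) (sq_nonneg (chord x y))]

lemma abs_coord_le_norm (x : E) (i : Fin 4) : |x i| ≤ ‖x‖ := by
  simpa using EuclideanSpace.norm_eq x ▸ PiLp.norm_apply_le x i

/-- Locally the intrinsic distance is at most twice the length of the chord. -/
lemma IsEmbeddedSurface.exists_intrinsicDist_le_chord {S : Set E} (hS : IsEmbeddedSurface S)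
    {x : E} (hx : x ∈ S) :
    ∃ δ > 0, ∀ y ∈ S, ∀ z ∈ S, ‖y - x‖ < δ → ‖z - x‖ < δ →
      intrinsicDist S y z ≤ ENNReal.ofReal (2 * chord y z) := by
  obtain ⟨W, r, hxW, h⟩ := hS.exists_isLocalRetraction hx
  set X := x 0 + 1 with hX
  have hX0 : 0 < X := by have := (hS.1 hx).2; linarith
  -- The squared speed of the projected segment will exceed the squared chord by at most 8η‖z - y‖².
  -- With ‖z - y‖ ≤ 4X · chord, this choice bounds the excess by three squared chords, which gives
  -- the factor 2.
  obtain ⟨η, hη, hη1, hηX⟩ : ∃ η > 0, η ≤ 1 ∧ 8 * η * (4 * X) ^ 2 ≤ 3 := by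
    refine ⟨min 1 (3 / (8 * (4 * X) ^ 2)), by positivity, min_le_left _ _, ?_⟩
    have := min_le_right 1 (3 / (8 * (4 * X) ^ 2))
    rw [le_div_iff₀ (by positivity)] at this
    linarith
  have hdc : ContinuousAt (fderiv ℝ r) x :=
    ((h.contDiffAt hxW).fderiv_right (m := 2) (by norm_num)).continuousAt
  have hev : ∀ᶠ y in 𝓝 x, y ∈ W ∧ ‖fderiv ℝ r y - fderiv ℝ r x‖ ≤ η := by
    have h2 : ∀ᶠ y in 𝓝 x, fderiv ℝ r y ∈ Metric.closedBall (fderiv ℝ r x) η :=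
      hdc.eventually_mem (Metric.closedBall_mem_nhds _ hη)
    filter_upwards [h.isOpen.mem_nhds hxW, h2] with y h1 h2
    exact ⟨h1, by rwa [Metric.mem_closedBall, dist_eq_norm] at h2⟩
  obtain ⟨δ, hδ, hball⟩ := Metric.eventually_nhds_iff_ball.mp hev
  refine ⟨min δ 1, by positivity, fun y hy z hz hyx hzx => ?_⟩
  have hyb : y ∈ Metric.ball x δ := by
    rw [Metric.mem_ball, dist_eq_norm]; exact hyx.trans_le (min_le_left _ _)
  have hzb : z ∈ Metric.ball x δ := by
    rw [Metric.mem_ball, dist_eq_norm]; exact hzx.trans_le (min_le_left _ _)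
  have hX' : ∀ w : E, ‖w - x‖ < min δ 1 → w 0 ≤ X := by
    intro w hw
    have h1 := (le_abs_self _).trans (abs_coord_le_norm (w - x) 0)
    have h2 := hw.trans_le (min_le_right _ _)
    simp at h1
    linarith
  have hseg : ∀ t ∈ Icc (0 : ℝ) 1, y + t • (z - y) ∈ Metric.ball x δ := fun t ht =>
    (convex_ball x δ).add_smul_sub_mem hyb hzb ht
  have hcd : ∀ t ∈ Icc (0 : ℝ) 1, HasDerivAt (fun t : ℝ => r (y + t • (z - y)))
      (fderiv ℝ r (y + t • (z - y)) (z - y)) t := by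
    intro t ht
    have h1 : HasDerivAt (fun t : ℝ => y + t • (z - y)) (z - y) t := by
      simpa using ((hasDerivAt_id t).smul_const (z - y)).const_add y
    exact (h.hasFDerivAt (hball _ (hseg t ht)).1).comp_hasDerivAt t h1
  -- Since r fixes y and z, the mean value inequality shows that secants of S are almost fixed by dr
  -- at x.
  have hδ' : ‖(z - y) - fderiv ℝ r x (z - y)‖ ≤ η * ‖z - y‖ := by
    have := (convex_ball x δ).norm_image_sub_le_of_norm_hasFDerivWithin_le'
      (fun w hw => (h.hasFDerivAt (hball w hw).1).hasFDerivWithinAt)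
      (fun w hw => (hball w hw).2) hyb hzb
    rwa [h.fix y hy (hball y hyb).1, h.fix z hz (hball z hzb).1] at this
  have hch : chord z y ^ 2 = mink (z - y) (z - y) := chord_sq (hS.1 hz) (hS.1 hy)
  have hch0 : 0 ≤ chord z y := Real.sqrt_nonneg _
  have hcomm : chord y z = chord z y := by
    rw [chord, chord, ← neg_sub z y, mink_neg_left, mink_neg_right, neg_neg]
  have hnc := norm_sub_le_chord (hS.1 hz) (hS.1 hy) (hX' z hzx) (hX' y hyx)
  have hspeed : ∀ t ∈ Icc (0 : ℝ) 1, Real.sqrt (mink (fderiv ℝ r (y + t • (z - y)) (z - y))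
      (fderiv ℝ r (y + t • (z - y)) (z - y))) ≤ 2 * chord z y := by
    intro t ht
    set v := z - y with hv
    set e := fderiv ℝ r (y + t • v) v - v with he
    have he1 : ‖e‖ ≤ 2 * η * ‖v‖ := by
      have h1 : ‖(fderiv ℝ r (y + t • v) - fderiv ℝ r x) v‖ ≤ η * ‖v‖ :=
        (ContinuousLinearMap.le_opNorm _ _).trans
          (mul_le_mul_of_nonneg_right (hball _ (hseg t ht)).2 (norm_nonneg _))
      have h2 : e = (fderiv ℝ r (y + t • v) - fderiv ℝ r x) v - (v - fderiv ℝ r x v) := by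
        simp [he]
      rw [h2]
      refine (norm_sub_le _ _).trans ?_
      linarith
    have hve : fderiv ℝ r (y + t • v) v = v + e := by simp [he]
    rw [hve]
    refine Real.sqrt_le_iff.mpr ⟨by positivity, ?_⟩
    have h3 : mink (v + e) (v + e) = mink v v + 2 * mink v e + mink e e := by
      simp [mink_comm e v]; ring
    have h4 := (le_abs_self _).trans (abs_mink_le v e)
    have h5 := mink_self_le e
    have hn := norm_nonneg v
    have h6 : ‖v‖ * ‖e‖ ≤ 2 * η * ‖v‖ ^ 2 := by nlinarith
    have h7 : ‖e‖ ^ 2 ≤ 4 * η * ‖v‖ ^ 2 := by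
      calc ‖e‖ ^ 2 ≤ (2 * η * ‖v‖) ^ 2 := pow_le_pow_left₀ (norm_nonneg _) he1 2
        _ = η * (4 * η * ‖v‖ ^ 2) := by ring
        _ ≤ 1 * (4 * η * ‖v‖ ^ 2) := mul_le_mul_of_nonneg_right hη1 (by positivity)
        _ = _ := one_mul _
    have h8 : ‖v‖ ^ 2 ≤ (4 * X) ^ 2 * chord z y ^ 2 := by
      rw [← mul_pow]; exact pow_le_pow_left₀ hn hnc 2
    have h9 : 8 * η * ‖v‖ ^ 2 ≤ 3 * chord z y ^ 2 := by
      calc 8 * η * ‖v‖ ^ 2 ≤ 8 * η * ((4 * X) ^ 2 * chord z y ^ 2) :=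
            mul_le_mul_of_nonneg_left h8 (by positivity)
        _ = (8 * η * (4 * X) ^ 2) * chord z y ^ 2 := by ring
        _ ≤ _ := mul_le_mul_of_nonneg_right hηX (sq_nonneg _)
    rw [h3, ← hch, mul_pow]
    linarith
  rw [hcomm]
  have hcs : ContDiffOn ℝ 1 (fun t : ℝ => r (y + t • (z - y))) (Icc 0 1) := by
    intro t ht
    refine ContDiffAt.contDiffWithinAt ?_
    have h1 : ContDiffAt ℝ 1 r (y + t • (z - y)) :=
      (h.contDiffAt (hball _ (hseg t ht)).1).of_le (by norm_num)
    have h2 : ContDiffAt ℝ 1 (fun t : ℝ => y + t • (z - y)) t := by fun_prop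
    exact h1.comp t h2
  have hle : intrinsicDist S y z ≤
      ENNReal.ofReal (curveLength fun t : ℝ => r (y + t • (z - y))) :=
    sInf_le ⟨fun t : ℝ => r (y + t • (z - y)), hcs,
    fun t ht => h.mapsTo _ (hball _ (hseg t ht)).1, by simpa using h.fix y hy (hball y hyb).1,
    by simpa using h.fix z hz (hball z hzb).1, rfl⟩
  refine hle.trans (ENNReal.ofReal_le_ofReal ?_)
  rw [curveLength]
  have := intervalIntegral.norm_integral_le_of_norm_le_const (a := 0) (b := 1)
    (f := fun t => Real.sqrt (mink (derivWithin (fun t : ℝ => r (y + t • (z - y))) (Icc 0 1) t)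
      (derivWithin (fun t : ℝ => r (y + t • (z - y))) (Icc 0 1) t)))
    (C := 2 * chord z y) (fun t ht => by
      rw [uIoc_of_le zero_le_one] at ht
      have ht' : t ∈ Icc (0 : ℝ) 1 := ⟨ht.1.le, ht.2⟩
      rw [(hcd t ht').hasDerivWithinAt.derivWithin (uniqueDiffOn_Icc zero_lt_one t ht'),
        Real.norm_of_nonneg (Real.sqrt_nonneg _)]
      exact hspeed t ht')
  simp only [sub_zero, abs_one, mul_one] at this
  exact (le_abs_self _).trans this

/-! ### Compactness of intrinsic balls -/

/-- The Hopf-Rinow theorem for a length metric that is given as a function compatible with a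
topology. -/
theorem isCompact_of_length_dist {X : Type*} [TopologicalSpace X] [LocallyCompactSpace X]
    (d : X → X → ℝ) (hself : ∀ x, d x x = 0) (hcomm : ∀ x y, d x y = d y x)
    (htri : ∀ x y z, d x z ≤ d x y + d y z)
    (htop : ∀ s : Set X, IsOpen s ↔ ∀ x ∈ s, ∃ ε > 0, ∀ y, d x y < ε → y ∈ s)
    (hzero : ∀ x y, d x y = 0 → x = y)
    (hcomplete : ∀ u : ℕ → X, (∀ ε > 0, ∃ N, ∀ i ≥ N, ∀ j ≥ N, d (u i) (u j) < ε) →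
      ∃ y, Tendsto (fun i => d (u i) y) atTop (𝓝 0))
    (hl : ∀ (x y : X) (s t : ℝ), 0 < s → 0 < t → d x y < s + t → ∃ z, d x z < s ∧ d z y < t)
    (p : X) (R : ℝ) : IsCompact {y | d p y ≤ R} := by
  -- Built over the given topology, so that compactness for the metric is compactness for that
  -- topology.
  let inst : MetricSpace X :=
    { PseudoMetricSpace.ofDistTopology d hself hcomm htri htop with
      eq_of_dist_eq_zero := fun {x y} h => hzero x y h }
  have : CompleteSpace X := by
    refine Metric.complete_of_cauchySeq_tendsto fun u hu => ?_
    obtain ⟨y, hy⟩ := hcomplete u (Metric.cauchySeq_iff.mp hu)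
    exact ⟨y, tendsto_iff_dist_tendsto_zero.mpr hy⟩
  have heq : {y | d p y ≤ R} = Metric.closedBall p R := by
    ext y
    rw [Metric.mem_closedBall, dist_comm]
    rfl
  rw [heq]
  exact isCompact_closedBall_of_length hl p R

/-- Near each point of the surface, the surface is intrinsically close. -/
lemma IsEmbeddedSurface.eventually_intrinsicDist_lt {S : Set E} (hS : IsEmbeddedSurface S)
    {x : E} (hx : x ∈ S) {ε : ENNReal} (hε : 0 < ε) :
    ∀ᶠ y in 𝓝[S] x, intrinsicDist S x y < ε := by
  obtain ⟨δ, hδ, h⟩ := hS.exists_intrinsicDist_le_chord hx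
  have hc : ContinuousAt (fun y => ENNReal.ofReal (2 * chord x y)) x := by
    refine ENNReal.continuous_ofReal.continuousAt.comp ?_
    refine Continuous.continuousAt (continuous_const.mul (Continuous.sqrt ?_))
    exact continuous_mink.comp (f := fun y => (x - y, x - y)) (by fun_prop)
  have h1 : ∀ᶠ y in 𝓝 x, ENNReal.ofReal (2 * chord x y) < ε :=
    hc.eventually_lt continuousAt_const (by simpa [chord] using hε)
  have h2 : ∀ᶠ y in 𝓝 x, ‖y - x‖ < δ := by
    filter_upwards [Metric.ball_mem_nhds x hδ] with y hy
    rwa [Metric.mem_ball, dist_eq_norm] at hy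
  filter_upwards [self_mem_nhdsWithin, h1.filter_mono nhdsWithin_le_nhds,
    h2.filter_mono nhdsWithin_le_nhds] with y hy h1 h2
  exact (h x hx y hy (by simpa using hδ) h2).trans_lt h1

/-- The points at finite intrinsic distance from x form an open and closed subset of S, because
nearby points are at finite distance from each other. -/
lemma IsEmbeddedSurface.intrinsicDist_lt_top {S : Set E} (hS : IsEmbeddedSurface S)
    (hconn : IsConnected S) {x y : E} (hx : x ∈ S) (hy : y ∈ S) : intrinsicDist S x y < ⊤ := by
  have : PreconnectedSpace S := isPreconnected_iff_preconnectedSpace.mp hconn.isPreconnected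
  let A : Set S := {z | intrinsicDist S x z < ⊤}
  have hnear : ∀ z : S, ∀ᶠ w : S in 𝓝 z, intrinsicDist S z w < ⊤ := fun z => by
    have := hS.eventually_intrinsicDist_lt z.2 (ε := ⊤) (by simp)
    rw [eventually_nhds_subtype_iff S z (fun w => intrinsicDist S z w < ⊤)]
    exact this
  have hA : IsClopen A := by
    constructor
    · rw [← isOpen_compl_iff, isOpen_iff_mem_nhds]
      intro z hz
      filter_upwards [hnear z] with w hw hwA
      refine hz ((intrinsicDist_triangle S x w z).trans_lt (ENNReal.add_lt_top.mpr ⟨hwA, ?_⟩))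
      rwa [intrinsicDist_comm]
    · rw [isOpen_iff_mem_nhds]
      intro z hz
      filter_upwards [hnear z] with w hw
      exact (intrinsicDist_triangle S x z w).trans_lt (ENNReal.add_lt_top.mpr ⟨hz, hw⟩)
  have huniv := hA.eq_univ ⟨⟨x, hx⟩, by simp [A, intrinsicDist_self hx]⟩
  have : (⟨y, hy⟩ : S) ∈ A := huniv ▸ mem_univ _
  exact this

/-- Near each of its points S is the fixed-point set of a retraction, so it is locally closed in ℝ⁴.
-/
lemma IsEmbeddedSurface.locallyCompactSpace {S : Set E} (hS : IsEmbeddedSurface S) :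
    LocallyCompactSpace S := by
  suffices WeaklyLocallyCompactSpace S by infer_instance
  refine ⟨fun x => ?_⟩
  obtain ⟨W, r, hxW, h⟩ := hS.exists_isLocalRetraction x.2
  obtain ⟨δ, hδ, hball⟩ := Metric.nhds_basis_closedBall.mem_iff.mp (h.isOpen.mem_nhds hxW)
  have hK : IsCompact (S ∩ Metric.closedBall (x : E) δ) := by
    have : S ∩ Metric.closedBall (x : E) δ
        = Metric.closedBall (x : E) δ ∩ (fun y => r y - y) ⁻¹' {0} := by
      ext y
      simp only [mem_inter_iff, mem_preimage, mem_singleton_iff, sub_eq_zero]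
      constructor
      · rintro ⟨hy, hyb⟩
        exact ⟨hyb, h.fix y hy (hball hyb)⟩
      · rintro ⟨hyb, hy⟩
        exact ⟨hy ▸ h.mapsTo y (hball hyb), hyb⟩
    rw [this]
    refine (isCompact_closedBall (x : E) δ).of_isClosed_subset ?_ inter_subset_left
    exact ((h.contDiffOn.continuousOn.mono hball).sub continuousOn_id).preimage_isClosed_of_isClosed
      Metric.isClosed_closedBall isClosed_singleton
  refine ⟨Subtype.val ⁻¹' Metric.closedBall (x : E) δ, ?_,
    continuous_subtype_val.continuousAt.preimage_mem_nhds (Metric.closedBall_mem_nhds _ hδ)⟩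
  rw [Subtype.isCompact_iff, Subtype.image_preimage_coe]
  exact hK

/-- In a complete connected surface the intrinsic balls are compact. -/
theorem IsEmbeddedSurface.isCompact_intrinsicBall {S : Set E} (hS : IsEmbeddedSurface S)
    (hconn : IsConnected S) (hcomp : IsCompleteSurface S) {p : E} (hp : p ∈ S) {R : ℝ}
    (hR : 0 ≤ R) : IsCompact {y | y ∈ S ∧ intrinsicDist S p y ≤ ENNReal.ofReal R} := by
  have hfin : ∀ x y : S, intrinsicDist S x y ≠ ⊤ := fun x y =>
    (hS.intrinsicDist_lt_top hconn x.2 y.2).ne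
  have hlt : ∀ (x y : S) {l : ℝ}, 0 < l →
      ((intrinsicDist S x y).toReal < l ↔ intrinsicDist S x y < ENNReal.ofReal l) := by
    intro x y l hl
    rw [ENNReal.lt_ofReal_iff_toReal_lt (hfin x y)]
  have : LocallyCompactSpace S := hS.locallyCompactSpace
  have hball := isCompact_of_length_dist (X := S) (fun x y => (intrinsicDist S x y).toReal)
    (fun x => by simp [intrinsicDist_self x.2])
    (fun x y => by rw [intrinsicDist_comm])
    (fun x y z => by
      rw [← ENNReal.toReal_add (hfin x y) (hfin y z)]
      exact ENNReal.toReal_mono (ENNReal.add_ne_top.mpr ⟨hfin x y, hfin y z⟩)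
        (intrinsicDist_triangle S x y z))
    -- The two topologies agree: intrinsic closeness forces Euclidean closeness, and the local chord
    -- bound gives the converse.
    (fun s => by
      rw [isOpen_iff_mem_nhds]
      refine forall₂_congr fun x _ => ?_
      constructor
      · intro hs
        obtain ⟨ε, hε, hball⟩ := Metric.mem_nhds_iff.mp hs
        obtain ⟨δ, hδ, h⟩ := exists_norm_sub_lt_of_intrinsicDist_lt hS.1 x.2 hε
        refine ⟨δ, hδ, fun y hy => hball ?_⟩
        have := h y y.2 ((hlt x y hδ).mp hy)
        rw [Metric.mem_ball, dist_comm, Subtype.dist_eq, dist_eq_norm]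
        exact this
      · rintro ⟨ε, hε, h⟩
        have := hS.eventually_intrinsicDist_lt x.2 (ε := ENNReal.ofReal ε) (by simpa using hε)
        rw [← eventually_nhds_subtype_iff S x
          (fun w => intrinsicDist S x w < ENNReal.ofReal ε)] at this
        filter_upwards [this] with y hy using h y ((hlt x y hε).mpr hy))
    (fun x y hxy => by
      by_contra hne
      have hpos : 0 < ‖(x : E) - y‖ := norm_pos_iff.mpr (sub_ne_zero.mpr
        (fun h => hne (Subtype.ext h)))
      obtain ⟨δ, hδ, h⟩ := exists_norm_sub_lt_of_intrinsicDist_lt hS.1 x.2 hpos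
      exact lt_irrefl _ (h y y.2 ((hlt x y hδ).mp (by rw [hxy]; exact hδ))))
    (fun u hu => by
      obtain ⟨y, hy, hlim⟩ := hcomp (fun i => u i) (fun i => (u i).2) (fun ε hε => by
        obtain ⟨ε', hε', hε''⟩ : ∃ ε' : ℝ, 0 < ε' ∧ ENNReal.ofReal ε' ≤ ε := by
          rcases eq_or_ne ε ⊤ with rfl | hne
          · exact ⟨1, one_pos, le_top⟩
          · exact ⟨ε.toReal, ENNReal.toReal_pos hε.ne' hne, ENNReal.ofReal_toReal_le⟩
        obtain ⟨N, hN⟩ := hu ε' hε'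
        exact ⟨N, fun i hi j hj => ((hlt _ _ hε').mp (hN i hi j hj)).trans_le hε''⟩)
      exact ⟨⟨y, hy⟩, (ENNReal.tendsto_toReal ENNReal.zero_ne_top).comp hlim⟩)
    (fun x y s t hs ht hst => by
      obtain ⟨z, hz, h1, h2⟩ := exists_between_of_intrinsicDist_lt y.2 hs ht
        ((hlt x y (add_pos hs ht)).mp hst)
      exact ⟨⟨z, hz⟩, (hlt x ⟨z, hz⟩ hs).mpr h1, (hlt ⟨z, hz⟩ y ht).mpr h2⟩) ⟨p, hp⟩ R
  have himg := hball.image (continuous_subtype_val : Continuous (Subtype.val : S → E))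
  convert himg using 1
  ext y
  constructor
  · rintro ⟨hy, hd⟩
    exact ⟨⟨y, hy⟩, ENNReal.toReal_le_of_le_ofReal hR hd, rfl⟩
  · rintro ⟨y, hy, rfl⟩
    refine ⟨y.2, ?_⟩
    rw [← ENNReal.ofReal_toReal (hfin ⟨p, hp⟩ y)]
    exact ENNReal.ofReal_le_ofReal hy

/-! ### Second differences of points of a surface -/

/-- A property of triples that holds with some constant near each diagonal point of a compact set
holds with a uniform constant near the diagonal. -/
lemma exists_uniform_near_diagonal {B : Set E} (hB : IsCompact B) {P : E → E → E → ℝ → Prop}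
    (hmono : ∀ x y z C C', C ≤ C' → P x y z C → P x y z C')
    (hloc : ∀ a ∈ B, ∃ δ > 0, ∃ C, ∀ x ∈ B, ∀ y ∈ B, ∀ z ∈ B,
      ‖x - a‖ < δ → ‖y - a‖ < δ → ‖z - a‖ < δ → P x y z C) :
    ∃ δ > 0, ∃ C > 0, ∀ x ∈ B, ∀ y ∈ B, ∀ z ∈ B,
      ‖y - x‖ < δ → ‖z - x‖ < δ → P x y z C := by
  by_contra! hcon
  -- Counterexamples with δ = 1/(k + 1) and C = k + 1 accumulate at a diagonal point, where the
  -- local constant is eventually exceeded.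
  have hk : ∀ k : ℕ, ∃ x ∈ B, ∃ y ∈ B, ∃ z ∈ B,
      ‖y - x‖ < 1 / ((k : ℝ) + 1) ∧ ‖z - x‖ < 1 / ((k : ℝ) + 1) ∧ ¬ P x y z ((k : ℝ) + 1) :=
    fun k => hcon _ (by positivity) _ (by positivity)
  choose x hx y hy z hz hxy hxz hP using hk
  obtain ⟨a, ha, φ, hφ, hlim⟩ := hB.tendsto_subseq hx
  obtain ⟨δ, hδ, C, h⟩ := hloc a ha
  have h1 : Tendsto (fun k => 1 / ((φ k : ℝ) + 1)) atTop (𝓝 0) :=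
    tendsto_one_div_add_atTop_nhds_zero_nat.comp hφ.tendsto_atTop
  have e1 : ∀ᶠ k in atTop, 1 / ((φ k : ℝ) + 1) < δ / 2 :=
    h1.eventually_lt_const (by positivity)
  have e2 : ∀ᶠ k in atTop, ‖x (φ k) - a‖ < δ / 2 := by
    filter_upwards [hlim.eventually (Metric.ball_mem_nhds a (half_pos hδ))] with k hk
    rwa [dist_eq_norm] at hk
  have e3 : ∀ᶠ k in atTop, C ≤ (φ k : ℝ) + 1 := by
    have : Tendsto (fun k => (φ k : ℝ)) atTop atTop :=
      tendsto_natCast_atTop_atTop.comp hφ.tendsto_atTop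
    filter_upwards [this.eventually_ge_atTop C] with k hk
    linarith
  obtain ⟨k, hk1, hk2, hk3⟩ := (e1.and (e2.and e3)).exists
  have hnear : ∀ w, ‖w - x (φ k)‖ < 1 / ((φ k : ℝ) + 1) → ‖w - a‖ < δ := by
    intro w hw
    have := norm_sub_le_norm_sub_add_norm_sub w (x (φ k)) a
    linarith
  exact hP (φ k) (hmono _ _ _ _ _ hk3 (h _ (hx _) _ (hy _) _ (hz _) (by linarith)
    (hnear _ (hxy _)) (hnear _ (hxz _))))

/-- Second order Taylor estimate for a map whose second derivative is Lipschitz. -/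
lemma norm_taylor_two_le {f : E → E} {f' : E → E →L[ℝ] E} {f'' : E → E →L[ℝ] E →L[ℝ] E}
    {s : Set E} (hs : Convex ℝ s) (hf : ∀ x ∈ s, HasFDerivAt f (f' x) x)
    (hf' : ∀ x ∈ s, HasFDerivAt f' (f'' x) x) (hsymm : ∀ x ∈ s, ∀ v w, f'' x v w = f'' x w v)
    {K : ℝ} (hK : ∀ x ∈ s, ∀ y ∈ s, ‖f'' x - f'' y‖ ≤ K * ‖x - y‖) (hK0 : 0 ≤ K)
    {y z : E} (hy : y ∈ s) (hz : z ∈ s) :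
    ‖f z - f y - f' y (z - y) - (1 / 2 : ℝ) • f'' y (z - y) (z - y)‖ ≤ K * ‖z - y‖ ^ 3 := by
  set R := ‖z - y‖
  have hR : 0 ≤ R := norm_nonneg _
  -- Cutting down to this ball turns the Lipschitz bound into the constant K·R; two applications of
  -- the mean value inequality then give K·R³.
  set s' := s ∩ Metric.closedBall y R
  have hs' : Convex ℝ s' := hs.inter (convex_closedBall y R)
  have hy' : y ∈ s' := ⟨hy, Metric.mem_closedBall_self hR⟩
  have hz' : z ∈ s' := ⟨hz, by rw [Metric.mem_closedBall, dist_eq_norm]⟩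
  have hnear : ∀ u ∈ s', ‖u - y‖ ≤ R := fun u hu => by
    have := hu.2; rwa [Metric.mem_closedBall, dist_eq_norm] at this
  have h1 : ∀ u ∈ s', ‖f' u - f' y - f'' y (u - y)‖ ≤ K * R ^ 2 := by
    intro u hu
    have := hs'.norm_image_sub_le_of_norm_hasFDerivWithin_le' (C := K * R)
      (fun w hw => (hf' w hw.1).hasFDerivWithinAt)
      (fun w hw => (hK w hw.1 y hy).trans (mul_le_mul_of_nonneg_left (hnear w hw) hK0)) hy' hu
    refine this.trans ?_
    have := mul_le_mul_of_nonneg_left (hnear u hu) (mul_nonneg hK0 hR)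
    linarith [this, (by ring : K * R * R = K * R ^ 2)]
  have hg : ∀ u ∈ s', HasFDerivWithinAt
      (fun u => f u - (1 / 2 : ℝ) • f'' y (u - y) (u - y)) (f' u - f'' y (u - y)) s' u := by
    intro u hu
    have hid : HasFDerivAt (fun u : E => u - y) (ContinuousLinearMap.id ℝ E) u :=
      (hasFDerivAt_id u).sub_const y
    have hb : HasFDerivAt (fun u : E => f'' y (u - y)) (f'' y) u := by
      exact (f'' y).hasFDerivAt.comp u hid
    have hq := (hb.clm_apply hid).const_smul (1 / 2 : ℝ)
    refine (((hf u hu.1).sub hq).congr_fderiv ?_).hasFDerivWithinAt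
    ext1 v
    simp only [sub_apply, smul_apply, add_apply, ContinuousLinearMap.comp_apply,
      ContinuousLinearMap.flip_apply, ContinuousLinearMap.id_apply, hsymm y hy v (u - y)]
    rw [← two_smul ℝ, smul_smul]
    norm_num
  have h2 := hs'.norm_image_sub_le_of_norm_hasFDerivWithin_le' (φ := f' y) (C := K * R ^ 2) hg
    (fun u hu => by
      have := h1 u hu
      rwa [sub_right_comm] at this) hy' hz'
  have e : f z - f y - f' y (z - y) - (1 / 2 : ℝ) • f'' y (z - y) (z - y)
      = f z - (1 / 2 : ℝ) • f'' y (z - y) (z - y)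
        - (f y - (1 / 2 : ℝ) • f'' y (y - y) (y - y)) - f' y (z - y) := by
    simp only [sub_self, map_zero, smul_zero, sub_zero]
    abel
  rw [e]
  calc _ ≤ K * R ^ 2 * R := h2
    _ = K * R ^ 3 := by ring

/-- The projection to the Minkowski normal space of a surface with unit normal `ν` at `y`. -/
noncomputable def normalPart (y ν z : E) : E := -mink z y • y + mink z ν • ν

lemma normalPart_add (y ν z w : E) :
    normalPart y ν (z + w) = normalPart y ν z + normalPart y ν w := by
  simp only [normalPart, mink_add_left, neg_add, add_smul]; abel

lemma normalPart_smul (y ν : E) (a : ℝ) (z : E) :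
    normalPart y ν (a • z) = a • normalPart y ν z := by
  simp only [normalPart, mink_smul_left, smul_add, smul_smul, mul_neg]

lemma norm_normalPart_le (y ν z : E) : ‖normalPart y ν z‖ ≤ (‖y‖ ^ 2 + ‖ν‖ ^ 2) * ‖z‖ := by
  refine (norm_add_le _ _).trans ?_
  rw [norm_smul, norm_smul, norm_neg, Real.norm_eq_abs, Real.norm_eq_abs]
  have h1 := mul_le_mul_of_nonneg_right (abs_mink_le z y) (norm_nonneg y)
  have h2 := mul_le_mul_of_nonneg_right (abs_mink_le z ν) (norm_nonneg ν)
  nlinarith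

/-- The acceleration that a curve of the surface through `y` with velocity `v` has in normal
directions. -/
noncomputable def normalAccel (r N : E → E) (y v : E) : E :=
  normalPart y (N y) (fderiv ℝ (fderiv ℝ r) y v v)

namespace IsLocalModel

variable {S W : Set E} {r N : E → E} {y : E}

lemma normalPart_of_mem_tangentSet (h : IsLocalModel S W r N) (hS : S ⊆ hyp3) (hyS : y ∈ S)
    (hy : y ∈ W) {v : E} (hv : v ∈ tangentSet S y) : normalPart y (N y) v = 0 := by
  simp [normalPart, mink_eq_zero_of_mem_tangentSet hS hv, mink_comm v (N y),
    (h.unitNormal y hyS hy).2.2 v hv]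

lemma mink_normalPart (h : IsLocalModel S W r N) (hS : S ⊆ hyp3) (hyS : y ∈ S)
    (hy : y ∈ W) {v : E} (hv : v ∈ tangentSet S y) (z : E) :
    mink (normalPart y (N y) z) v = 0 := by
  simp [normalPart, mink_comm y v, mink_eq_zero_of_mem_tangentSet hS hv,
    (h.unitNormal y hyS hy).2.2 v hv]

lemma normalPart_eq_self (h : IsLocalModel S W r N) (hS : S ⊆ hyp3) (hyS : y ∈ S)
    (hy : y ∈ W) {z : E} (hz : ∀ v ∈ tangentSet S y, mink z v = 0) :
    normalPart y (N y) z = z := by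
  have hN := h.unitNormal y hyS hy
  have hyy := (hS hyS).1
  have d1 : mink (z - normalPart y (N y) z) y = 0 := by simp [normalPart, hN.1, hyy]
  have d2 : mink (z - normalPart y (N y) z) (N y) = 0 := by
    simp [normalPart, hN.2.1, mink_comm y (N y), hN.1]
  have hd := h.mem_tangentSet hS hyS hy hN d1 d2
  have h0 := eq_zero_of_orthogonal hyy d1 (by
    rw [mink_sub_left, hz _ hd, h.mink_normalPart hS hyS hy hd, sub_self])
  exact (sub_eq_zero.mp h0).symm

lemma continuousOn_normalAccel (h : IsLocalModel S W r N) :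
    ContinuousOn (fun z : E × E => normalAccel r N z.1 z.2) (W ×ˢ univ) := by
  have h1 : ContinuousOn (fun z : E × E => z.1) (W ×ˢ univ) := continuousOn_fst
  have h2 : ContinuousOn (fun z : E × E => N z.1) (W ×ˢ univ) :=
    h.contDiffOn_normal.continuousOn.comp h1 fun z hz => hz.1
  have hdr : ContDiffOn ℝ 2 (fderiv ℝ r) W :=
    h.contDiffOn.fderiv_of_isOpen h.isOpen (by norm_num)
  have hddr : ContDiffOn ℝ 1 (fderiv ℝ (fderiv ℝ r)) W :=
    hdr.fderiv_of_isOpen h.isOpen (by norm_num)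
  have h3 : ContinuousOn (fun z : E × E => fderiv ℝ (fderiv ℝ r) z.1 z.2 z.2) (W ×ˢ univ) :=
    ((hddr.continuousOn.comp h1 fun z hz => hz.1).clm_apply continuousOn_snd).clm_apply
      continuousOn_snd
  have hm : ∀ {f g : E × E → E}, ContinuousOn f (W ×ˢ univ) → ContinuousOn g (W ×ˢ univ) →
      ContinuousOn (fun z => mink (f z) (g z)) (W ×ˢ univ) := fun hf hg =>
    continuous_mink.comp_continuousOn (hf.prodMk hg)
  exact ((hm h3 h1).neg.smul h1).add ((hm h3 h2).smul h2)

/-- If the second difference of three nearby points of the surface is normal to the surface at the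
middle point, it agrees with the normal acceleration up to third order. -/
lemma exists_secondDifference_le (h : IsLocalModel S W r N) (hS : S ⊆ hyp3) {x₀ : E}
    (hx₀ : x₀ ∈ W) :
    ∃ δ > 0, ∃ C ≥ 0, Metric.ball x₀ δ ⊆ W ∧
      (∀ y ∈ Metric.ball x₀ δ, ∀ v, ‖normalAccel r N y v‖ ≤ C * ‖v‖ ^ 2) ∧
      ∀ y ∈ S, ∀ z ∈ S, ∀ w ∈ S, y ∈ Metric.ball x₀ δ → z ∈ Metric.ball x₀ δ →
        w ∈ Metric.ball x₀ δ → (∀ v ∈ tangentSet S y, mink (z + w - (2 : ℝ) • y) v = 0) →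
        ‖z + w - (2 : ℝ) • y
          - (1 / 2 : ℝ) • (normalAccel r N y (z - y) + normalAccel r N y (w - y))‖
          ≤ C * (‖z - y‖ ^ 3 + ‖w - y‖ ^ 3) := by
  have hdr : ContDiffOn ℝ 2 (fderiv ℝ r) W :=
    h.contDiffOn.fderiv_of_isOpen h.isOpen (by norm_num)
  have hddr : ContDiffOn ℝ 1 (fderiv ℝ (fderiv ℝ r)) W :=
    hdr.fderiv_of_isOpen h.isOpen (by norm_num)
  have hdda : ContDiffAt ℝ 1 (fderiv ℝ (fderiv ℝ r)) x₀ :=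
    hddr.contDiffAt (h.isOpen.mem_nhds hx₀)
  obtain ⟨K, t, ht, hK⟩ := hdda.exists_lipschitzOnWith
  have hbd : ContinuousAt (fun y => ‖y‖ ^ 2 + ‖N y‖ ^ 2) x₀ := by
    have := (h.contDiffOn_normal.contDiffAt (h.isOpen.mem_nhds hx₀)).continuousAt
    fun_prop
  set M := ‖x₀‖ ^ 2 + ‖N x₀‖ ^ 2 + 1 with hM
  set D := ‖fderiv ℝ (fderiv ℝ r) x₀‖ + 1 with hD
  have e1 : ∀ᶠ y in 𝓝 x₀, ‖y‖ ^ 2 + ‖N y‖ ^ 2 < M :=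
    hbd.eventually_lt continuousAt_const (by simp [hM])
  have e2 : ∀ᶠ y in 𝓝 x₀, ‖fderiv ℝ (fderiv ℝ r) y‖ < D :=
    (hdda.continuousAt.eventually_mem (Metric.ball_mem_nhds _ one_pos)).mono fun y hy => by
      rw [Metric.mem_ball, dist_eq_norm] at hy
      have := norm_le_norm_add_norm_sub' (fderiv ℝ (fderiv ℝ r) y) (fderiv ℝ (fderiv ℝ r) x₀)
      linarith
  have e3 : ∀ᶠ y in 𝓝 x₀, y ∈ W := h.isOpen.mem_nhds hx₀
  have e4 : ∀ᶠ y in 𝓝 x₀, y ∈ t := ht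
  obtain ⟨δ, hδ, hball⟩ := Metric.eventually_nhds_iff_ball.mp
    ((e1.and e2).and (e3.and e4))
  have hM0 : 0 ≤ M := by positivity
  have hD0 : 0 ≤ D := by positivity
  have hnp : ∀ y ∈ Metric.ball x₀ δ, ∀ z, ‖normalPart y (N y) z‖ ≤ M * ‖z‖ := fun y hy z =>
    (norm_normalPart_le y (N y) z).trans
      (mul_le_mul_of_nonneg_right (hball y hy).1.1.le (norm_nonneg z))
  have hdd : ∀ y ∈ Metric.ball x₀ δ, ∀ v w,
      ‖fderiv ℝ (fderiv ℝ r) y v w‖ ≤ D * ‖v‖ * ‖w‖ := fun y hy v w => by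
    refine (ContinuousLinearMap.le_opNorm₂ _ v w).trans ?_
    have := (hball y hy).1.2.le
    gcongr
  have hC1 : M * D ≤ M * (D + K) := mul_le_mul_of_nonneg_left (by linarith [K.coe_nonneg]) hM0
  have hC2 : M * K ≤ M * (D + K) := mul_le_mul_of_nonneg_left (by linarith) hM0
  refine ⟨δ, hδ, M * (D + K), by positivity, fun y hy => (hball y hy).2.1, ?_, ?_⟩
  · intro y hy v
    calc ‖normalAccel r N y v‖ ≤ M * (D * ‖v‖ * ‖v‖) :=
          (hnp y hy _).trans (mul_le_mul_of_nonneg_left (hdd y hy v v) hM0)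
      _ = M * D * ‖v‖ ^ 2 := by ring
      _ ≤ _ := mul_le_mul_of_nonneg_right hC1 (sq_nonneg _)
  · intro y hyS z hzS w hwS hy hz hw hperp
    -- The linear Taylor term dr(z - y) is tangent and so has no normal part; the normal part of a
    -- secant starts with half the normal acceleration.
    have key : ∀ z ∈ S, z ∈ Metric.ball x₀ δ →
        ‖normalPart y (N y) (z - y) - (1 / 2 : ℝ) • normalAccel r N y (z - y)‖
          ≤ M * (K * ‖z - y‖ ^ 3) := by
      intro z hzS hz
      have htay := norm_taylor_two_le (convex_ball x₀ δ)
        (fun u hu => h.hasFDerivAt (hball u hu).2.1)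
        (fun u hu => h.hasFDerivAt_fderiv (hball u hu).2.1)
        (fun u hu v w => h.snd_fderiv_comm (hball u hu).2.1 v w)
        (fun u hu v hv => by
          have := hK.dist_le_mul u (hball u hu).2.2 v (hball v hv).2.2
          rwa [dist_eq_norm, dist_eq_norm] at this) K.coe_nonneg hy hz
      rw [h.fix y hyS (hball y hy).2.1, h.fix z hzS (hball z hz).2.1] at htay
      set ρ := z - y - fderiv ℝ r y (z - y)
        - (1 / 2 : ℝ) • fderiv ℝ (fderiv ℝ r) y (z - y) (z - y) with hρ
      have hdec : z - y = fderiv ℝ r y (z - y)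
          + ((1 / 2 : ℝ) • fderiv ℝ (fderiv ℝ r) y (z - y) (z - y) + ρ) := by
        rw [hρ]; abel
      have hpart : normalPart y (N y) (z - y)
          = (1 / 2 : ℝ) • normalAccel r N y (z - y) + normalPart y (N y) ρ := by
        conv_lhs => rw [hdec]
        rw [normalPart_add, normalPart_add, normalPart_smul,
          h.normalPart_of_mem_tangentSet hS hyS (hball y hy).2.1
            (h.fderiv_mem hyS (hball y hy).2.1 _), zero_add]
        rfl
      rw [hpart, add_sub_cancel_left]
      exact (hnp y hy ρ).trans (mul_le_mul_of_nonneg_left htay hM0)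
    -- The orthogonality hypothesis makes the second difference equal to its normal part, so the
    -- estimates for the two secants add up.
    have hself := h.normalPart_eq_self hS hyS (hball y hy).2.1 hperp
    have hsplit : z + w - (2 : ℝ) • y = (z - y) + (w - y) := by rw [two_smul]; abel
    have hre : z + w - (2 : ℝ) • y
          - (1 / 2 : ℝ) • (normalAccel r N y (z - y) + normalAccel r N y (w - y))
        = (normalPart y (N y) (z - y) - (1 / 2 : ℝ) • normalAccel r N y (z - y))
          + (normalPart y (N y) (w - y) - (1 / 2 : ℝ) • normalAccel r N y (w - y)) := by
      conv_lhs => rw [← hself, hsplit, normalPart_add, smul_add]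
      abel
    rw [hre]
    calc _ ≤ M * (K * ‖z - y‖ ^ 3) + M * (K * ‖w - y‖ ^ 3) :=
          (norm_add_le _ _).trans (add_le_add (key z hzS hz) (key w hwS hw))
      _ = M * K * (‖z - y‖ ^ 3 + ‖w - y‖ ^ 3) := by ring
      _ ≤ _ := mul_le_mul_of_nonneg_right hC2 (by positivity)

end IsLocalModel

/-! ### Discrete geodesics -/

/-- The first variation of the energy `∑ (-1 - ⟨x_k, x_{k+1}⟩)` of a polygon that moves at the
single vertex `j + 1`. -/
lemma hasDerivAt_energy {N j : ℕ} (hj : j + 1 < N) {x : ℕ → E} {c : ℝ → E} {w : E}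
    (h0 : c 0 = x (j + 1)) (hc : HasDerivAt c w 0) :
    HasDerivAt (fun t => ∑ k ∈ Finset.range N,
      (-1 - mink (Function.update x (j + 1) (c t) k) (Function.update x (j + 1) (c t) (k + 1))))
      (-mink (x j + x (j + 2)) w) 0 := by
  have hu : ∀ k, HasDerivAt (fun t => Function.update x (j + 1) (c t) k)
      (if k = j + 1 then w else 0) 0 := by
    intro k
    by_cases hk : k = j + 1
    · subst hk; simpa using hc
    · simpa [hk] using hasDerivAt_const (0 : ℝ) (x k)
  have hx : Function.update x (j + 1) (c 0) = x := by rw [h0, Function.update_eq_self]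
  have hsum := HasDerivAt.fun_sum (u := Finset.range N) fun k _ =>
    (hasDerivAt_mink (hu k) (hu (k + 1))).const_sub (-1)
  refine hsum.congr_deriv ?_
  simp only [hx, neg_add, Finset.sum_add_distrib, Finset.sum_neg_distrib, mink_add_left]
  congr 2
  · rw [Finset.sum_eq_single j]
    · simp
    · intro k _ hk; simp [hk]
    · intro hk; simp at hk; omega
  · rw [Finset.sum_eq_single (j + 1)]
    · simp [mink_comm w]
    · intro k _ hk; simp [hk]
    · intro hk; simp at hk; omega

section

variable {S : Set E} {p q : E}

/-- Polygons of small energy with critical energy exist in a complete connected surface. -/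
lemma IsEmbeddedSurface.exists_critical_polygon (hS : IsEmbeddedSurface S) (hconn : IsConnected S)
    (hcomp : IsCompleteSurface S) (hp : p ∈ S) (hq : q ∈ S) :
    ∃ B ⊆ S, IsCompact B ∧ ∃ A > 0, ∃ N₀ : ℕ, ∀ N ≥ N₀, ∃ x : ℕ → E, (∀ i, x i ∈ B) ∧ x 0 = p ∧
      x N = q ∧
      (∀ j, j + 1 < N → ∀ w ∈ tangentSet S (x (j + 1)), mink (x j + x (j + 2)) w = 0) ∧
      ∑ k ∈ Finset.range N, chord (x k) (x (k + 1)) ^ 2 ≤ A ^ 2 / N := by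
  have hpq := hS.intrinsicDist_lt_top hconn hp hq
  obtain ⟨c, hc, hcS, hc0, hc1, -⟩ := exists_path_of_intrinsicDist_lt
    (l := (intrinsicDist S p q).toReal + 1) (S := S) (x := p) (y := q) (by
      rw [ENNReal.ofReal_add ENNReal.toReal_nonneg zero_le_one, ENNReal.ofReal_toReal hpq.ne]
      exact ENNReal.lt_add_right hpq.ne (by simp))
  obtain ⟨A', hA'⟩ := isCompact_Icc.exists_bound_of_continuousOn (s := Icc (0 : ℝ) 1)
    (hc.continuous_deriv le_rfl).continuousOn
  set A := max A' 1
  have hA0 : 0 < A := lt_max_of_lt_right one_pos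
  have hlip : ∀ s ∈ Icc (0 : ℝ) 1, ∀ t ∈ Icc (0 : ℝ) 1, ‖c t - c s‖ ≤ A * ‖t - s‖ :=
    fun s hs t ht => (convex_Icc (0 : ℝ) 1).norm_image_sub_le_of_norm_deriv_le
      (fun t _ => (hasDerivAt_of_contDiff hc t).differentiableAt)
      (fun t ht => (hA' t ht).trans (le_max_left _ _)) hs ht
  set l := ∫ t in (0 : ℝ)..1, speed c t with hl
  have hl0 : 0 ≤ l := intervalIntegral.integral_nonneg zero_le_one fun t _ => speed_nonneg c t
  have hcl : ∀ t ∈ Icc (0 : ℝ) 1, intrinsicDist S p (c t) ≤ ENNReal.ofReal l := by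
    intro t ht
    have := intrinsicDist_le_of_path (S := S) hc ht.1 fun t _ => hcS t
    rw [hc0 0 le_rfl] at this
    refine this.trans (ENNReal.ofReal_le_ofReal ?_)
    have hint := fun a b =>
      (continuous_speed hc).intervalIntegrable (μ := MeasureTheory.volume) a b
    have h1 := intervalIntegral.integral_add_adjacent_intervals (hint 0 t) (hint t 1)
    have h2 : 0 ≤ ∫ t in t..1, speed c t :=
      intervalIntegral.integral_nonneg ht.2 fun t _ => speed_nonneg c t
    linarith
  -- R ≥ l keeps the polygon inscribed in c inside the ball. R ≥ 2A + 1 leaves room around the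
  -- vertices of a minimizer, which turn out to lie within 2A of p.
  set R := max l (2 * A + 1)
  have hR0 : 0 ≤ R := hl0.trans (le_max_left _ _)
  set B : Set E := {y | y ∈ S ∧ intrinsicDist S p y ≤ ENNReal.ofReal R} with hB
  have hBS : B ⊆ S := fun y hy => hy.1
  have hBc : IsCompact B := hS.isCompact_intrinsicBall hconn hcomp hp hR0
  have hcB : ∀ t ∈ Icc (0 : ℝ) 1, c t ∈ B := fun t ht =>
    ⟨hcS t, (hcl t ht).trans (ENNReal.ofReal_le_ofReal (le_max_left _ _))⟩
  have hqB : q ∈ B := by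
    have := hcB 1 ⟨zero_le_one, le_rfl⟩
    rwa [hc1 1 le_rfl] at this
  -- The predicate ignores the third point and the constant; only the uniform radius is wanted.
  obtain ⟨ρ, hρ, -, -, hunif⟩ := exists_uniform_near_diagonal hBc
    (P := fun x y _ _ => intrinsicDist S x y ≤ ENNReal.ofReal (2 * chord x y))
    (fun _ _ _ _ _ _ h => h) (fun a ha => by
      obtain ⟨δ, hδ, h⟩ := hS.exists_intrinsicDist_le_chord (hBS ha)
      exact ⟨δ, hδ, 0, fun x hx y hy z _ h1 h2 _ => h x (hBS hx) y (hBS hy) h1 h2⟩)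
  obtain ⟨X, hX⟩ : ∃ X : ℝ, ∀ y ∈ B, y 0 ≤ X := by
    obtain ⟨X, hX⟩ := hBc.isBounded.exists_norm_le
    exact ⟨X, fun y hy => ((le_abs_self _).trans (abs_coord_le_norm y 0)).trans (hX y hy)⟩
  have hX0 : 0 < X := (hS.1 hp).2.trans_le (hX p (by
    have := hcB 0 ⟨le_rfl, zero_le_one⟩
    rwa [hc0 0 le_rfl] at this))
  -- An edge of a polygon of energy A²/N has chord at most A/√N, hence Euclidean length at most
  -- 4XA/√N, which has to be less than ρ.
  obtain ⟨N₀, hN₀⟩ := exists_nat_gt ((4 * X * A / ρ) ^ 2)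
  refine ⟨B, hBS, hBc, A, hA0, N₀ + 1, fun N hN => ?_⟩
  have hNpos : (0 : ℝ) < N := by
    have : 0 < N := by omega
    exact_mod_cast this
  have hNbig : (4 * X * A / ρ) ^ 2 < N := hN₀.trans_le (by
    have : N₀ ≤ N := by omega
    exact_mod_cast this)
  -- Polygons are infinite sequences frozen at q from index N on, so Ω is a closed part of a compact
  -- product.
  let Ω : Set (ℕ → E) := (univ.pi fun _ => B) ∩ ({x | x 0 = p} ∩ {x | ∀ i ≥ N, x i = q})
  have hΩ : IsCompact Ω := by
    refine (isCompact_univ_pi fun _ => hBc).inter_right (IsClosed.inter ?_ ?_)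
    · exact isClosed_eq (continuous_apply 0) continuous_const
    · have : {x : ℕ → E | ∀ i ≥ N, x i = q} = ⋂ i, ⋂ (_ : i ≥ N), {x | x i = q} := by
        ext; simp
      rw [this]
      exact isClosed_iInter fun i => isClosed_iInter fun _ =>
        isClosed_eq (continuous_apply i) continuous_const
  let e : (ℕ → E) → ℝ := fun x => ∑ k ∈ Finset.range N, (-1 - mink (x k) (x (k + 1)))
  have he : Continuous e := by
    refine continuous_finsetSum _ fun k _ => continuous_const.sub ?_
    exact continuous_mink.comp (f := fun x : ℕ → E => (x k, x (k + 1)))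
      ((continuous_apply k).prodMk (continuous_apply (k + 1)))
  let x₀ : ℕ → E := fun i => c (i / N)
  have hx₀1 : ∀ i ≥ N, x₀ i = q := fun i hi => by
    refine hc1 _ ?_
    rw [ge_iff_le, one_le_div hNpos]
    exact_mod_cast hi
  have hI : ∀ i ≤ N, (i / N : ℝ) ∈ Icc (0 : ℝ) 1 := fun i hi =>
    ⟨by positivity, by rw [div_le_one hNpos]; exact_mod_cast hi⟩
  have hx₀ : x₀ ∈ Ω := by
    refine ⟨fun i _ => ?_, by simp [x₀, hc0], hx₀1⟩
    rcases le_total i N with h | h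
    · exact hcB _ (hI i h)
    · rw [hx₀1 i h]; exact hqB
  obtain ⟨x, hx, hmin⟩ := hΩ.exists_isMinOn ⟨x₀, hx₀⟩ he.continuousOn
  have hxB : ∀ i, x i ∈ B := fun i => hx.1 i (mem_univ i)
  have hex : ∀ x : ℕ → E, (∀ i, x i ∈ S) →
      ∑ k ∈ Finset.range N, chord (x k) (x (k + 1)) ^ 2 = 2 * e x := by
    intro x hx
    rw [Finset.mul_sum]
    refine Finset.sum_congr rfl fun k _ => ?_
    rw [chord_sq (hS.1 (hx k)) (hS.1 (hx (k + 1))), mink_chord (hS.1 (hx k)) (hS.1 (hx (k + 1)))]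
  have henergy : ∑ k ∈ Finset.range N, chord (x k) (x (k + 1)) ^ 2 ≤ A ^ 2 / N := by
    rw [hex x fun i => hBS (hxB i)]
    have h1 : 2 * e x ≤ 2 * e x₀ := by
      have : e x ≤ e x₀ := hmin hx₀
      linarith
    refine h1.trans ?_
    rw [← hex x₀ fun i => hcS _]
    calc ∑ k ∈ Finset.range N, chord (x₀ k) (x₀ (k + 1)) ^ 2
        ≤ ∑ k ∈ Finset.range N, (A / N) ^ 2 := by
          refine Finset.sum_le_sum fun k hk => pow_le_pow_left₀ (Real.sqrt_nonneg _) ?_ 2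
          rw [Finset.mem_range] at hk
          refine (chord_le_norm _ _).trans ?_
          rw [norm_sub_rev]
          refine (hlip _ (hI k hk.le) _ (hI (k + 1) hk)).trans (le_of_eq ?_)
          rw [← sub_div, Nat.cast_add, Nat.cast_one, add_sub_cancel_left,
            Real.norm_of_nonneg (by positivity)]
          ring
      _ = A ^ 2 / N := by
          rw [Finset.sum_const, Finset.card_range, nsmul_eq_mul]
          field_simp
  have hchord0 : ∀ k, 0 ≤ chord (x k) (x (k + 1)) := fun k => Real.sqrt_nonneg _
  have hchord : ∀ k < N, chord (x k) (x (k + 1)) ^ 2 ≤ A ^ 2 / N := fun k hk =>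
    (Finset.single_le_sum (f := fun k => chord (x k) (x (k + 1)) ^ 2)
      (fun k _ => sq_nonneg _) (Finset.mem_range.mpr hk)).trans henergy
  have hnear : ∀ k < N, ‖x (k + 1) - x k‖ < ρ := by
    intro k hk
    rw [norm_sub_rev]
    refine (norm_sub_le_chord (hS.1 (hBS (hxB k))) (hS.1 (hBS (hxB (k + 1)))) (hX _ (hxB k))
      (hX _ (hxB (k + 1)))).trans_lt ?_
    refine lt_of_pow_lt_pow_left₀ 2 hρ.le ?_
    rw [mul_pow]
    have h1 := mul_le_mul_of_nonneg_left (hchord k hk) (sq_nonneg (4 * X))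
    refine h1.trans_lt ?_
    rw [div_pow, div_lt_iff₀ (by positivity), mul_pow] at hNbig
    rw [mul_div_assoc', div_lt_iff₀ hNpos]
    linarith
  have hdist : ∀ i ≤ N, intrinsicDist S p (x i)
      ≤ ENNReal.ofReal (2 * ∑ k ∈ Finset.range i, chord (x k) (x (k + 1))) := by
    intro i
    induction i with
    | zero => intro _; rw [hx.2.1, intrinsicDist_self hp]; simp
    | succ i ih =>
      intro hi
      refine (intrinsicDist_triangle S p (x i) _).trans ?_
      rw [Finset.sum_range_succ, mul_add, ENNReal.ofReal_add
        (mul_nonneg zero_le_two (Finset.sum_nonneg fun k _ => hchord0 k))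
        (mul_nonneg zero_le_two (hchord0 i))]
      exact add_le_add (ih (by omega)) (hunif _ (hxB i) _ (hxB (i + 1)) _ (hxB i)
        (hnear i hi) (by simpa using hρ))
  have hsum : ∑ k ∈ Finset.range N, chord (x k) (x (k + 1)) ≤ A := by
    refine le_of_sq_le_sq ?_ hA0.le
    have h1 := sq_sum_le_card_mul_sum_sq (s := Finset.range N)
      (f := fun k => chord (x k) (x (k + 1)))
    rw [Finset.card_range] at h1
    refine h1.trans ((mul_le_mul_of_nonneg_left henergy hNpos.le).trans (le_of_eq ?_))
    field_simp
  refine ⟨x, hxB, hx.2.1, hx.2.2 N le_rfl, ?_, henergy⟩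
  rintro j hj w ⟨γ, h0, hγS, hγd⟩
  have hmemS := hBS (hxB (j + 1))
  have hγB : ∀ᶠ t in 𝓝 (0 : ℝ), γ t ∈ B := by
    have h1 : Tendsto γ (𝓝 0) (𝓝[S] x (j + 1)) :=
      tendsto_nhdsWithin_iff.mpr ⟨h0 ▸ hγd.continuousAt, hγS⟩
    have h2 := h1.eventually (hS.eventually_intrinsicDist_lt hmemS (ε := 1) one_pos)
    filter_upwards [hγS, h2] with t ht1 ht2
    refine ⟨ht1, (intrinsicDist_triangle S p (x (j + 1)) _).trans ?_⟩
    have h3 : intrinsicDist S p (x (j + 1)) ≤ ENNReal.ofReal (2 * A) :=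
      (hdist (j + 1) hj.le).trans (ENNReal.ofReal_le_ofReal
        (mul_le_mul_of_nonneg_left ((Finset.sum_le_sum_of_subset_of_nonneg
          (Finset.range_subset_range.mpr hj.le) fun k _ _ => hchord0 k).trans hsum) zero_le_two))
    refine (add_le_add h3 ht2.le).trans ?_
    rw [← ENNReal.ofReal_one, ← ENNReal.ofReal_add (by positivity) zero_le_one]
    exact ENNReal.ofReal_le_ofReal (le_max_right _ _)
  -- The vertices are strictly inside the ball, so moving one of them along any curve in S stays
  -- admissible for small t; minimality within B thus yields criticality on S.
  have hloc : IsLocalMin (fun t => e (Function.update x (j + 1) (γ t))) 0 := by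
    filter_upwards [hγB] with t ht
    have hupd : Function.update x (j + 1) (γ t) ∈ Ω := by
      refine ⟨fun i _ => ?_, ?_, fun i hi => ?_⟩
      · by_cases hi : i = j + 1
        · subst hi; simpa using ht
        · simpa [hi] using hxB i
      · simpa using hx.2.1
      · rw [Function.update_of_ne (by omega)]; exact hx.2.2 i hi
    have := hmin hupd
    simpa [h0] using this
  have := hloc.hasDerivAt_eq_zero (hasDerivAt_energy hj h0 hγd)
  linarith

end

/-- A finite sequence of nonnegative numbers whose increments are bounded by their squares is
bounded by its mean and its energy. -/
lemma le_of_increment_le_sq {N : ℕ} {d : ℕ → ℝ} {C A Q : ℝ} (hC : 0 ≤ C)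
    (hinc : ∀ k, k + 1 < N → |d (k + 1) - d k| ≤ C * (d k ^ 2 + d (k + 1) ^ 2))
    (hsum : ∑ k ∈ Finset.range N, d k ≤ A) (hsq : ∑ k ∈ Finset.range N, d k ^ 2 ≤ Q) {i : ℕ}
    (hi : i < N) : d i ≤ A / N + 2 * C * Q := by
  have key : ∀ i j, i ≤ j → j < N → |d j - d i| ≤ 2 * C * Q := by
    intro i j hij hj
    have h1 : dist (d i) (d j) ≤ ∑ k ∈ Finset.Ico i j, C * (d k ^ 2 + d (k + 1) ^ 2) :=
      dist_le_Ico_sum_of_dist_le hij fun {k} _ hk => by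
        rw [dist_comm, Real.dist_eq]; exact hinc k (by omega)
    have h2 : ∑ k ∈ Finset.Ico i j, d k ^ 2 ≤ Q :=
      (Finset.sum_le_sum_of_subset_of_nonneg (fun k hk => by
        simp only [Finset.mem_Ico, Finset.mem_range] at hk ⊢; omega)
        fun k _ _ => sq_nonneg _).trans hsq
    have h3 : ∑ k ∈ Finset.Ico i j, d (k + 1) ^ 2 ≤ Q := by
      rw [Finset.sum_Ico_add' (fun k => d k ^ 2) i j 1]
      exact (Finset.sum_le_sum_of_subset_of_nonneg (fun k hk => by
        simp only [Finset.mem_Ico, Finset.mem_range] at hk ⊢; omega)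
        fun k _ _ => sq_nonneg _).trans hsq
    rw [← Finset.mul_sum, Finset.sum_add_distrib, dist_comm, Real.dist_eq] at h1
    have := mul_le_mul_of_nonneg_left (add_le_add h2 h3) hC
    linarith
  -- Some term is at most the mean, and the total variation of d between any two indices is at most
  -- 2CQ.
  obtain ⟨j, hj, hjA⟩ : ∃ j ∈ Finset.range N, d j ≤ A / N := by
    refine Finset.exists_le_of_sum_le ⟨i, Finset.mem_range.mpr hi⟩ ?_
    have hN : (0 : ℝ) < N := by
      have : 0 < N := by omega
      exact_mod_cast this
    rw [Finset.sum_const, Finset.card_range, nsmul_eq_mul, mul_div_cancel₀ _ hN.ne']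
    exact hsum
  rw [Finset.mem_range] at hj
  have : |d i - d j| ≤ 2 * C * Q := by
    rcases le_total i j with h | h
    · rw [abs_sub_comm]; exact key i j h hj
    · exact key j i h hi
  linarith [le_abs_self (d i - d j)]

section

variable {S : Set E} {p q : E}

/-- For a critical triple the second difference is normal, hence equals an average of normal
accelerations, which are quadratic in the secants. The cubic error is absorbed at small distances,
and compactness makes the constant uniform. -/
lemma IsEmbeddedSurface.exists_secondDifference_le_sq (hS : IsEmbeddedSurface S)
    (hν : ∀ x ∈ S, ∃ ν, IsUnitNormal S x ν) {B : Set E} (hB : IsCompact B) (hBS : B ⊆ S) :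
    ∃ δ > 0, ∃ C > 0, ∀ x ∈ B, ∀ y ∈ B, ∀ z ∈ B, ‖y - x‖ < δ → ‖z - x‖ < δ →
      (∀ v ∈ tangentSet S x, mink (y + z) v = 0) →
      ‖y + z - (2 : ℝ) • x‖ ≤ C * (‖y - x‖ ^ 2 + ‖z - x‖ ^ 2) := by
  refine exists_uniform_near_diagonal hB (P := fun x y z C =>
    (∀ v ∈ tangentSet S x, mink (y + z) v = 0) →
      ‖y + z - (2 : ℝ) • x‖ ≤ C * (‖y - x‖ ^ 2 + ‖z - x‖ ^ 2)) ?_ fun a ha => ?_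
  · intro x y z C C' hCC h hv
    exact (h hv).trans (mul_le_mul_of_nonneg_right hCC (by positivity))
  obtain ⟨ν, hν⟩ := hν a (hBS ha)
  obtain ⟨W, r, N, haW, hm⟩ := hS.exists_isLocalModel (hBS ha) hν
  obtain ⟨δ, hδ, C, hC, -, h1, h2⟩ := hm.exists_secondDifference_le hS.1 haW
  refine ⟨min δ (1 / 2), by positivity, 2 * C, fun x hx y hy z hz hxa hya hza hv => ?_⟩
  have hmem : ∀ w : E, ‖w - a‖ < min δ (1 / 2) → w ∈ Metric.ball a δ := fun w hw => by
    rw [Metric.mem_ball, dist_eq_norm]; exact hw.trans_le (min_le_left _ _)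
  have hv' : ∀ v ∈ tangentSet S x, mink (y + z - (2 : ℝ) • x) v = 0 := fun v hvt => by
    rw [mink_sub_left, hv v hvt, mink_smul_left, mink_comm x v,
      mink_eq_zero_of_mem_tangentSet hS.1 hvt]
    ring
  have h3 := h2 x (hBS hx) y (hBS hy) z (hBS hz) (hmem x hxa) (hmem y hya) (hmem z hza) hv'
  have hsmall : ∀ w : E, ‖w - a‖ < min δ (1 / 2) → ‖w - x‖ ≤ 1 := fun w hw => by
    have h4 := norm_sub_le_norm_sub_add_norm_sub w a x
    rw [norm_sub_rev a x] at h4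
    have h5 := min_le_right δ (1 / 2)
    linarith
  have hcube : ∀ w : E, ‖w - a‖ < min δ (1 / 2) → ‖w - x‖ ^ 3 ≤ ‖w - x‖ ^ 2 := fun w hw =>
    pow_le_pow_of_le_one (norm_nonneg _) (hsmall w hw) (by norm_num)
  have h4 := h1 x (hmem x hxa) (y - x)
  have h5 := h1 x (hmem x hxa) (z - x)
  have h6 := norm_add_le (normalAccel r N x (y - x)) (normalAccel r N x (z - x))
  have h7 : ‖(1 / 2 : ℝ) • (normalAccel r N x (y - x) + normalAccel r N x (z - x))‖
      ≤ C * (‖y - x‖ ^ 2 + ‖z - x‖ ^ 2) := by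
    rw [norm_smul, Real.norm_of_nonneg (by norm_num)]
    nlinarith [mul_nonneg hC (sq_nonneg ‖y - x‖), mul_nonneg hC (sq_nonneg ‖z - x‖)]
  have h8 : C * (‖y - x‖ ^ 3 + ‖z - x‖ ^ 3) ≤ C * (‖y - x‖ ^ 2 + ‖z - x‖ ^ 2) :=
    mul_le_mul_of_nonneg_left (add_le_add (hcube y hya) (hcube z hza)) hC
  have h9 := norm_le_norm_sub_add (y + z - (2 : ℝ) • x)
    ((1 / 2 : ℝ) • (normalAccel r N x (y - x) + normalAccel r N x (z - x)))
  linarith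

/-- A discrete geodesic with `N` steps of length at most `M / N`, with vertices in `B`. -/
structure IsDiscreteGeodesic (S B : Set E) (p q : E) (M : ℝ) (N : ℕ) (x : ℕ → E) : Prop where
  mem : ∀ i, x i ∈ B
  source : x 0 = p
  target : x N = q
  critical : ∀ j, j + 1 < N → ∀ w ∈ tangentSet S (x (j + 1)),
    mink (x (j + 2) + x j - (2 : ℝ) • x (j + 1)) w = 0
  step_le : ∀ k < N, ‖x (k + 1) - x k‖ ≤ M / N
  second_le : ∀ k, k + 1 < N → ‖x (k + 2) + x k - (2 : ℝ) • x (k + 1)‖ ≤ M / N ^ 2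

/-- Low energy alone bounds the steps only in mean square. Criticality bounds each change of step
length by squares of steps, so the steps vary in total by O(1/N); every step is then O(1/N), and
every second difference O(1/N²). -/
lemma IsEmbeddedSurface.exists_isDiscreteGeodesic (hS : IsEmbeddedSurface S)
    (hν : ∀ x ∈ S, ∃ ν, IsUnitNormal S x ν) (hconn : IsConnected S)
    (hcomp : IsCompleteSurface S) (hp : p ∈ S) (hq : q ∈ S) :
    ∃ B ⊆ S, IsCompact B ∧ ∃ M > 0, ∃ N₀ : ℕ, ∀ N ≥ N₀, ∃ x : ℕ → E,
      IsDiscreteGeodesic S B p q M N x := by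
  obtain ⟨B, hBS, hB, A, hA, N₀, h⟩ := hS.exists_critical_polygon hconn hcomp hp hq
  obtain ⟨δ, hδ, C, hC, hsec⟩ := hS.exists_secondDifference_le_sq hν hB hBS
  obtain ⟨X, hX1, hX⟩ : ∃ X : ℝ, 1 ≤ X ∧ ∀ y ∈ B, y 0 ≤ X := by
    obtain ⟨X, hX⟩ := hB.isBounded.exists_norm_le
    exact ⟨max X 1, le_max_right _ _, fun y hy =>
      ((le_abs_self _).trans (abs_coord_le_norm y 0)).trans ((hX y hy).trans (le_max_left _ _))⟩
  have hX0 : 0 < X := by linarith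
  set D := 4 * X * A with hD
  have hD0 : 0 < D := by positivity
  obtain ⟨N₁, hN₁⟩ := exists_nat_gt ((D / δ) ^ 2)
  set M₁ := D + 2 * C * D ^ 2 with hM₁
  have hM₁0 : 0 < M₁ := by positivity
  refine ⟨B, hBS, hB, max M₁ (2 * C * M₁ ^ 2), lt_max_of_lt_left hM₁0, max N₀ (N₁ + 1),
    fun N hN => ?_⟩
  have hN0 : N₀ ≤ N := (le_max_left _ _).trans hN
  have hN1 : N₁ + 1 ≤ N := (le_max_right _ _).trans hN
  have hNpos : (0 : ℝ) < N := by
    have : 0 < N := by omega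
    exact_mod_cast this
  have hNbig : (D / δ) ^ 2 < N := hN₁.trans_le (by
    have : N₁ ≤ N := by omega
    exact_mod_cast this)
  obtain ⟨x, hxB, hx0, hxN, hcrit, hen⟩ := h N hN0
  have hxS : ∀ k, x k ∈ hyp3 := fun k => hS.1 (hBS (hxB k))
  set d : ℕ → ℝ := fun k => ‖x (k + 1) - x k‖ with hd
  have hdc : ∀ k, d k ^ 2 ≤ (4 * X) ^ 2 * chord (x k) (x (k + 1)) ^ 2 := by
    intro k
    rw [← mul_pow]
    refine pow_le_pow_left₀ (norm_nonneg _) ?_ 2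
    rw [norm_sub_rev]
    exact norm_sub_le_chord (hxS k) (hxS (k + 1)) (hX _ (hxB k)) (hX _ (hxB (k + 1)))
  have hsq : ∑ k ∈ Finset.range N, d k ^ 2 ≤ D ^ 2 / N := by
    refine (Finset.sum_le_sum fun k _ => hdc k).trans ?_
    rw [← Finset.mul_sum]
    refine (mul_le_mul_of_nonneg_left hen (by positivity)).trans (le_of_eq ?_)
    rw [hD]; ring
  have hsum : ∑ k ∈ Finset.range N, d k ≤ D := by
    refine le_of_sq_le_sq ?_ hD0.le
    have h1 := sq_sum_le_card_mul_sum_sq (s := Finset.range N) (f := d)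
    rw [Finset.card_range] at h1
    refine h1.trans ((mul_le_mul_of_nonneg_left hsq hNpos.le).trans (le_of_eq ?_))
    field_simp
  have hsmall : ∀ k < N, d k < δ := by
    intro k hk
    refine lt_of_pow_lt_pow_left₀ 2 hδ.le ?_
    refine ((Finset.single_le_sum (f := fun k => d k ^ 2) (fun k _ => sq_nonneg _)
      (Finset.mem_range.mpr hk)).trans hsq).trans_lt ?_
    rw [div_pow, div_lt_iff₀ (by positivity)] at hNbig
    rw [div_lt_iff₀ hNpos]
    linarith
  have hsec' : ∀ k, k + 1 < N →
      ‖x (k + 2) + x k - (2 : ℝ) • x (k + 1)‖ ≤ C * (d k ^ 2 + d (k + 1) ^ 2) := by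
    intro k hk
    have h1 := hsec _ (hxB (k + 1)) _ (hxB (k + 2)) _ (hxB k) (hsmall (k + 1) hk)
      (by rw [norm_sub_rev]; exact hsmall k (by omega))
      (fun v hv => by rw [add_comm]; exact hcrit k hk v hv)
    rw [norm_sub_rev (x k)] at h1
    rw [add_comm (d k ^ 2)]
    exact h1
  have hinc : ∀ k, k + 1 < N → |d (k + 1) - d k| ≤ C * (d k ^ 2 + d (k + 1) ^ 2) := by
    intro k hk
    refine le_trans ?_ (hsec' k hk)
    refine (abs_norm_sub_norm_le _ _).trans (le_of_eq ?_)
    congr 1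
    rw [two_smul]; abel
  have hstep : ∀ k < N, d k ≤ M₁ / N := by
    intro k hk
    refine (le_of_increment_le_sq hC.le hinc hsum hsq hk).trans (le_of_eq ?_)
    rw [hM₁]; field_simp
  refine ⟨x, hxB, hx0, hxN, ?_, ?_, ?_⟩
  · intro j hj w hw
    rw [mink_sub_left, add_comm (x (j + 2)), hcrit j hj w hw, mink_smul_left,
      mink_comm _ w, mink_eq_zero_of_mem_tangentSet hS.1 hw]
    ring
  · intro k hk
    refine (hstep k hk).trans ?_
    gcongr
    exact le_max_left _ _
  · intro k hk
    refine (hsec' k hk).trans ?_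
    have h1 := pow_le_pow_left₀ (norm_nonneg _) (hstep k (by omega)) 2
    have h2 := pow_le_pow_left₀ (norm_nonneg _) (hstep (k + 1) hk) 2
    calc C * (d k ^ 2 + d (k + 1) ^ 2) ≤ C * ((M₁ / N) ^ 2 + (M₁ / N) ^ 2) :=
          mul_le_mul_of_nonneg_left (add_le_add h1 h2) hC.le
      _ = 2 * C * M₁ ^ 2 / N ^ 2 := by ring
      _ ≤ _ := by
        gcongr
        exact le_max_right _ _

end

/-! ### The limit of discrete geodesics -/

lemma norm_sub_sub_smul_le {V : ℕ → E} {a : E} {e : ℝ} {i j : ℕ}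
    (h : ∀ k, min i j ≤ k → k < max i j → ‖V (k + 1) - V k - a‖ ≤ e) :
    ‖V j - V i - ((j : ℝ) - i) • a‖ ≤ e * |(j : ℝ) - i| := by
  have key : ∀ i j, i ≤ j → (∀ k, i ≤ k → k < j → ‖V (k + 1) - V k - a‖ ≤ e) →
      ‖V j - V i - ((j : ℝ) - i) • a‖ ≤ e * ((j : ℝ) - i) := by
    intro i j hij
    induction j, hij using Nat.le_induction with
    | base => intro _; simp
    | succ j hij ih =>
      intro h
      have h1 := ih fun k hk hkj => h k hk (by omega)
      have h2 := h j hij (by omega)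
      have e1 : V (j + 1) - V i - (((j + 1 : ℕ) : ℝ) - i) • a
          = (V j - V i - ((j : ℝ) - i) • a) + (V (j + 1) - V j - a) := by
        push_cast
        rw [show (j : ℝ) + 1 - i = ((j : ℝ) - i) + 1 by ring, add_smul, one_smul]
        abel
      rw [e1]
      refine (norm_add_le _ _).trans ?_
      push_cast
      linarith
  rcases le_total i j with hij | hij
  · have hc : (i : ℝ) ≤ j := by exact_mod_cast hij
    rw [abs_of_nonneg (by linarith)]
    exact key i j hij fun k h1 h2 => h k (by simp [hij, h1]) (by simp [hij, h2])
  · have hc : (j : ℝ) ≤ i := by exact_mod_cast hij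
    rw [abs_of_nonpos (by linarith), neg_sub]
    have := key j i hij fun k h1 h2 => h k (by simp [hij, h1]) (by simp [hij, h2])
    have e2 : -(V j - V i - ((j : ℝ) - i) • a) = V i - V j - ((i : ℝ) - j) • a := by
      rw [← neg_sub (i : ℝ) j, neg_smul]
      abel
    rwa [← norm_neg, e2]

/-- The index of the vertex of an `N`-gon at time `t`. -/
noncomputable def vertexIndex (t : ℝ) (N : ℕ) : ℕ := min ⌊t * N⌋₊ (N - 1)

lemma vertexIndex_lt (t : ℝ) {N : ℕ} (hN : 0 < N) : vertexIndex t N < N :=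
  (min_le_right _ _).trans_lt (by omega)

lemma tendsto_vertexIndex_div {t : ℝ} (ht : t ∈ Icc (0 : ℝ) 1) :
    Tendsto (fun N : ℕ => (vertexIndex t N : ℝ) / N) atTop (𝓝 t) := by
  have hlow : Tendsto (fun N : ℕ => t - 1 / (N : ℝ)) atTop (𝓝 t) := by
    simpa using tendsto_const_nhds.sub (tendsto_one_div_atTop_nhds_zero_nat (𝕜 := ℝ))
  refine tendsto_of_tendsto_of_tendsto_of_le_of_le' hlow tendsto_const_nhds ?_ ?_
  · filter_upwards [eventually_gt_atTop 0] with N hN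
    have hN' : (0 : ℝ) < N := by exact_mod_cast hN
    rw [le_div_iff₀ hN', sub_mul, one_div_mul_cancel hN'.ne', vertexIndex, Nat.cast_min]
    refine le_min ?_ ?_
    · linarith [Nat.lt_floor_add_one (t * N)]
    · rw [Nat.cast_sub (by omega), Nat.cast_one]
      nlinarith [ht.2]
  · filter_upwards [eventually_gt_atTop 0] with N hN
    have hN' : (0 : ℝ) < N := by exact_mod_cast hN
    rw [div_le_iff₀ hN']
    have h1 : (vertexIndex t N : ℝ) ≤ ⌊t * N⌋₊ := by exact_mod_cast min_le_left _ _
    exact h1.trans (Nat.floor_le (mul_nonneg ht.1 hN'.le))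

namespace IsDiscreteGeodesic

variable {S B : Set E} {p q : E} {M : ℝ} {N : ℕ} {x : ℕ → E}

/-- The discrete velocity. -/
noncomputable def _root_.HypSurf.discreteVelocity (N : ℕ) (x : ℕ → E) (k : ℕ) : E :=
  (N : ℝ) • (x (k + 1) - x k)

lemma norm_velocity_le (h : IsDiscreteGeodesic S B p q M N x) {k : ℕ} (hk : k < N) :
    ‖discreteVelocity N x k‖ ≤ M := by
  have hN : (0 : ℝ) < N := by
    have : 0 < N := by omega
    exact_mod_cast this
  rw [discreteVelocity, norm_smul, Real.norm_of_nonneg hN.le, mul_comm, ← le_div_iff₀ hN]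
  exact h.step_le k hk

lemma velocity_succ_sub (N : ℕ) (x : ℕ → E) (k : ℕ) :
    discreteVelocity N x (k + 1) - discreteVelocity N x k
      = (N : ℝ) • (x (k + 2) + x k - (2 : ℝ) • x (k + 1)) := by
  rw [discreteVelocity, discreteVelocity, ← smul_sub, two_smul]
  congr 1
  abel

lemma norm_velocity_sub_le (h : IsDiscreteGeodesic S B p q M N x) {i j : ℕ} (hi : i < N)
    (hj : j < N) :
    ‖discreteVelocity N x j - discreteVelocity N x i‖ ≤ M * |(j : ℝ) / N - i / N| := by
  have hN : (0 : ℝ) < N := by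
    have : 0 < N := by omega
    exact_mod_cast this
  have := norm_sub_sub_smul_le (V := discreteVelocity N x) (a := 0) (e := M / N) (i := i) (j := j)
    fun k _ hk => by
      have hkN : k + 1 < N := by
        have : max i j < N := max_lt hi hj
        omega
      rw [sub_zero, velocity_succ_sub, norm_smul, Real.norm_of_nonneg hN.le]
      refine (mul_le_mul_of_nonneg_left (h.second_le k hkN) hN.le).trans (le_of_eq ?_)
      field_simp
  rw [smul_zero, sub_zero] at this
  refine this.trans (le_of_eq ?_)
  rw [← sub_div, abs_div, abs_of_pos hN]
  ring

lemma norm_sub_le (h : IsDiscreteGeodesic S B p q M N x) {i j : ℕ} (hi : i < N)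
    (hj : j < N) : ‖x j - x i‖ ≤ M * |(j : ℝ) / N - i / N| := by
  have hN : (0 : ℝ) < N := by
    have : 0 < N := by omega
    exact_mod_cast this
  have := norm_sub_sub_smul_le (V := x) (a := 0) (e := M / N) (i := i) (j := j)
    fun k _ hk => by
      rw [sub_zero]
      exact h.step_le k (hk.trans (max_lt hi hj))
  rw [smul_zero, sub_zero] at this
  refine this.trans (le_of_eq ?_)
  rw [← sub_div, abs_div, abs_of_pos hN]
  ring

/-- A discrete first-order Taylor formula: between the indices i and j the velocity stays within
M|j/N - i/N| of its value at i. It survives the limit and gives differentiability there. -/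
lemma norm_sub_sub_velocity_le (h : IsDiscreteGeodesic S B p q M N x) (hM : 0 ≤ M) {i j : ℕ}
    (hi : i < N) (hj : j < N) :
    ‖x j - x i - ((j : ℝ) / N - i / N) • discreteVelocity N x i‖
      ≤ M * |(j : ℝ) / N - i / N| * |(j : ℝ) / N - i / N| := by
  have hN : (0 : ℝ) < N := by
    have : 0 < N := by omega
    exact_mod_cast this
  set l := |(j : ℝ) / N - i / N| with hl
  have := norm_sub_sub_smul_le (V := x) (a := (N : ℝ)⁻¹ • discreteVelocity N x i)
    (e := (N : ℝ)⁻¹ * (M * l)) (i := i) (j := j) fun k hk1 hk2 => by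
      have hkN : k < N := hk2.trans (max_lt hi hj)
      have e1 : x (k + 1) - x k = (N : ℝ)⁻¹ • discreteVelocity N x k := by
        rw [discreteVelocity, smul_smul, inv_mul_cancel₀ hN.ne', one_smul]
      rw [e1, ← smul_sub, norm_smul, Real.norm_of_nonneg (by positivity)]
      refine mul_le_mul_of_nonneg_left ((h.norm_velocity_sub_le hi hkN).trans
        (mul_le_mul_of_nonneg_left ?_ hM)) (by positivity)
      rw [hl, ← sub_div, ← sub_div, abs_div, abs_div]
      refine div_le_div_of_nonneg_right ?_ (abs_nonneg _)
      rcases le_total i j with hij | hij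
      · rw [min_eq_left hij] at hk1
        rw [max_eq_right hij] at hk2
        have c1 : (i : ℝ) ≤ k := by exact_mod_cast hk1
        have c2 : (k : ℝ) ≤ j := by exact_mod_cast hk2.le
        rw [abs_of_nonneg (by linarith), abs_of_nonneg (by linarith)]
        linarith
      · rw [min_eq_right hij] at hk1
        rw [max_eq_left hij] at hk2
        have c1 : (j : ℝ) ≤ k := by exact_mod_cast hk1
        have c2 : (k : ℝ) ≤ i := by exact_mod_cast hk2.le
        rw [abs_of_nonpos (by linarith), abs_of_nonpos (by linarith)]
        linarith
  rw [smul_smul, ← div_eq_mul_inv, sub_div] at this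
  refine this.trans (le_of_eq ?_)
  have e2 : |(j : ℝ) - i| = N * l := by
    rw [hl, ← sub_div, abs_div, abs_of_pos hN]
    field_simp
  rw [e2]
  field_simp

end IsDiscreteGeodesic

lemma normalAccel_smul (r N : E → E) (y : E) (a : ℝ) (v : E) :
    normalAccel r N y (a • v) = a ^ 2 • normalAccel r N y v := by
  rw [normalAccel, normalAccel, ← normalPart_smul]
  congr 1
  simp [smul_smul, sq]

/-- The discrete acceleration of a discrete geodesic is close to the normal acceleration. -/
lemma IsDiscreteGeodesic.norm_accel_sub_le {S B : Set E} {p q : E} {M : ℝ} {N : ℕ} {x : ℕ → E}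
    (h : IsDiscreteGeodesic S B p q M N x) {r ν : E → E} {C δ : ℝ} (hC : 0 ≤ C)
    (hBS : B ⊆ S) {x₀ : E}
    (hsec : ∀ y ∈ S, ∀ z ∈ S, ∀ w ∈ S, y ∈ Metric.ball x₀ δ → z ∈ Metric.ball x₀ δ →
        w ∈ Metric.ball x₀ δ → (∀ v ∈ tangentSet S y, mink (z + w - (2 : ℝ) • y) v = 0) →
        ‖z + w - (2 : ℝ) • y
          - (1 / 2 : ℝ) • (normalAccel r ν y (z - y) + normalAccel r ν y (w - y))‖
          ≤ C * (‖z - y‖ ^ 3 + ‖w - y‖ ^ 3))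
    {k : ℕ} (hk : k + 1 < N) (h0 : x k ∈ Metric.ball x₀ δ) (h1 : x (k + 1) ∈ Metric.ball x₀ δ)
    (h2 : x (k + 2) ∈ Metric.ball x₀ δ) {a : E} {ε : ℝ}
    (ha0 : ‖normalAccel r ν (x (k + 1)) (discreteVelocity N x k) - a‖ ≤ ε)
    (ha1 : ‖normalAccel r ν (x (k + 1)) (discreteVelocity N x (k + 1)) - a‖ ≤ ε) :
    ‖discreteVelocity N x (k + 1) - discreteVelocity N x k - (N : ℝ)⁻¹ • a‖
      ≤ (N : ℝ)⁻¹ * (ε + 2 * C * M ^ 3 * (N : ℝ)⁻¹) := by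
  have hN : (0 : ℝ) < N := by
    have : 0 < N := by omega
    exact_mod_cast this
  have hs := hsec _ (hBS (h.mem (k + 1))) _ (hBS (h.mem (k + 2))) _ (hBS (h.mem k)) h1 h2 h0
    (h.critical k hk)
  have s0 := h.step_le k (by omega)
  have s1 := h.step_le (k + 1) hk
  have v0 : x k - x (k + 1) = (-(N : ℝ)⁻¹) • discreteVelocity N x k := by
    rw [discreteVelocity, smul_smul, neg_mul, inv_mul_cancel₀ hN.ne', neg_smul, one_smul, neg_sub]
  have v1 : x (k + 2) - x (k + 1) = (N : ℝ)⁻¹ • discreteVelocity N x (k + 1) := by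
    rw [discreteVelocity, smul_smul, inv_mul_cancel₀ hN.ne', one_smul]
  have hs' : ‖x (k + 2) + x k - (2 : ℝ) • x (k + 1) - (1 / 2 : ℝ) •
      (normalAccel r ν (x (k + 1)) (x (k + 2) - x (k + 1))
        + normalAccel r ν (x (k + 1)) (x k - x (k + 1)))‖ ≤ 2 * C * (M / N) ^ 3 := by
    refine hs.trans ?_
    rw [norm_sub_rev (x k)]
    have p0 := pow_le_pow_left₀ (norm_nonneg _) s0 3
    have p1 := pow_le_pow_left₀ (norm_nonneg _) s1 3
    calc _ ≤ C * ((M / N) ^ 3 + (M / N) ^ 3) :=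
          mul_le_mul_of_nonneg_left (add_le_add p1 p0) hC
      _ = _ := by ring
  rw [v0, v1, normalAccel_smul, normalAccel_smul] at hs'
  set A₀ := normalAccel r ν (x (k + 1)) (discreteVelocity N x k)
  set A₁ := normalAccel r ν (x (k + 1)) (discreteVelocity N x (k + 1))
  set D := x (k + 2) + x k - (2 : ℝ) • x (k + 1)
  set ρ := D - (1 / 2 : ℝ) • (((N : ℝ)⁻¹) ^ 2 • A₁ + (-(N : ℝ)⁻¹) ^ 2 • A₀) with hρ
  -- The velocity jump is N times the second difference, whose main part is N⁻²(A₀ + A₁)/2; the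
  -- reversed direction of the backward secant disappears in the square.
  have e1 : discreteVelocity N x (k + 1) - discreteVelocity N x k - (N : ℝ)⁻¹ • a
      = (N : ℝ) • ρ + (N : ℝ)⁻¹ • ((1 / 2 : ℝ) • (A₁ - a) + (1 / 2 : ℝ) • (A₀ - a)) := by
    rw [IsDiscreteGeodesic.velocity_succ_sub]
    change (N : ℝ) • D - _ = _
    rw [hρ]
    match_scalars <;> field_simp <;> ring
  rw [e1]
  refine (norm_add_le _ _).trans ?_
  rw [norm_smul, norm_smul, Real.norm_of_nonneg hN.le, Real.norm_of_nonneg (by positivity)]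
  have b1 : (N : ℝ) * ‖ρ‖ ≤ N * (2 * C * (M / N) ^ 3) := mul_le_mul_of_nonneg_left hs' hN.le
  have b2 : ‖(1 / 2 : ℝ) • (A₁ - a) + (1 / 2 : ℝ) • (A₀ - a)‖ ≤ ε := by
    refine (norm_add_le _ _).trans ?_
    rw [norm_smul, norm_smul, Real.norm_of_nonneg (by norm_num)]
    linarith
  have b3 := mul_le_mul_of_nonneg_left b2 (inv_nonneg.mpr hN.le)
  have b4 : (N : ℝ) * (2 * C * (M / N) ^ 3) = (N : ℝ)⁻¹ * (2 * C * M ^ 3 * (N : ℝ)⁻¹) := by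
    field_simp
  rw [mul_add]
  linarith

lemma exists_tendsto_ultrafilter_of_isCompact {K : Set E} (hK : IsCompact K) (U : Ultrafilter ℕ)
    {f : ℕ → E} (hf : ∀ᶠ n in (U : Filter ℕ), f n ∈ K) :
    ∃ a ∈ K, Tendsto f U (𝓝 a) :=
  hK.ultrafilter_le_nhds (U.map f) (by rwa [le_principal_iff])

/-- Limits of discrete geodesics of a surface are curves whose acceleration is normal to the
surface. -/
lemma IsEmbeddedSurface.exists_limit_curve {S B : Set E} {p q : E} {M : ℝ}
    (hS : IsEmbeddedSurface S) (hν : ∀ x ∈ S, ∃ ν, IsUnitNormal S x ν) (hBS : B ⊆ S)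
    (hB : IsCompact B) (hM : 0 < M) {N₀ : ℕ}
    (hd : ∀ N ≥ N₀, ∃ x : ℕ → E, IsDiscreteGeodesic S B p q M N x) :
    ∃ γ v a : ℝ → E, γ 0 = p ∧ γ 1 = q ∧ ContinuousOn a (Icc 0 1) ∧ ∀ t ∈ Icc (0 : ℝ) 1,
      γ t ∈ S ∧ HasDerivWithinAt γ (v t) (Icc 0 1) t ∧ HasDerivWithinAt v (a t) (Icc 0 1) t ∧
      ∀ w ∈ tangentSet S (γ t), mink (a t) w = 0 := by
  set I := Icc (0 : ℝ) 1
  have hx' : ∀ N : ℕ, ∃ x : ℕ → E, N₀ ≤ N → IsDiscreteGeodesic S B p q M N x := fun N => by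
    by_cases hN : N₀ ≤ N
    · obtain ⟨x, hx⟩ := hd N hN
      exact ⟨x, fun _ => hx⟩
    · exact ⟨0, fun h => absurd h hN⟩
  choose x hx using hx'
  -- A nonprincipal ultrafilter gives limits of positions and velocities at all times at once,
  -- without extracting subsequences.
  set U : Ultrafilter ℕ := hyperfilter ℕ
  have hU : (U : Filter ℕ) ≤ atTop := Nat.hyperfilter_le_atTop
  have hev : ∀ᶠ N in (U : Filter ℕ), 0 < N ∧ IsDiscreteGeodesic S B p q M N (x N) := by
    refine Eventually.filter_mono hU ?_
    filter_upwards [eventually_gt_atTop 0, eventually_ge_atTop N₀] with N h1 h2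
    exact ⟨h1, hx N h2⟩
  have hγ : ∀ t : ℝ, ∃ y ∈ B, Tendsto (fun N => x N (vertexIndex t N)) U (𝓝 y) := fun t =>
    exists_tendsto_ultrafilter_of_isCompact hB U (hev.mono fun N hN => hN.2.mem _)
  have hv : ∀ t : ℝ, ∃ y ∈ Metric.closedBall (0 : E) M,
      Tendsto (fun N => discreteVelocity N (x N) (vertexIndex t N)) U (𝓝 y) := fun t =>
    exists_tendsto_ultrafilter_of_isCompact (isCompact_closedBall 0 M) U (hev.mono fun N hN => by
      rw [mem_closedBall_zero_iff]
      exact hN.2.norm_velocity_le (vertexIndex_lt t hN.1))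
  choose γ hγB hγ using hγ
  choose v hvB hv using hv
  have hidx : ∀ t ∈ I, Tendsto (fun N : ℕ => (vertexIndex t N : ℝ) / N) U (𝓝 t) := fun t ht =>
    (tendsto_vertexIndex_div ht).mono_left hU
  have hidx2 : ∀ s ∈ I, ∀ t ∈ I, Tendsto (fun N : ℕ => |(vertexIndex t N : ℝ) / N
      - vertexIndex s N / N|) U (𝓝 |t - s|) := fun s hs t ht =>
    ((hidx t ht).sub (hidx s hs)).abs
  have hquad : ∀ s ∈ I, ∀ t ∈ I, ‖γ t - γ s - (t - s) • v s‖ ≤ M * |t - s| * |t - s| := by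
    intro s hs t ht
    refine le_of_tendsto_of_tendsto (((hγ t).sub (hγ s)).sub
      (((hidx t ht).sub (hidx s hs)).smul (hv s))).norm
      (((hidx2 s hs t ht).const_mul M).mul (hidx2 s hs t ht)) ?_
    filter_upwards [hev] with N hN using
      hN.2.norm_sub_sub_velocity_le hM.le (vertexIndex_lt s hN.1) (vertexIndex_lt t hN.1)
  have hγd : ∀ s ∈ I, HasDerivWithinAt γ (v s) I s := by
    intro s hs
    rw [hasDerivWithinAt_iff_isLittleO, Asymptotics.isLittleO_iff]
    intro ε hε
    have hnear : ∀ᶠ t in 𝓝[I] s, |t - s| < ε / M := by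
      refine Eventually.filter_mono nhdsWithin_le_nhds ?_
      filter_upwards [Metric.ball_mem_nhds s (div_pos hε hM)] with t ht
      rwa [Metric.mem_ball, Real.dist_eq] at ht
    filter_upwards [hnear, self_mem_nhdsWithin] with t h1 ht
    refine (hquad s hs t ht).trans ?_
    rw [Real.norm_eq_abs]
    refine mul_le_mul_of_nonneg_right ?_ (abs_nonneg _)
    rw [lt_div_iff₀ hM] at h1
    linarith
  have hvlip : ∀ s ∈ I, ∀ t ∈ I, ‖v t - v s‖ ≤ M * |t - s| := by
    intro s hs t ht
    refine le_of_tendsto_of_tendsto ((hv t).sub (hv s)).norm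
      ((hidx2 s hs t ht).const_mul M) ?_
    filter_upwards [hev] with N hN using
      hN.2.norm_velocity_sub_le (vertexIndex_lt s hN.1) (vertexIndex_lt t hN.1)
  have hvc : ContinuousOn v I := by
    intro s hs
    have h0 : Tendsto (fun t => M * |t - s|) (𝓝[I] s) (𝓝 0) := by
      have : Continuous fun t => M * |t - s| := by fun_prop
      simpa using (this.tendsto s).mono_left nhdsWithin_le_nhds
    refine tendsto_iff_norm_sub_tendsto_zero.mpr (squeeze_zero' (Eventually.of_forall
      fun t => norm_nonneg _) ?_ h0)
    filter_upwards [self_mem_nhdsWithin] with t ht using hvlip s hs t ht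
  have hγc : ContinuousOn γ I := fun s hs => (hγd s hs).continuousWithinAt
  -- Near s all discrete accelerations are close to the normal acceleration at (γ s, v s), up to an
  -- error O(1/N) that vanishes in the limit; summing them differentiates v.
  have hvd : ∀ s ∈ I, ∀ {W : Set E} {r ν : E → E}, IsLocalModel S W r ν → γ s ∈ W →
      HasDerivWithinAt v (normalAccel r ν (γ s) (v s)) I s := by
    intro s hs W r ν hm hW
    obtain ⟨δ, hδ, C, hC, -, -, hsec⟩ := hm.exists_secondDifference_le hS.1 hW
    set a := normalAccel r ν (γ s) (v s)
    rw [hasDerivWithinAt_iff_isLittleO, Asymptotics.isLittleO_iff]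
    intro ε hε
    have hcont : ContinuousAt (fun z : E × E => normalAccel r ν z.1 z.2) (γ s, v s) :=
      hm.continuousOn_normalAccel.continuousAt
        ((hm.isOpen.prod isOpen_univ).mem_nhds ⟨hW, mem_univ _⟩)
    obtain ⟨η, hη, hball⟩ := Metric.mem_nhds_iff.mp
      (hcont.preimage_mem_nhds (Metric.ball_mem_nhds a (half_pos hε)))
    -- Vertices between the two indices stay within κ/4 + κ/4 of γ s, and the extra vertex k + 2 of
    -- a second difference adds less than κ/4.
    set κ := min δ η with hκ
    have hκ0 : 0 < κ := lt_min hδ hη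
    have hnear : ∀ᶠ t in 𝓝[I] s, |t - s| < κ / (4 * M) := by
      refine Eventually.filter_mono nhdsWithin_le_nhds ?_
      filter_upwards [Metric.ball_mem_nhds s (div_pos hκ0 (by positivity : 0 < 4 * M))] with t ht
      rwa [Metric.mem_ball, Real.dist_eq] at ht
    filter_upwards [hnear, self_mem_nhdsWithin] with t h1 ht
    rw [lt_div_iff₀ (by positivity)] at h1
    refine le_of_tendsto_of_tendsto (((hv t).sub (hv s)).sub
      (((hidx t ht).sub (hidx s hs)).smul_const a)).norm
      ((hidx2 s hs t ht).const_mul ε) ?_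
    have e1 : ∀ᶠ N in (U : Filter ℕ), |(vertexIndex t N : ℝ) / N - vertexIndex s N / N| * (4 * M)
        < κ := ((hidx2 s hs t ht).mul_const _).eventually_lt_const h1
    have e2 : ∀ᶠ N in (U : Filter ℕ), ‖x N (vertexIndex s N) - γ s‖ < κ / 4 := by
      filter_upwards [(hγ s).eventually (Metric.ball_mem_nhds _ (by positivity :
        0 < κ / 4))] with N hN
      rwa [dist_eq_norm] at hN
    have e3 : ∀ᶠ N in (U : Filter ℕ),
        ‖discreteVelocity N (x N) (vertexIndex s N) - v s‖ < κ / 4 := by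
      filter_upwards [(hv s).eventually (Metric.ball_mem_nhds _ (by positivity :
        0 < κ / 4))] with N hN
      rwa [dist_eq_norm] at hN
    have hinv : Tendsto (fun N : ℕ => (N : ℝ)⁻¹) U (𝓝 0) :=
      tendsto_inv_atTop_nhds_zero_nat.mono_left hU
    have e4 : ∀ᶠ N : ℕ in (U : Filter ℕ), 2 * C * M ^ 3 * (N : ℝ)⁻¹ < ε / 2 := by
      have := hinv.const_mul (2 * C * M ^ 3)
      rw [mul_zero] at this
      exact this.eventually_lt_const (half_pos hε)
    have e5 : ∀ᶠ N : ℕ in (U : Filter ℕ), M * (N : ℝ)⁻¹ < κ / 4 := by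
      have := hinv.const_mul M
      rw [mul_zero] at this
      exact this.eventually_lt_const (by positivity)
    filter_upwards [hev, e1, e2, e3, e4, e5] with N hN e1 e2 e3 e4 e5
    obtain ⟨hN0, hN⟩ := hN
    have hN' : (0 : ℝ) < N := by exact_mod_cast hN0
    set i := vertexIndex s N with hi
    set j := vertexIndex t N with hj
    have hiN : i < N := vertexIndex_lt s hN0
    have hjN : j < N := vertexIndex_lt t hN0
    have hkl : ∀ k, min i j ≤ k → k ≤ max i j →
        |(k : ℝ) / N - i / N| ≤ |(j : ℝ) / N - i / N| := by
      intro k hk1 hk2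
      rw [← sub_div, ← sub_div, abs_div, abs_div]
      refine div_le_div_of_nonneg_right ?_ (abs_nonneg _)
      rcases le_total i j with hij | hij
      · rw [min_eq_left hij] at hk1
        rw [max_eq_right hij] at hk2
        have c1 : (i : ℝ) ≤ k := by exact_mod_cast hk1
        have c2 : (k : ℝ) ≤ j := by exact_mod_cast hk2
        rw [abs_of_nonneg (by linarith), abs_of_nonneg (by linarith)]
        linarith
      · rw [min_eq_right hij] at hk1
        rw [max_eq_left hij] at hk2
        have c1 : (j : ℝ) ≤ k := by exact_mod_cast hk1
        have c2 : (k : ℝ) ≤ i := by exact_mod_cast hk2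
        rw [abs_of_nonpos (by linarith), abs_of_nonpos (by linarith)]
        linarith
    have hx1 : ∀ k, min i j ≤ k → k ≤ max i j → ‖x N k - γ s‖ < κ / 2 := by
      intro k hk1 hk2
      have hkN : k < N := hk2.trans_lt (max_lt hiN hjN)
      have h2 := (hN.norm_sub_le hiN hkN).trans
        (mul_le_mul_of_nonneg_left (hkl k hk1 hk2) hM.le)
      have h3 := norm_sub_le_norm_sub_add_norm_sub (x N k) (x N i) (γ s)
      linarith
    have hx2 : ∀ k, min i j ≤ k → k ≤ max i j →
        ‖discreteVelocity N (x N) k - v s‖ < κ / 2 := by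
      intro k hk1 hk2
      have hkN : k < N := hk2.trans_lt (max_lt hiN hjN)
      have h2 := (hN.norm_velocity_sub_le hiN hkN).trans
        (mul_le_mul_of_nonneg_left (hkl k hk1 hk2) hM.le)
      have h3 := norm_sub_le_norm_sub_add_norm_sub (discreteVelocity N (x N) k)
        (discreteVelocity N (x N) i) (v s)
      linarith
    have hκδ : κ ≤ δ := min_le_left _ _
    have hκη : κ ≤ η := min_le_right _ _
    have hacc : ∀ y w, ‖y - γ s‖ < κ / 2 → ‖w - v s‖ < κ / 2 →
        ‖normalAccel r ν y w - a‖ ≤ ε / 2 := by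
      intro y w hy hw
      have : (y, w) ∈ Metric.ball (γ s, v s) η := by
        rw [Metric.mem_ball, Prod.dist_eq, max_lt_iff, dist_eq_norm, dist_eq_norm]
        constructor <;> linarith
      have := hball this
      rw [mem_preimage, Metric.mem_ball, dist_eq_norm] at this
      exact this.le
    have key := norm_sub_sub_smul_le (V := discreteVelocity N (x N)) (a := (N : ℝ)⁻¹ • a)
      (e := (N : ℝ)⁻¹ * ε) (i := i) (j := j) fun k hk1 hk2 => by
        have hkN : k + 1 < N := by
          have : max i j < N := max_lt hiN hjN
          omega
        have y0 := hx1 k hk1 hk2.le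
        have y1 := hx1 (k + 1) (by omega) hk2
        have y2 : ‖x N (k + 2) - γ s‖ < κ := by
          have h2 := hN.step_le (k + 1) hkN
          rw [div_eq_mul_inv] at h2
          have h3 := norm_sub_le_norm_sub_add_norm_sub (x N (k + 2)) (x N (k + 1)) (γ s)
          have h4 : x N (k + 1 + 1) = x N (k + 2) := rfl
          rw [h4] at h2
          linarith
        have hb : ∀ y, ‖y - γ s‖ < κ → y ∈ Metric.ball (γ s) δ := fun y hy => by
          rw [Metric.mem_ball, dist_eq_norm]; linarith
        refine (hN.norm_accel_sub_le hC hBS hsec hkN (hb _ (by linarith)) (hb _ (by linarith))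
          (hb _ y2) (hacc _ _ y1 (hx2 k hk1 hk2.le))
          (hacc _ _ y1 (hx2 (k + 1) (by omega) hk2))).trans ?_
        exact mul_le_mul_of_nonneg_left (by linarith) (by positivity)
    rw [smul_smul, ← div_eq_mul_inv, sub_div] at key
    refine key.trans (le_of_eq ?_)
    rw [← sub_div, abs_div, abs_of_pos hN']
    field_simp
  have hmodel : ∀ s ∈ I, ∃ (W : Set E) (r ν : E → E), γ s ∈ W ∧ IsLocalModel S W r ν := by
    intro s _
    obtain ⟨ν, hν⟩ := hν _ (hBS (hγB s))
    exact hS.exists_isLocalModel (hBS (hγB s)) hν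
  have hUD : UniqueDiffOn ℝ I := uniqueDiffOn_Icc zero_lt_one
  -- The normal acceleration is written through a local model, so the global acceleration is taken
  -- to be the derivative of v and identified with it locally.
  refine ⟨γ, v, derivWithin v I, ?_, ?_, ?_, fun t ht => ⟨hBS (hγB t), hγd t ht, ?_, ?_⟩⟩
  · refine tendsto_nhds_unique (hγ 0) ((tendsto_const_nhds (x := p)).congr' ?_)
    filter_upwards [hev] with N hN
    simp [vertexIndex, hN.2.source]
  -- The index at time 1 is N - 1 instead of N; the missing last step has length at most M/N.
  · refine tendsto_nhds_unique (hγ 1) ?_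
    rw [tendsto_iff_norm_sub_tendsto_zero]
    have hlim : Tendsto (fun N : ℕ => M / (N : ℝ)) U (𝓝 0) :=
      (tendsto_const_div_atTop_nhds_zero_nat M).mono_left hU
    refine squeeze_zero' (Eventually.of_forall fun _ => norm_nonneg _) ?_ hlim
    filter_upwards [hev] with N hN
    obtain ⟨hN0, hN⟩ := hN
    have h1 : vertexIndex 1 N = N - 1 := by simp [vertexIndex]
    have h2 := hN.step_le (N - 1) (by omega)
    rw [Nat.sub_add_cancel hN0, hN.target, norm_sub_rev] at h2
    rwa [h1]
  · intro s hs
    obtain ⟨W, r, ν, hW, hm⟩ := hmodel s hs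
    have hc : ContinuousWithinAt (fun t => normalAccel r ν (γ t) (v t)) I s := by
      have h1 : ContinuousAt (fun z : E × E => normalAccel r ν z.1 z.2) (γ s, v s) :=
        hm.continuousOn_normalAccel.continuousAt
          ((hm.isOpen.prod isOpen_univ).mem_nhds ⟨hW, mem_univ _⟩)
      exact ContinuousAt.comp_continuousWithinAt (f := fun t => (γ t, v t)) h1
        ((hγc s hs).prodMk (hvc s hs))
    have heq : ∀ t ∈ I, γ t ∈ W → derivWithin v I t = normalAccel r ν (γ t) (v t) :=
      fun t ht htW => (hvd t ht hm htW).derivWithin (hUD t ht)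
    refine hc.congr_of_eventuallyEq ?_ (heq s hs hW)
    filter_upwards [self_mem_nhdsWithin,
      (hγc s hs).eventually_mem (hm.isOpen.mem_nhds hW)] with t ht htW using heq t ht htW
  · obtain ⟨W, r, ν, hW, hm⟩ := hmodel t ht
    exact (hvd t ht hm hW).differentiableWithinAt.hasDerivWithinAt
  · intro w hw
    obtain ⟨W, r, ν, hW, hm⟩ := hmodel t ht
    rw [(hvd t ht hm hW).derivWithin (hUD t ht)]
    exact hm.mink_normalPart hS.1 (hBS (hγB t)) hW hw _

/-- A curve with normal acceleration between distinct points can be parametrized by arc length. -/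
lemma IsEmbeddedSurface.exists_isGeodesicSegment_of_curve {S : Set E} {p q : E}
    (hS : IsEmbeddedSurface S) (hν : ∀ x ∈ S, ∃ ν, IsUnitNormal S x ν) (hpq : p ≠ q)
    {γ v a : ℝ → E} (h0 : γ 0 = p) (h1 : γ 1 = q) (ha : ContinuousOn a (Icc 0 1))
    (h : ∀ t ∈ Icc (0 : ℝ) 1, γ t ∈ S ∧ HasDerivWithinAt γ (v t) (Icc 0 1) t ∧
      HasDerivWithinAt v (a t) (Icc 0 1) t ∧ ∀ w ∈ tangentSet S (γ t), mink (a t) w = 0) :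
    ∃ L γ', IsGeodesicSegment S p q L γ' := by
  set I := Icc (0 : ℝ) 1
  have hI0 : (0 : ℝ) ∈ I := ⟨le_rfl, zero_le_one⟩
  have hUI : UniqueDiffOn ℝ I := uniqueDiffOn_Icc zero_lt_one
  have hvT : ∀ t ∈ I, v t ∈ tangentSet S (γ t) := by
    intro t ht
    obtain ⟨ν, hν⟩ := hν _ (h t ht).1
    obtain ⟨W, r, N, hW, hm⟩ := hS.exists_isLocalModel (h t ht).1 hν
    exact (hm.curve_derivatives hS.1 zero_lt_one (fun s hs => (h s hs).2.1)
      (fun s hs => (h s hs).1) ht (h t ht).2.2.1 hW).1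
  set l := mink (v 0) (v 0) with hl
  -- The acceleration is orthogonal to the tangent velocity, so the speed is constant; it is nonzero
  -- because the end points differ.
  have hconst : ∀ t ∈ I, mink (v t) (v t) = l := by
    have hd : ∀ t ∈ I, HasDerivWithinAt (fun t => mink (v t) (v t)) 0 I t := by
      intro t ht
      have h2 := hasDerivWithinAt_mink (h t ht).2.2.1 (h t ht).2.2.1
      have h3 := (h t ht).2.2.2 _ (hvT t ht)
      rw [mink_comm (v t), h3, add_zero] at h2
      exact h2
    exact constant_of_derivWithin_zero (fun t ht => (hd t ht).differentiableWithinAt)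
      (fun t ht => (hd t ⟨ht.1, ht.2.le⟩).derivWithin (hUI t ⟨ht.1, ht.2.le⟩))
  have hlpos : 0 < l := by
    have hne : ∃ t ∈ I, v t ≠ 0 := by
      by_contra! hcon
      refine hpq ?_
      have := constant_of_derivWithin_zero (f := γ)
        (fun t ht => (h t ht).2.1.differentiableWithinAt)
        (fun t ht => by
          have ht' : t ∈ I := ⟨ht.1, ht.2.le⟩
          rw [(h t ht').2.1.derivWithin (hUI t ht'), hcon t ht']) 1 ⟨zero_le_one, le_rfl⟩
      rw [← h0, ← h1, this]
    obtain ⟨t, ht, hvt⟩ := hne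
    rw [← hconst t ht]
    exact mink_self_pos_of_orthogonal (hS.1 (h t ht).1).1
      (mink_eq_zero_of_mem_tangentSet hS.1 (hvT t ht)) hvt
  set L := Real.sqrt l
  have hL : 0 < L := Real.sqrt_pos.mpr hlpos
  have hLl : L * L = l := Real.mul_self_sqrt hlpos.le
  have hUL : UniqueDiffOn ℝ (Icc 0 L) := uniqueDiffOn_Icc hL
  have hmaps : MapsTo (fun t => L⁻¹ * t) (Icc 0 L) I := by
    intro t ht
    refine ⟨mul_nonneg (inv_nonneg.mpr hL.le) ht.1, ?_⟩
    rw [inv_mul_le_iff₀ hL, mul_one]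
    exact ht.2
  have hscale : ∀ {f : ℝ → E} {f' : E} {t : ℝ}, HasDerivWithinAt f f' I (L⁻¹ * t) →
      HasDerivWithinAt (fun t => f (L⁻¹ * t)) (L⁻¹ • f') (Icc 0 L) t := by
    intro f f' t hf
    have hlin : HasDerivWithinAt (fun t => L⁻¹ * t) L⁻¹ (Icc 0 L) t := by
      simpa using ((hasDerivAt_id t).const_mul L⁻¹).hasDerivWithinAt
    exact hf.scomp t hlin hmaps
  have hd1 : ∀ t ∈ Icc 0 L, HasDerivWithinAt (fun t => γ (L⁻¹ * t)) (L⁻¹ • v (L⁻¹ * t))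
      (Icc 0 L) t := fun t ht => hscale (h _ (hmaps ht)).2.1
  have hd2 : ∀ t ∈ Icc 0 L, HasDerivWithinAt (fun t => L⁻¹ • v (L⁻¹ * t))
      (L⁻¹ • L⁻¹ • a (L⁻¹ * t)) (Icc 0 L) t := fun t ht =>
    (hscale (h _ (hmaps ht)).2.2.1).fun_const_smul L⁻¹
  have e1 : ∀ t ∈ Icc 0 L, derivWithin (fun t => γ (L⁻¹ * t)) (Icc 0 L) t = L⁻¹ • v (L⁻¹ * t) :=
    fun t ht => (hd1 t ht).derivWithin (hUL t ht)
  have e2 : ∀ t ∈ Icc 0 L, derivWithin (derivWithin (fun t => γ (L⁻¹ * t)) (Icc 0 L)) (Icc 0 L) t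
      = L⁻¹ • L⁻¹ • a (L⁻¹ * t) := fun t ht => by
    rw [derivWithin_congr e1 (e1 t ht)]
    exact (hd2 t ht).derivWithin (hUL t ht)
  have hac : ContinuousOn (fun t => L⁻¹ • L⁻¹ • a (L⁻¹ * t)) (Icc 0 L) :=
    ((ha.comp (by fun_prop) hmaps).const_smul L⁻¹).const_smul L⁻¹
  refine ⟨L, fun t => γ (L⁻¹ * t), hL.le, ?_, fun t ht => (h _ (hmaps ht)).1, by simp [h0], ?_,
    ?_, ?_⟩
  · have h1' : ContDiffOn ℝ (0 + 1) (derivWithin (fun t => γ (L⁻¹ * t)) (Icc 0 L)) (Icc 0 L) := by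
      rw [contDiffOn_succ_iff_derivWithin hUL]
      refine ⟨fun t ht => ((hd2 t ht).congr e1 (e1 t ht)).differentiableWithinAt, by simp, ?_⟩
      rw [contDiffOn_zero]
      exact hac.congr e2
    have h2' : ContDiffOn ℝ (1 + 1) (fun t => γ (L⁻¹ * t)) (Icc 0 L) := by
      rw [contDiffOn_succ_iff_derivWithin hUL]
      exact ⟨fun t ht => (hd1 t ht).differentiableWithinAt, by simp, by simpa using h1'⟩
    simpa [one_add_one_eq_two] using h2'
  · simp [inv_mul_cancel₀ hL.ne', h1]
  · intro t ht
    rw [e1 t ht]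
    simp only [mink_smul_left, mink_smul_right, hconst _ (hmaps ht)]
    rw [← hLl]
    field_simp
  · intro t ht w hw
    have h2 := mink_eq_zero_of_mem_tangentSet hS.1 hw
    rw [e2 t ht, tangentProj, mink_add_left, mink_smul_left, mink_smul_left, mink_smul_left,
      (h _ (hmaps ht)).2.2.2 w hw, mink_comm _ w, h2]
    ring

/-- In a complete connected surface any two distinct points are joined by a geodesic. -/
theorem IsEmbeddedSurface.exists_isGeodesicSegment {S : Set E} {p q : E}
    (hS : IsEmbeddedSurface S) (hν : ∀ x ∈ S, ∃ ν, IsUnitNormal S x ν) (hconn : IsConnected S)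
    (hcomp : IsCompleteSurface S) (hp : p ∈ S) (hq : q ∈ S) (hpq : p ≠ q) :
    ∃ L γ, IsGeodesicSegment S p q L γ := by
  obtain ⟨B, hBS, hB, M, hM, N₀, hd⟩ := hS.exists_isDiscreteGeodesic hν hconn hcomp hp hq
  obtain ⟨γ, v, a, h0, h1, ha, h⟩ := hS.exists_limit_curve hν hBS hB hM hd
  exact hS.exists_isGeodesicSegment_of_curve hν hpq h0 h1 ha h

end HypSurf

/-! ### The main theorem -/

theorem mainTheorem6 (S : Set E) (hS : IsEmbeddedSurface S)
    (hk : ∀ x ∈ S, ∀ k : ℝ, IsPrincipalCurvature S x k → |k| ≤ 1)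
    (ν : E → E) (hν : ∀ x ∈ S, IsUnitNormal S x (ν x))
    (n p q : E) (hpq : p ≠ q)
    (hp : IsOuterTangentHorosphere S n p (ν p))
    (hq : IsOuterTangentHorosphere S n q (ν q)) :
    (∀ (L : ℝ) (γ : ℝ → E), IsGeodesicSegment S p q L γ →
      γ '' Icc 0 L ⊆ horosphere n ∩ S ∧
      IsGeodesicSegment (horosphere n) p q L γ ∧
      IsLineOfCurvature S L γ) ∧
    (IsConnected S → IsCompleteSurface S →
      ∃ (L : ℝ) (γ : ℝ → E), IsGeodesicSegment S p q L γ ∧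
        ∀ (L' : ℝ) (γ' : ℝ → E), IsGeodesicSegment S p q L' γ' →
          L' = L ∧ EqOn γ' γ (Icc 0 L)) := by
  have hν' : ∀ x ∈ S, ∃ ν, IsUnitNormal S x ν := fun x hx => ⟨ν x, hν x hx⟩
  have key : ∀ {L : ℝ} {γ : ℝ → E}, IsGeodesicSegment S p q L γ → ∀ t ∈ Icc 0 L,
      mink (γ t) n = -1 ∧ mink (derivWithin γ (Icc 0 L) t) n = 0 ∧
      derivWithin (derivWithin γ (Icc 0 L)) (Icc 0 L) t = n ∧
      ∃ k, IsPrincipalDirection S (γ t) k (derivWithin γ (Icc 0 L) t) := fun h t ht =>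
    h.mem_horosphere (h.length_pos hpq) hS hk hν' hp.null.1 hp.mem_horosphere.2
      hq.mem_horosphere.2 hp.disjoint ht
  refine ⟨fun L γ h => ⟨?_, ?_, fun t ht => (key h t ht).2.2.2⟩, fun hconn hcomp => ?_⟩
  · rintro _ ⟨t, ht, rfl⟩
    exact ⟨⟨hS.1 (h.mem t ht), (key h t ht).1⟩, h.mem t ht⟩
  · exact h.horosphere hS.1 fun t ht => ⟨(key h t ht).1, (key h t ht).2.2.1⟩
  -- Any geodesic serves as witness: every other one also has acceleration n, so the parabola
  -- through p and q is the same.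
  · obtain ⟨L, γ, h⟩ := hS.exists_isGeodesicSegment hν' hconn hcomp hp.mem_surface
      hq.mem_surface hpq
    exact ⟨L, γ, h, fun L' γ' h' => h.unique h' (h.length_pos hpq) (h'.length_pos hpq) hp.null.1
      (fun t ht => ⟨(key h t ht).2.1, (key h t ht).2.2.1⟩)
      (fun t ht => ⟨(key h' t ht).2.1, (key h' t ht).2.2.1⟩)⟩
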